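/- For $\theta\in(0,\frac\pi2)$ let $$\Omega_\theta=\Big\{(x_1,x_2)\in\mathbb R^2:\ x_1\tan\theta<|x_2|<\Big(x_1+\frac{\pi}{\sin\theta}\Big)\tan\theta\Big\}$$ be the broken guide with half-opening $\theta$, and let $\Delta^{\mathsf{Dir}}_{\Omega_\theta}$ be the positive Dirichlet Laplacian on $\Omega_\theta$, that is, the unbounded operator $u\mapsto-\Delta u$ (in the sense of distributions) in the complex Hilbert space $L^2(\Omega_\theta)$ with domain $\{u\in H^1_0(\Omega_\theta):\ \Delta u\in L^2(\Omega_\theta)\}$, where $H^1_0(\Omega_\theta)$ is the closure of $C_c^\infty(\Omega_\theta)$ in $H^1(\Omega_\theta)$. The essential spectrum $\sigma_{\mathsf{ess}}(A)$ of an operator $A$ with domain $\mathsf{Dom}(A)$ in a complex Hilbert space $H$ is the set of $\lambda\in\mathbb C$ such that $A-\lambda\,\mathrm{Id}$ is not Fredholm from $\mathsf{Dom}(A)$ into $H$; Fredholm means that the kernel is finite dimensional and that the range is closed and of finite codimension. Then, for every $\theta\in(0,\frac\pi2)$, $$\sigma_{\mathsf{ess}}\big(\Delta^{\mathsf{Dir}}_{\Omega_\theta}\big)=[1,+\infty).$$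 -/

import Mathlib

open MeasureTheory TopologicalSpace
open scoped ENNReal ContDiff Distributions

noncomputable section

namespace BrokenGuide

/-! ### Essential spectrum of an unbounded operator -/

section Spectrum

variable {H : Type*} [NormedAddCommGroup H] [InnerProductSpace ℂ H]

/-- `A - z Id`, as a linear map from `Dom(A)` into `H`. -/
def subScalar (A : H →ₗ.[ℂ] H) (z : ℂ) : A.domain →ₗ[ℂ] H :=
  A.toFun - z • A.domain.subtype

/-- A linear map `T : D → H` is Fredholm if its kernel is finite dimensional and its range is closed
with finite codimension. It is meant for unbounded operators (`D` a subspace of `H` on which `T` is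
closed but not continuous for the norm of `H`), so that `ContinuousLinearMap.IsFredholm` does not
apply. -/
structure IsFredholm {D : Type*} [AddCommGroup D] [Module ℂ D] (T : D →ₗ[ℂ] H) : Prop where
  finite_ker : FiniteDimensional ℂ (LinearMap.ker T)
  isClosed_range : IsClosed (LinearMap.range T : Set H)
  finite_coker : FiniteDimensional ℂ (H ⧸ LinearMap.range T)

/-- The essential spectrum of `A`: the complex numbers `z` such that `A - z Id` is not Fredholm
from `Dom(A)` into `H`. -/
def essentialSpectrum (A : H →ₗ.[ℂ] H) : Set ℂ :=
  {z | ¬ IsFredholm (subScalar A z)}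

end Spectrum

/-! ### The Dirichlet Laplacian on an open subset of `ℝᵈ` -/

section Dirichlet

variable {d : ℕ} (Ω : Opens (EuclideanSpace ℝ (Fin d)))

/-- The complex Hilbert space `L²(Ω)`. -/
abbrev L2 : Type :=
  Lp ℂ 2 (volume.restrict (Ω : Set (EuclideanSpace ℝ (Fin d))))

variable {Ω}

/-- The partial derivative `∂ᵢ φ` of a function on `ℝᵈ`. -/
def partialDeriv (i : Fin d) (φ : EuclideanSpace ℝ (Fin d) → ℂ) (x : EuclideanSpace ℝ (Fin d)) : ℂ :=
  fderiv ℝ φ x (EuclideanSpace.single i 1)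

/-- `g` is the weak gradient of `u` in `Ω`: `∫ u ∂ᵢφ = - ∫ gᵢ φ` for all test functions. -/
def IsWeakGradient (u : L2 Ω) (g : Fin d → L2 Ω) : Prop :=
  ∀ (φ : 𝓓(Ω, ℂ)) (i : Fin d),
    ∫ x in (Ω : Set (EuclideanSpace ℝ (Fin d))), u x * partialDeriv i φ x =
      - ∫ x in (Ω : Set (EuclideanSpace ℝ (Fin d))), g i x * φ x

/-- `f = Δu` in the sense of distributions in `Ω`: `∫ u Δφ = ∫ f φ` for all test functions. -/
def IsWeakLaplacian (u f : L2 Ω) : Prop :=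
  ∀ φ : 𝓓(Ω, ℂ),
    ∫ x in (Ω : Set (EuclideanSpace ℝ (Fin d))), u x * Laplacian.laplacian (φ : _ → ℂ) x =
      ∫ x in (Ω : Set (EuclideanSpace ℝ (Fin d))), f x * φ x

/-- `u ∈ H¹₀(Ω)`: `u` belongs to `H¹(Ω)` (it has a weak gradient `g` in `L²(Ω)`), and it is a limit
of test functions in the norm of `H¹(Ω)`. -/
def MemH10 (u : L2 Ω) : Prop :=
  ∃ g : Fin d → L2 Ω, IsWeakGradient u g ∧
    ∀ ε : ℝ≥0∞, 0 < ε → ∃ φ : 𝓓(Ω, ℂ),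
      eLpNorm (fun x => u x - φ x) 2 (volume.restrict (Ω : Set (EuclideanSpace ℝ (Fin d)))) < ε ∧
      ∀ i, eLpNorm (fun x => g i x - partialDeriv i φ x) 2
        (volume.restrict (Ω : Set (EuclideanSpace ℝ (Fin d)))) < ε

lemma continuous_partialDeriv (φ : 𝓓(Ω, ℂ)) (i : Fin d) : Continuous (partialDeriv i φ) :=
  (φ.contDiff.continuous_fderiv (by simp)).clm_apply continuous_const

lemma hasCompactSupport_partialDeriv (φ : 𝓓(Ω, ℂ)) (i : Fin d) :
    HasCompactSupport (partialDeriv i φ) :=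
  φ.hasCompactSupport.fderiv_apply (𝕜 := ℝ) (EuclideanSpace.single i 1)

lemma continuous_laplacian (φ : 𝓓(Ω, ℂ)) : Continuous (Laplacian.laplacian (φ : _ → ℂ)) := by
  rw [InnerProductSpace.laplacian_eq_iteratedFDeriv_stdOrthonormalBasis]
  refine continuous_finsetSum _ fun i _ => ?_
  have h := φ.contDiff.continuous_iteratedFDeriv (m := 2) (by
    exact WithTop.coe_le_coe.mpr (le_top : (2 : ℕ∞) ≤ ⊤))
  fun_prop

lemma hasCompactSupport_laplacian (φ : 𝓓(Ω, ℂ)) :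
    HasCompactSupport (Laplacian.laplacian (φ : _ → ℂ)) := by
  refine (φ.hasCompactSupport.iteratedFDeriv (𝕜 := ℝ) 2).mono ?_
  intro x hx h0
  apply hx
  rw [InnerProductSpace.laplacian_eq_iteratedFDeriv_stdOrthonormalBasis]
  simp only [h0, zero_apply, Finset.sum_const_zero]

lemma integrable_pair (u : L2 Ω) {ψ : EuclideanSpace ℝ (Fin d) → ℂ} (hc : Continuous ψ)
    (hs : HasCompactSupport ψ) :
    Integrable (fun x => u x * ψ x) (volume.restrict (Ω : Set (EuclideanSpace ℝ (Fin d)))) :=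
  (Lp.memLp u).integrable_mul (q := 2) (hc.memLp_of_hasCompactSupport hs)

lemma pair_add (u v : L2 Ω) {ψ : EuclideanSpace ℝ (Fin d) → ℂ} (hc : Continuous ψ)
    (hs : HasCompactSupport ψ) :
    ∫ x in (Ω : Set (EuclideanSpace ℝ (Fin d))), (u + v : L2 Ω) x * ψ x =
      (∫ x in (Ω : Set (EuclideanSpace ℝ (Fin d))), u x * ψ x) +
        ∫ x in (Ω : Set (EuclideanSpace ℝ (Fin d))), v x * ψ x := by
  rw [← integral_add (integrable_pair u hc hs) (integrable_pair v hc hs)]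
  refine integral_congr_ae ?_
  filter_upwards [Lp.coeFn_add u v] with x hx
  rw [hx, Pi.add_apply, add_mul]

lemma pair_smul (c : ℂ) (u : L2 Ω) (ψ : EuclideanSpace ℝ (Fin d) → ℂ) :
    ∫ x in (Ω : Set (EuclideanSpace ℝ (Fin d))), (c • u : L2 Ω) x * ψ x =
      c * ∫ x in (Ω : Set (EuclideanSpace ℝ (Fin d))), u x * ψ x := by
  rw [← integral_const_mul]
  refine integral_congr_ae ?_
  filter_upwards [Lp.coeFn_smul c u] with x hx
  rw [hx, Pi.smul_apply, smul_eq_mul, mul_assoc]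

lemma IsWeakLaplacian.add {u v f g : L2 Ω} (hu : IsWeakLaplacian u f) (hv : IsWeakLaplacian v g) :
    IsWeakLaplacian (u + v) (f + g) := fun φ => by
  rw [pair_add u v (continuous_laplacian φ) (hasCompactSupport_laplacian φ),
    pair_add f g φ.continuous φ.hasCompactSupport, hu φ, hv φ]

lemma IsWeakLaplacian.smul {u f : L2 Ω} (c : ℂ) (hu : IsWeakLaplacian u f) :
    IsWeakLaplacian (c • u) (c • f) := fun φ => by
  rw [pair_smul, pair_smul, hu φ]

/-- The distributional Laplacian, when it is in `L²(Ω)`, is unique. -/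
lemma IsWeakLaplacian.unique {u f g : L2 Ω} (hf : IsWeakLaplacian u f)
    (hg : IsWeakLaplacian u g) : f = g := by
  have hloc : ∀ h : L2 Ω, LocallyIntegrable h
      (volume.restrict (Ω : Set (EuclideanSpace ℝ (Fin d)))) := fun h =>
    (Lp.memLp h).locallyIntegrable (by norm_num)
  have key := Ω.isOpen.ae_eq_zero_of_integral_contDiff_smul_eq_zero
    (((hloc f).sub (hloc g)).locallyIntegrableOn Ω) (by
      intro φ hφ hc hs
      let ψ : 𝓓(Ω, ℂ) := ⟨fun x => (φ x : ℂ), Complex.ofRealCLM.contDiff.comp hφ,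
        hc.comp_left (g := Complex.ofReal) Complex.ofReal_zero,
        (closure_mono (Function.support_comp_subset Complex.ofReal_zero φ)).trans hs⟩
      have h1 := (hf ψ).symm.trans (hg ψ)
      rw [← sub_eq_zero, ← integral_sub (integrable_pair f ψ.continuous ψ.hasCompactSupport)
        (integrable_pair g ψ.continuous ψ.hasCompactSupport)] at h1
      rw [← h1]
      refine integral_congr_ae (Filter.Eventually.of_forall fun x => ?_)
      change (φ x) • (f x - g x) = f x * (φ x : ℂ) - g x * (φ x : ℂ)
      rw [Complex.real_smul]
      ring)
  refine Lp.ext ?_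
  filter_upwards [key, ae_restrict_mem Ω.isOpen.measurableSet] with x hx hxm
  exact sub_eq_zero.mp (hx hxm)

lemma MemH10.zero : MemH10 (0 : L2 Ω) := by
  refine ⟨0, fun φ i => ?_, fun ε hε => ⟨0, ?_, fun i => ?_⟩⟩
  · have h := pair_smul (Ω := Ω) 0 0 (partialDeriv i φ)
    have h' := pair_smul (Ω := Ω) 0 0 φ
    rw [zero_smul, zero_mul] at h h'
    rw [h, Pi.zero_apply, h', neg_zero]
  · refine lt_of_eq_of_lt ((eLpNorm_congr_ae ?_).trans eLpNorm_zero) hε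
    filter_upwards [Lp.coeFn_zero ℂ 2 (volume.restrict (Ω : Set (EuclideanSpace ℝ (Fin d))))]
      with x hx
    rw [hx]
    exact sub_self (0 : ℂ)
  · refine lt_of_eq_of_lt ((eLpNorm_congr_ae ?_).trans eLpNorm_zero) hε
    filter_upwards [Lp.coeFn_zero ℂ 2 (volume.restrict (Ω : Set (EuclideanSpace ℝ (Fin d))))]
      with x hx
    have h0 : ((0 : 𝓓(Ω, ℂ)) : EuclideanSpace ℝ (Fin d) → ℂ) = fun _ => 0 := by
      ext; simp
    have hd : partialDeriv i ((0 : 𝓓(Ω, ℂ)) : _ → ℂ) x = 0 := by simp [partialDeriv, h0]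
    rw [hd, Pi.zero_apply, hx]
    exact sub_self (0 : ℂ)

lemma MemH10.add {u v : L2 Ω} (hu : MemH10 u) (hv : MemH10 v) : MemH10 (u + v) := by
  obtain ⟨g, hg, hga⟩ := hu
  obtain ⟨h, hh, hha⟩ := hv
  refine ⟨g + h, fun φ i => ?_, fun ε hε => ?_⟩
  · rw [pair_add u v (continuous_partialDeriv φ i) (hasCompactSupport_partialDeriv φ i),
      Pi.add_apply, pair_add _ _ φ.continuous φ.hasCompactSupport, hg φ i, hh φ i, neg_add]
  · obtain ⟨φ, h1, h2⟩ := hga (ε / 2) (ENNReal.half_pos hε.ne')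
    obtain ⟨ψ, h3, h4⟩ := hha (ε / 2) (ENNReal.half_pos hε.ne')
    refine ⟨φ + ψ, ?_, fun i => ?_⟩
    · refine lt_of_le_of_lt ?_ ((ENNReal.add_lt_add h1 h3).trans_eq (ENNReal.add_halves ε))
      refine le_trans (le_of_eq (eLpNorm_congr_ae ?_)) (eLpNorm_add_le
        ((Lp.aestronglyMeasurable u).sub φ.continuous.aestronglyMeasurable)
        ((Lp.aestronglyMeasurable v).sub ψ.continuous.aestronglyMeasurable) (by norm_num))
      filter_upwards [Lp.coeFn_add u v] with x hx
      rw [hx]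
      exact add_sub_add_comm (u x) (v x) (φ x) (ψ x)
    · refine lt_of_le_of_lt ?_ ((ENNReal.add_lt_add (h2 i) (h4 i)).trans_eq (ENNReal.add_halves ε))
      refine le_trans (le_of_eq (eLpNorm_congr_ae ?_)) (eLpNorm_add_le
        ((Lp.aestronglyMeasurable (g i)).sub (continuous_partialDeriv φ i).aestronglyMeasurable)
        ((Lp.aestronglyMeasurable (h i)).sub (continuous_partialDeriv ψ i).aestronglyMeasurable)
        (by norm_num))
      filter_upwards [Lp.coeFn_add (g i) (h i)] with x hx
      have hd : partialDeriv i ((φ + ψ : 𝓓(Ω, ℂ)) : _ → ℂ) x =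
          partialDeriv i φ x + partialDeriv i ψ x := by
        have e : ((φ + ψ : 𝓓(Ω, ℂ)) : EuclideanSpace ℝ (Fin d) → ℂ) = (φ : _ → ℂ) + ψ := by
          ext; simp
        rw [partialDeriv, e, fderiv_add (φ.contDiff.differentiable (by simp) x)
          (ψ.contDiff.differentiable (by simp) x)]
        rfl
      simp only [Pi.add_apply, hx, hd]
      ring

lemma MemH10.smul {u : L2 Ω} (c : ℂ) (hu : MemH10 u) : MemH10 (c • u) := by
  by_cases hc : c = 0
  · rw [hc, zero_smul]
    exact MemH10.zero
  obtain ⟨g, hg, hga⟩ := hu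
  have hc0 : (‖c‖ₑ : ℝ≥0∞) ≠ 0 := by simpa using hc
  refine ⟨c • g, fun φ i => ?_, fun ε hε => ?_⟩
  · rw [pair_smul, Pi.smul_apply, pair_smul, hg φ i, mul_neg]
  · obtain ⟨φ, h1, h2⟩ := hga (ε / ‖c‖ₑ) (ENNReal.div_pos hε.ne' (by simp))
    have hlt : ∀ {a : ℝ≥0∞}, a < ε / ‖c‖ₑ → ‖c‖ₑ * a < ε := fun {a} ha => by
      rw [mul_comm]
      exact (ENNReal.lt_div_iff_mul_lt (Or.inl hc0) (Or.inl (by simp))).mp ha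
    refine ⟨c • φ, ?_, fun i => ?_⟩
    · refine lt_of_eq_of_lt ?_ (hlt h1)
      rw [← eLpNorm_const_smul]
      refine eLpNorm_congr_ae ?_
      filter_upwards [Lp.coeFn_smul c u] with x hx
      rw [hx]
      exact (mul_sub c (u x) (φ x)).symm
    · refine lt_of_eq_of_lt ?_ (hlt (h2 i))
      rw [← eLpNorm_const_smul]
      refine eLpNorm_congr_ae ?_
      filter_upwards [Lp.coeFn_smul c (g i)] with x hx
      have hd : partialDeriv i ((c • φ : 𝓓(Ω, ℂ)) : _ → ℂ) x = c * partialDeriv i φ x := by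
        have e : ((c • φ : 𝓓(Ω, ℂ)) : EuclideanSpace ℝ (Fin d) → ℂ) = c • (φ : _ → ℂ) := by
          ext; simp
        rw [partialDeriv, e, fderiv_const_smul (φ.contDiff.differentiable (by simp) x)]
        rfl
      simp only [Pi.smul_apply, hx, hd, smul_eq_mul]
      ring

lemma IsWeakLaplacian.zero : IsWeakLaplacian (0 : L2 Ω) 0 := fun φ => by
  have h := pair_smul (Ω := Ω) 0 0 (Laplacian.laplacian (φ : _ → ℂ))
  have h' := pair_smul (Ω := Ω) 0 0 φ
  rw [zero_smul, zero_mul] at h h'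
  rw [h, h']

variable (Ω)

/-- The domain `{u ∈ H¹₀(Ω) : Δu ∈ L²(Ω)}` of the Dirichlet Laplacian. -/
def dirichletDomain : Submodule ℂ (L2 Ω) where
  carrier := {u | MemH10 u ∧ ∃ f, IsWeakLaplacian u f}
  add_mem' := fun ⟨hu, f, hf⟩ ⟨hv, g, hg⟩ => ⟨hu.add hv, f + g, hf.add hg⟩
  zero_mem' := ⟨MemH10.zero, 0, IsWeakLaplacian.zero⟩
  smul_mem' := fun c _ ⟨hu, f, hf⟩ => ⟨hu.smul c, c • f, hf.smul c⟩

variable {Ω}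

/-- The distributional Laplacian `Δu ∈ L²(Ω)` of an element of the domain. -/
def weakLaplacian (u : dirichletDomain Ω) : L2 Ω := u.2.2.choose

lemma weakLaplacian_spec (u : dirichletDomain Ω) : IsWeakLaplacian (u : L2 Ω) (weakLaplacian u) :=
  u.2.2.choose_spec

variable (Ω)

/-- The positive Dirichlet Laplacian `u ↦ -Δu` of `Ω`, as an unbounded operator in `L²(Ω)`. -/
def dirichletLaplacian : L2 Ω →ₗ.[ℂ] L2 Ω where
  domain := dirichletDomain Ω
  toFun :=
    { toFun := fun u => -weakLaplacian u
      map_add' := fun u v => by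
        rw [← neg_add, neg_inj]
        exact (weakLaplacian_spec (u + v)).unique
          ((weakLaplacian_spec u).add (weakLaplacian_spec v))
      map_smul' := fun c u => by
        rw [smul_neg, neg_inj]
        exact (weakLaplacian_spec (c • u)).unique ((weakLaplacian_spec u).smul c) }

variable {Ω}

/-- The graph of the Dirichlet Laplacian: `u` is in the domain and has image `f` if and only if
`u ∈ H¹₀(Ω)` and `-Δu = f` in the sense of distributions. -/
lemma mem_graph_dirichletLaplacian {u f : L2 Ω} :
    (u, f) ∈ (dirichletLaplacian Ω).graph ↔ MemH10 u ∧ IsWeakLaplacian u (-f) := by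
  rw [LinearPMap.mem_graph_iff]
  constructor
  · rintro ⟨y, rfl, rfl⟩
    refine ⟨y.2.1, ?_⟩
    change IsWeakLaplacian _ (-(-weakLaplacian y))
    rw [neg_neg]
    exact weakLaplacian_spec y
  · rintro ⟨hu, hf⟩
    refine ⟨⟨u, hu, -f, hf⟩, rfl, ?_⟩
    change -weakLaplacian ⟨u, hu, -f, hf⟩ = f
    rw [neg_eq_iff_eq_neg]
    exact (weakLaplacian_spec _).unique hf

end Dirichlet

/-! ### The broken guide -/

/-- The broken guide `Ω_θ` with half-opening `θ`: the points `(x₁, x₂)` of the plane such that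
`x₁ tan θ < |x₂| < (x₁ + π / sin θ) tan θ`. -/
def brokenGuide (θ : ℝ) : Opens (EuclideanSpace ℝ (Fin 2)) where
  carrier := {x | x 0 * Real.tan θ < |x 1| ∧
    |x 1| < (x 0 + Real.pi / Real.sin θ) * Real.tan θ}
  is_open' := by
    simp only [Set.ofPred_and]
    exact IsOpen.inter (isOpen_lt (by fun_prop) (by fun_prop)) (isOpen_lt (by fun_prop) (by fun_prop))

end BrokenGuide

end

/-! Far from the corner the guide consists of two half strips of width π. The lowest transverse
Dirichlet eigenvalue on `(0, π)` is 1, with eigenfunction `sin`, so waves travel along an arm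
exactly at the energies `1 + k²`; the corner is bounded and cannot affect the essential spectrum.

The unbounded operator `A` is first traded for a bounded one. With `ι` the inclusion of `H¹₀` into
`L²`, the operator `R = ι ι*` is `(A + 1)⁻¹` (`resolventOp_eq_iff`), and `A - z` is Fredholm exactly
when `T = 1 - (z + 1) R` is (`isFredholm_subScalar_iff`).

Outside `[1, ∞)`, `A - z` is Fredholm. The Wirtinger inequality across the arms gives `∫|u|² ≤
∫|∇u|² + ∫_Q |u|²`, where `Q` is a square containing the corner
(`integral_norm_sq_le_gradSq_add_box`). Cutting `Q` into squares of side `ℓ` and applying Poincaré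
on each bounds the last term by finitely many linear functionals plus `ℓ² ∫|∇u|²`, with `ℓ`
arbitrarily small; this replaces the compact embedding. Through the quadratic form it yields `‖f‖ ≤
C (‖T f‖ + ‖F f‖)` with `F` of finite rank (`exists_estimate`), hence a finite dimensional kernel
and a closed range. The cokernel is the kernel of `T*`, which is the same operator for the conjugate
of `z`.

On `[1, ∞)`, it is not Fredholm. The functions `R^{-1/2} χ(s/R) e^{iks} sin t` on the upper arm,
with `R` growing geometrically, have constant norm and disjoint supports, and are approximate
eigenfunctions for `1 + k²`. A Fredholm `T` would force a convergent subsequence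
(`exists_tendsto_subseq_of_isFredholm`, `not_isFredholm_of_separated`). -/

open MeasureTheory TopologicalSpace
open scoped ENNReal ContDiff Distributions

noncomputable section

namespace BrokenGuide

/-! ### Fredholm criteria for bounded operators -/

section Fredholm

variable {H E : Type*} [NormedAddCommGroup H] [InnerProductSpace ℂ H]
  [NormedAddCommGroup E] [NormedSpace ℂ E]

/-- On the kernel the estimate reads `‖f‖ ≤ C ‖F f‖`, so `F` embeds the kernel into `E`. -/
lemma finiteDimensional_ker_of_estimate [FiniteDimensional ℂ E] (T : H →L[ℂ] H) (F : H →L[ℂ] E)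
    {C : ℝ} (h : ∀ f, ‖f‖ ≤ C * (‖T f‖ + ‖F f‖)) :
    FiniteDimensional ℂ (LinearMap.ker (T : H →ₗ[ℂ] H)) := by
  refine FiniteDimensional.of_injective
    ((F : H →ₗ[ℂ] E).comp (LinearMap.ker (T : H →ₗ[ℂ] H)).subtype) ?_
  rw [← LinearMap.ker_eq_bot, LinearMap.ker_eq_bot']
  rintro ⟨x, hx⟩ hF
  have h1 := h x
  have hx' : T x = 0 := hx
  have hF' : F x = 0 := hF
  rw [hx', hF', norm_zero, norm_zero, add_zero, mul_zero] at h1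
  exact Subtype.ext (norm_le_zero_iff.mp h1)

/-- On `ker F`, which has finite codimension, `T` is bounded below and so has closed image; the full
range only adds a finite dimensional space to it. -/
lemma isClosed_range_of_estimate [CompleteSpace H] [FiniteDimensional ℂ E] (T : H →L[ℂ] H)
    (F : H →L[ℂ] E) {C : ℝ} (h : ∀ f, ‖f‖ ≤ C * (‖T f‖ + ‖F f‖)) :
    IsClosed (LinearMap.range (T : H →ₗ[ℂ] H) : Set H) := by
  set S : Submodule ℂ H := LinearMap.ker (F : H →ₗ[ℂ] E) with hS
  have hSc : IsClosed (S : Set H) := F.isClosed_ker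
  have : CompleteSpace S := hSc.completeSpace_coe
  have hfin : FiniteDimensional ℂ (H ⧸ S) :=
    ((F : H →ₗ[ℂ] E).quotKerEquivRange.symm.finiteDimensional)
  have : S.CoFG := hfin
  refine LinearMap.isClosed_range_of_isClosed_map_of_finiteDimensional_quotient (s := S) ?_
  have hanti : AntilipschitzWith (Real.toNNReal C) (T.comp S.subtypeL) := by
    refine (T.comp S.subtypeL).antilipschitz_of_bound fun x => ?_
    have h1 := h x
    have hF' : F x = 0 := x.2
    rw [hF', norm_zero, add_zero] at h1
    exact h1.trans (mul_le_mul_of_nonneg_right (Real.le_coe_toNNReal C) (norm_nonneg _))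
  have hc := hanti.isClosed_range (T.comp S.subtypeL).uniformContinuous
  convert hc using 1
  ext y
  simp

/-- A closed range is complemented by its orthogonal, which is the kernel of the adjoint. -/
lemma finiteDimensional_quotient_range [CompleteSpace H] (T : H →L[ℂ] H)
    (hc : IsClosed (LinearMap.range (T : H →ₗ[ℂ] H) : Set H))
    (hk : FiniteDimensional ℂ (LinearMap.ker (T.adjoint : H →ₗ[ℂ] H))) :
    FiniteDimensional ℂ (H ⧸ LinearMap.range (T : H →ₗ[ℂ] H)) := by
  have : CompleteSpace (LinearMap.range (T : H →ₗ[ℂ] H)) := hc.completeSpace_coe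
  have hker := ContinuousLinearMap.orthogonal_range T
  rw [← hker] at hk
  exact (Submodule.quotientEquivOfIsCompl _ _
    (Submodule.isCompl_orthogonal (K := LinearMap.range (T : H →ₗ[ℂ] H)))).symm.finiteDimensional

/-- The open mapping theorem onto the closed range provides `w n → 0` with `T (w n) = T (f n)`. The
differences `f n - w n` are bounded in the finite dimensional kernel, where bounded sequences have
convergent subsequences. -/
lemma exists_tendsto_subseq_of_isFredholm [CompleteSpace H] (T : H →L[ℂ] H)
    (hT : IsFredholm (T : H →ₗ[ℂ] H)) {f : ℕ → H} {M : ℝ} (hf : ∀ n, ‖f n‖ ≤ M)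
    (hTf : Filter.Tendsto (fun n => T (f n)) Filter.atTop (nhds 0)) :
    ∃ a, ∃ φ : ℕ → ℕ, StrictMono φ ∧ Filter.Tendsto (f ∘ φ) Filter.atTop (nhds a) := by
  have hfk := hT.finite_ker
  have : CompleteSpace (LinearMap.range (T : H →ₗ[ℂ] H)) := hT.isClosed_range.completeSpace_coe
  obtain ⟨C, hC0, hC⟩ := T.rangeRestrict.exists_preimage_norm_le
    (LinearMap.surjective_rangeRestrict (T : H →ₗ[ℂ] H))
  choose w hw hwn using fun n => hC ⟨T (f n), f n, rfl⟩
  have hw' : ∀ n, T (w n) = T (f n) := fun n => congrArg Subtype.val (hw n)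
  have hw0 : Filter.Tendsto w Filter.atTop (nhds 0) := by
    refine squeeze_zero_norm hwn ?_
    have := (hTf.norm.const_mul C)
    simpa using this
  let k : ℕ → LinearMap.ker (T : H →ₗ[ℂ] H) := fun n => ⟨f n - w n, by
    simp [hw' n]⟩
  obtain ⟨M', hM'⟩ := hTf.norm.bddAbove_range
  have : ProperSpace (LinearMap.ker (T : H →ₗ[ℂ] H)) := FiniteDimensional.proper ℂ _
  obtain ⟨a, -, φ, hφ, hlim⟩ := tendsto_subseq_of_bounded
    (Metric.isBounded_closedBall (x := (0 : LinearMap.ker (T : H →ₗ[ℂ] H))) (r := M + C * M'))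
    (x := k) (fun n => by
      rw [mem_closedBall_zero_iff]
      refine (norm_sub_le (f n) (w n)).trans (add_le_add (hf n) ((hwn n).trans ?_))
      exact mul_le_mul_of_nonneg_left (hM' ⟨n, rfl⟩) hC0.le)
  refine ⟨a, φ, hφ, ?_⟩
  have h1 := ((continuous_subtype_val.tendsto a).comp hlim).add (hw0.comp hφ.tendsto_atTop)
  rw [add_zero] at h1
  refine h1.congr fun n => ?_
  simp [k]

/-- Transfer of the Fredholm property along a linear bijection of the source. -/
lemma isFredholm_comp_iff {D D' : Type*} [AddCommGroup D] [Module ℂ D] [AddCommGroup D']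
    [Module ℂ D'] (e : D' ≃ₗ[ℂ] D) (T : D →ₗ[ℂ] H) :
    IsFredholm (T ∘ₗ (e : D' →ₗ[ℂ] D)) ↔ IsFredholm T := by
  have hr : LinearMap.range (T ∘ₗ (e : D' →ₗ[ℂ] D)) = LinearMap.range T :=
    LinearMap.range_comp_of_range_eq_top _ e.range
  have hk : LinearMap.ker T ≃ₗ[ℂ] LinearMap.ker (T ∘ₗ (e : D' →ₗ[ℂ] D)) := by
    rw [LinearMap.ker_comp]
    refine (LinearEquiv.ofSubmodule' e (LinearMap.ker T)).symm
  constructor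
  · rintro ⟨h1, h2, h3⟩
    rw [hr] at h2 h3
    exact ⟨hk.symm.finiteDimensional, h2, h3⟩
  · rintro ⟨h1, h2, h3⟩
    rw [← hr] at h2 h3
    exact ⟨hk.finiteDimensional, h2, h3⟩

end Fredholm

/-! ### Partial derivatives and integration by parts -/

section Calculus

variable {d : ℕ} {Ω : Opens (EuclideanSpace ℝ (Fin d))}

lemma contDiff_partialDeriv {f : EuclideanSpace ℝ (Fin d) → ℂ} (hf : ContDiff ℝ ∞ f) (i : Fin d) :
    ContDiff ℝ ∞ (partialDeriv i f) :=
  (hf.fderiv_right (m := ∞) (by simp)).clm_apply contDiff_const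

lemma tsupport_partialDeriv_subset (f : EuclideanSpace ℝ (Fin d) → ℂ) (i : Fin d) :
    tsupport (partialDeriv i f) ⊆ tsupport f :=
  tsupport_fderiv_apply_subset ℝ _

/-- The partial derivative of a test function, as a test function. -/
def partialTest (i : Fin d) (φ : 𝓓(Ω, ℂ)) : 𝓓(Ω, ℂ) where
  toFun := partialDeriv i φ
  contDiff' := contDiff_partialDeriv φ.contDiff i
  hasCompactSupport' := hasCompactSupport_partialDeriv φ i
  tsupport_subset' := (tsupport_partialDeriv_subset _ i).trans φ.tsupport_subset

lemma coe_partialTest (i : Fin d) (φ : 𝓓(Ω, ℂ)) : (partialTest i φ : _ → ℂ) = partialDeriv i φ :=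
  rfl

/-- The complex conjugate of a test function. -/
def conjTest (φ : 𝓓(Ω, ℂ)) : 𝓓(Ω, ℂ) where
  toFun := fun x => (starRingEnd ℂ) (φ x)
  contDiff' := Complex.conjCLE.contDiff.comp φ.contDiff
  hasCompactSupport' := φ.hasCompactSupport.comp_left (g := starRingEnd ℂ) (map_zero _)
  tsupport_subset' :=
    (closure_mono (Function.support_comp_subset (map_zero (starRingEnd ℂ)) φ)).trans
      φ.tsupport_subset

lemma conjTest_apply (φ : 𝓓(Ω, ℂ)) (x : EuclideanSpace ℝ (Fin d)) :
    conjTest φ x = (starRingEnd ℂ) (φ x) := rfl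

lemma partialDeriv_conjTest (φ : 𝓓(Ω, ℂ)) (i : Fin d) (x : EuclideanSpace ℝ (Fin d)) :
    partialDeriv i (conjTest φ) x = (starRingEnd ℂ) (partialDeriv i φ x) := by
  have : (conjTest φ : EuclideanSpace ℝ (Fin d) → ℂ) = Complex.conjCLE ∘ φ := rfl
  rw [partialDeriv, this, Complex.conjCLE.comp_fderiv]
  rfl

lemma laplacian_eq_sum_partialDeriv {f : EuclideanSpace ℝ (Fin d) → ℂ} (hf : ContDiff ℝ ∞ f)
    (x : EuclideanSpace ℝ (Fin d)) :
    Laplacian.laplacian f x = ∑ i, partialDeriv i (partialDeriv i f) x := by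
  rw [InnerProductSpace.laplacian_eq_iteratedFDeriv_orthonormalBasis f
    (EuclideanSpace.basisFun (Fin d) ℝ)]
  refine Finset.sum_congr rfl fun i _ => ?_
  have hd : DifferentiableAt ℝ (fderiv ℝ f) x :=
    ((hf.fderiv_right (m := ∞) (by simp)).differentiable (by simp)) x
  rw [iteratedFDeriv_two_apply]
  simp only [EuclideanSpace.basisFun_apply, Matrix.cons_val_zero, Matrix.cons_val_one]
  change _ = fderiv ℝ (fun y => fderiv ℝ f y (EuclideanSpace.single i 1)) x _
  rw [fderiv_clm_apply hd (differentiableAt_const _)]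
  simp

lemma setIntegral_mul_test (a : EuclideanSpace ℝ (Fin d) → ℂ) (φ : 𝓓(Ω, ℂ)) :
    ∫ x in (Ω : Set (EuclideanSpace ℝ (Fin d))), a x * φ x = ∫ x, a x * φ x :=
  setIntegral_eq_integral_of_forall_compl_eq_zero fun x hx => by
    rw [image_eq_zero_of_notMem_tsupport (fun h => hx (φ.tsupport_subset h)), mul_zero]

/-- The test function vanishes outside `Ω`, so both integrals extend to the whole space and no
boundary term arises. Hence `a` needs neither decay nor a boundary condition. -/
lemma integral_mul_partialDeriv_test {a : EuclideanSpace ℝ (Fin d) → ℂ} (ha : ContDiff ℝ ∞ a)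
    (φ : 𝓓(Ω, ℂ)) (i : Fin d) :
    ∫ x in (Ω : Set (EuclideanSpace ℝ (Fin d))), a x * partialDeriv i φ x =
      - ∫ x in (Ω : Set (EuclideanSpace ℝ (Fin d))), partialDeriv i a x * φ x := by
  rw [← coe_partialTest, setIntegral_mul_test, setIntegral_mul_test]
  refine integral_mul_fderiv_eq_neg_fderiv_mul_of_integrable ?_ ?_ ?_
    (fun x _ => ha.differentiable (by simp) x) (fun x _ => φ.contDiff.differentiable (by simp) x)
  · exact ((contDiff_partialDeriv ha i).continuous.mul φ.continuous).integrable_of_hasCompactSupport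
      φ.hasCompactSupport.mul_left
  · exact (ha.continuous.mul (continuous_partialDeriv φ i)).integrable_of_hasCompactSupport
      (hasCompactSupport_partialDeriv φ i).mul_left
  · exact (ha.continuous.mul φ.continuous).integrable_of_hasCompactSupport
      φ.hasCompactSupport.mul_left

lemma integral_mul_laplacian_test {a : EuclideanSpace ℝ (Fin d) → ℂ} (ha : ContDiff ℝ ∞ a)
    (φ : 𝓓(Ω, ℂ)) :
    ∫ x in (Ω : Set (EuclideanSpace ℝ (Fin d))), a x * Laplacian.laplacian (φ : _ → ℂ) x =
      ∫ x in (Ω : Set (EuclideanSpace ℝ (Fin d))), Laplacian.laplacian a x * φ x := by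
  simp_rw [laplacian_eq_sum_partialDeriv ha, laplacian_eq_sum_partialDeriv φ.contDiff,
    Finset.mul_sum, Finset.sum_mul]
  rw [integral_finsetSum, integral_finsetSum]
  · refine Finset.sum_congr rfl fun i _ => ?_
    have h1 := integral_mul_partialDeriv_test ha (partialTest i φ) i
    have h2 := integral_mul_partialDeriv_test (contDiff_partialDeriv ha i) φ i
    rw [coe_partialTest] at h1
    rw [h1, h2, neg_neg]
  · intro i _
    exact (((contDiff_partialDeriv (contDiff_partialDeriv ha i) i).continuous.mul
      φ.continuous).integrable_of_hasCompactSupport φ.hasCompactSupport.mul_left).integrableOn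
  · intro i _
    exact ((ha.continuous.mul (partialTest i (partialTest i φ)).continuous
      ).integrable_of_hasCompactSupport
      (partialTest i (partialTest i φ)).hasCompactSupport.mul_left).integrableOn

lemma IsWeakGradient.integral_mul_laplacian {u : L2 Ω} {g : Fin d → L2 Ω}
    (h : IsWeakGradient u g) (φ : 𝓓(Ω, ℂ)) :
    ∫ x in (Ω : Set (EuclideanSpace ℝ (Fin d))), u x * Laplacian.laplacian (φ : _ → ℂ) x =
      - ∑ i, ∫ x in (Ω : Set (EuclideanSpace ℝ (Fin d))), g i x * partialDeriv i φ x := by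
  simp_rw [laplacian_eq_sum_partialDeriv φ.contDiff, Finset.mul_sum]
  rw [integral_finsetSum, ← Finset.sum_neg_distrib]
  · exact Finset.sum_congr rfl fun i _ => h (partialTest i φ) i
  · intro i _
    exact integrable_pair u (partialTest i (partialTest i φ)).continuous
      (partialTest i (partialTest i φ)).hasCompactSupport

end Calculus

/-! ### The space `H¹₀` as a Hilbert space and the resolvent at `-1` -/

section Resolvent

variable {d : ℕ} {Ω : Opens (EuclideanSpace ℝ (Fin d))}

/-- The class in `L²(Ω)` of a continuous function with compact support. -/
def contL2 (Ω : Opens (EuclideanSpace ℝ (Fin d))) {ψ : EuclideanSpace ℝ (Fin d) → ℂ}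
    (hc : Continuous ψ) (hs : HasCompactSupport ψ) : L2 Ω :=
  (hc.memLp_of_hasCompactSupport hs).toLp ψ

lemma coeFn_contL2 {ψ : EuclideanSpace ℝ (Fin d) → ℂ} (hc : Continuous ψ)
    (hs : HasCompactSupport ψ) :
    contL2 Ω hc hs =ᵐ[volume.restrict (Ω : Set (EuclideanSpace ℝ (Fin d)))] ψ :=
  MemLp.coeFn_toLp _

lemma enorm_sub_contL2 (u : L2 Ω) {ψ : EuclideanSpace ℝ (Fin d) → ℂ} (hc : Continuous ψ)
    (hs : HasCompactSupport ψ) :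
    ‖u - contL2 Ω hc hs‖ₑ =
      eLpNorm (fun x => u x - ψ x) 2 (volume.restrict (Ω : Set (EuclideanSpace ℝ (Fin d)))) := by
  rw [Lp.enorm_def]
  refine eLpNorm_congr_ae ?_
  filter_upwards [Lp.coeFn_sub u (contL2 Ω hc hs), coeFn_contL2 (Ω := Ω) hc hs] with x h1 h2
  rw [h1, Pi.sub_apply, h2]

lemma inner_contL2 (u : L2 Ω) {ψ : EuclideanSpace ℝ (Fin d) → ℂ} (hc : Continuous ψ)
    (hs : HasCompactSupport ψ) :
    inner ℂ (contL2 Ω hc hs) u =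
      ∫ x in (Ω : Set (EuclideanSpace ℝ (Fin d))), u x * (starRingEnd ℂ) (ψ x) := by
  rw [L2.inner_def]
  refine integral_congr_ae ?_
  filter_upwards [coeFn_contL2 (Ω := Ω) hc hs] with x h
  rw [h, RCLike.inner_apply]

/-- The ambient Hilbert space of pairs `(u, g)`. -/
abbrev Jet (Ω : Opens (EuclideanSpace ℝ (Fin d))) : Type :=
  PiLp 2 (fun _ : Option (Fin d) => L2 Ω)

/-- A test function with its gradient, as an element of `Jet Ω`. -/
def testJet (φ : 𝓓(Ω, ℂ)) : Jet Ω :=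
  WithLp.toLp 2 fun o => o.elim (contL2 Ω φ.continuous φ.hasCompactSupport)
    fun i => contL2 Ω (continuous_partialDeriv φ i) (hasCompactSupport_partialDeriv φ i)

lemma testJet_none (φ : 𝓓(Ω, ℂ)) :
    testJet φ none = contL2 Ω φ.continuous φ.hasCompactSupport := rfl

lemma testJet_some (φ : 𝓓(Ω, ℂ)) (i : Fin d) :
    testJet φ (some i) =
      contL2 Ω (continuous_partialDeriv φ i) (hasCompactSupport_partialDeriv φ i) := rfl

lemma partialDeriv_add_test (φ ψ : 𝓓(Ω, ℂ)) (i : Fin d) :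
    partialDeriv i ((φ + ψ : 𝓓(Ω, ℂ)) : _ → ℂ) = partialDeriv i φ + partialDeriv i ψ := by
  ext x
  have e : ((φ + ψ : 𝓓(Ω, ℂ)) : EuclideanSpace ℝ (Fin d) → ℂ) = (φ : _ → ℂ) + ψ := by
    ext; simp
  rw [partialDeriv, e, fderiv_add (φ.contDiff.differentiable (by simp) x)
    (ψ.contDiff.differentiable (by simp) x)]
  rfl

lemma partialDeriv_smul_test (c : ℂ) (φ : 𝓓(Ω, ℂ)) (i : Fin d) :
    partialDeriv i ((c • φ : 𝓓(Ω, ℂ)) : _ → ℂ) = c • partialDeriv i φ := by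
  ext x
  have e : ((c • φ : 𝓓(Ω, ℂ)) : EuclideanSpace ℝ (Fin d) → ℂ) = c • (φ : _ → ℂ) := by
    ext; simp
  rw [partialDeriv, e, fderiv_const_smul (φ.contDiff.differentiable (by simp) x)]
  rfl

/-- `φ ↦ (φ, ∇φ)`. -/
def testJetₗ (Ω : Opens (EuclideanSpace ℝ (Fin d))) : 𝓓(Ω, ℂ) →ₗ[ℂ] Jet Ω where
  toFun := testJet
  map_add' φ ψ := by
    refine PiLp.ext fun o => ?_
    cases o with
    | none =>
      exact MemLp.toLp_add (φ.continuous.memLp_of_hasCompactSupport φ.hasCompactSupport)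
        (ψ.continuous.memLp_of_hasCompactSupport ψ.hasCompactSupport)
    | some i =>
      rw [PiLp.add_apply, testJet_some, testJet_some, testJet_some]
      unfold contL2
      rw [← MemLp.toLp_add]
      exact (MemLp.toLp_eq_toLp_iff _ _).mpr
        (Filter.EventuallyEq.of_eq (partialDeriv_add_test φ ψ i))
  map_smul' c φ := by
    refine PiLp.ext fun o => ?_
    cases o with
    | none =>
      exact MemLp.toLp_const_smul c (φ.continuous.memLp_of_hasCompactSupport φ.hasCompactSupport)
    | some i =>
      rw [RingHom.id_apply, PiLp.smul_apply, testJet_some, testJet_some]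
      unfold contL2
      rw [← MemLp.toLp_const_smul]
      exact (MemLp.toLp_eq_toLp_iff _ _).mpr
        (Filter.EventuallyEq.of_eq (partialDeriv_smul_test c φ i))

/-- The Hilbert space `H¹₀(Ω)`, realised as the closure of the jets of test functions. -/
def H10 (Ω : Opens (EuclideanSpace ℝ (Fin d))) : Submodule ℂ (Jet Ω) :=
  (LinearMap.range (testJetₗ Ω)).topologicalClosure

lemma testJet_mem (φ : 𝓓(Ω, ℂ)) : testJet φ ∈ H10 Ω :=
  Submodule.le_topologicalClosure _ ⟨φ, rfl⟩

instance : CompleteSpace (H10 Ω) :=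
  (Submodule.isClosed_topologicalClosure _).completeSpace_coe

/-- The density argument that carries identities and inequalities from test functions to all of `H10
Ω`. -/
lemma H10_induction {p : Jet Ω → Prop} (hp : IsClosed {x | p x}) (h : ∀ φ, p (testJet φ))
    {x : Jet Ω} (hx : x ∈ H10 Ω) : p x := by
  have : closure (LinearMap.range (testJetₗ Ω) : Set (Jet Ω)) ⊆ {x | p x} := by
    refine closure_minimal ?_ hp
    rintro _ ⟨φ, rfl⟩
    exact h φ
  exact this hx

lemma continuous_jet_apply (o : Option (Fin d)) : Continuous fun x : Jet Ω => x o :=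
  (PiLp.proj (𝕜 := ℂ) 2 (fun _ : Option (Fin d) => L2 Ω) o).continuous

/-- Distributional pairings are bilinear and the inner product is sesquilinear; running over
conjugates of test functions passes from one to the other. In this form the condition is visibly
closed in `(u, g)`. -/
lemma isWeakGradient_iff {u : L2 Ω} {g : Fin d → L2 Ω} :
    IsWeakGradient u g ↔ ∀ (φ : 𝓓(Ω, ℂ)) (i : Fin d),
      inner ℂ (testJet φ (some i)) u = -(inner ℂ (testJet φ none) (g i)) := by
  constructor
  · intro h φ i
    have := h (conjTest φ) i
    rw [testJet_some, testJet_none, inner_contL2, inner_contL2]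
    simpa only [partialDeriv_conjTest, conjTest_apply] using this
  · intro h φ i
    have := h (conjTest φ) i
    rw [testJet_some, testJet_none, inner_contL2, inner_contL2] at this
    simpa only [partialDeriv_conjTest, conjTest_apply, Complex.conj_conj] using this

lemma isWeakGradient_of_mem {x : Jet Ω} (hx : x ∈ H10 Ω) :
    IsWeakGradient (x none) (fun i => x (some i)) := by
  rw [isWeakGradient_iff]
  intro φ i
  refine H10_induction (p := fun x : Jet Ω => inner ℂ (testJet φ (some i)) (x none) =
    -(inner ℂ (testJet φ none) (x (some i)))) ?_ ?_ hx
  · exact isClosed_eq (continuous_const.inner (continuous_jet_apply _))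
      (continuous_const.inner (continuous_jet_apply _)).neg
  · intro ψ
    have h := integral_mul_partialDeriv_test ψ.contDiff (conjTest φ) i
    rw [testJet_some, testJet_none, testJet_some, testJet_none, inner_contL2, inner_contL2]
    have e1 := coeFn_contL2 (Ω := Ω) ψ.continuous ψ.hasCompactSupport
    have e2 := coeFn_contL2 (Ω := Ω) (continuous_partialDeriv ψ i)
      (hasCompactSupport_partialDeriv ψ i)
    simp only [partialDeriv_conjTest, conjTest_apply] at h
    refine (integral_congr_ae ?_).trans (h.trans (congrArg Neg.neg (integral_congr_ae ?_)))
    · filter_upwards [e1] with x hx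
      rw [hx]
    · filter_upwards [e2] with x hx
      rw [hx]

/-- Approximation in each component is approximation in `Jet Ω`. The weak gradient clause of
`MemH10` is itself a consequence of the approximation, so the forward direction discards it. -/
lemma memH10_iff {u : L2 Ω} : MemH10 u ↔ ∃ x ∈ H10 Ω, x none = u := by
  constructor
  · rintro ⟨g, -, h⟩
    let x : Jet Ω := WithLp.toLp 2 fun o => o.elim u g
    refine ⟨x, ?_, rfl⟩
    choose φ h1 h2 using fun n : ℕ => h ((n : ℝ≥0∞) + 1)⁻¹ (by simp)
    have hlim : Filter.Tendsto (fun n : ℕ => ((n : ℝ≥0∞) + 1)⁻¹) Filter.atTop (nhds 0) := by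
      have := ENNReal.tendsto_inv_nat_nhds_zero.comp (Filter.tendsto_add_atTop_nat 1)
      simpa [Function.comp_def] using this
    refine mem_closure_of_tendsto (f := fun n => testJet (φ n)) (b := Filter.atTop) ?_
      (Filter.Eventually.of_forall fun n => ⟨φ n, rfl⟩)
    have : Filter.Tendsto (fun n => WithLp.ofLp (testJet (φ n))) Filter.atTop
        (nhds (WithLp.ofLp x)) := by
      rw [tendsto_pi_nhds]
      intro o
      rw [tendsto_iff_edist_tendsto_0]
      refine tendsto_of_tendsto_of_tendsto_of_le_of_le tendsto_const_nhds hlim (fun _ => zero_le)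
        fun n => ?_
      rw [edist_comm, edist_eq_enorm_sub]
      cases o with
      | none =>
        exact (enorm_sub_contL2 u (φ n).continuous (φ n).hasCompactSupport).trans_le (h1 n).le
      | some i =>
        exact (enorm_sub_contL2 (g i) (continuous_partialDeriv (φ n) i)
          (hasCompactSupport_partialDeriv (φ n) i)).trans_le (h2 n i).le
    exact ((PiLp.continuous_toLp 2 _).tendsto _).comp this
  · rintro ⟨x, hx, rfl⟩
    refine ⟨_, isWeakGradient_of_mem hx, fun ε hε => ?_⟩
    obtain ⟨_, ⟨φ, rfl⟩, hφ⟩ := EMetric.mem_closure_iff.mp hx ε hε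
    have key : ∀ o, ‖x o - testJet φ o‖ₑ < ε := fun o => by
      refine lt_of_le_of_lt ?_ hφ
      rw [edist_eq_enorm_sub, ← ofReal_norm, ← ofReal_norm]
      exact ENNReal.ofReal_le_ofReal (PiLp.norm_apply_le (x - testJet φ) o)
    refine ⟨φ, ?_, fun i => ?_⟩
    · exact (enorm_sub_contL2 (x none) φ.continuous φ.hasCompactSupport).symm.trans_lt (key none)
    · exact (enorm_sub_contL2 (x (some i)) (continuous_partialDeriv φ i)
        (hasCompactSupport_partialDeriv φ i)).symm.trans_lt (key (some i))

/-- The inclusion of `H¹₀(Ω)` into `L²(Ω)`. -/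
def inclL2 (Ω : Opens (EuclideanSpace ℝ (Fin d))) : H10 Ω →L[ℂ] L2 Ω :=
  (PiLp.proj (𝕜 := ℂ) 2 (fun _ : Option (Fin d) => L2 Ω) none).comp (H10 Ω).subtypeL

lemma inclL2_apply (x : H10 Ω) : inclL2 Ω x = (x : Jet Ω) none := rfl

/-- The resolvent `(A + 1)⁻¹` of the Dirichlet Laplacian. -/
def resolventOp (Ω : Opens (EuclideanSpace ℝ (Fin d))) : L2 Ω →L[ℂ] L2 Ω :=
  (inclL2 Ω).comp (inclL2 Ω).adjoint

lemma adjoint_resolventOp : (resolventOp Ω).adjoint = resolventOp Ω := by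
  rw [resolventOp, ContinuousLinearMap.adjoint_comp, ContinuousLinearMap.adjoint_adjoint]

lemma inner_jet (x y : Jet Ω) :
    inner ℂ x y = inner ℂ (x none) (y none) + ∑ i, inner ℂ (x (some i)) (y (some i)) := by
  rw [PiLp.inner_apply, Fintype.sum_option]

lemma isWeakLaplacian_iff {u f : L2 Ω} {g : Fin d → L2 Ω} (hg : IsWeakGradient u g) :
    IsWeakLaplacian u f ↔
      ∀ φ : 𝓓(Ω, ℂ), ∑ i, inner ℂ (testJet φ (some i)) (g i) = -(inner ℂ (testJet φ none) f) := by
  have key : ∀ φ : 𝓓(Ω, ℂ),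
      (∑ i, inner ℂ (testJet φ (some i)) (g i) = -(inner ℂ (testJet φ none) f)) ↔
      ∫ x in (Ω : Set (EuclideanSpace ℝ (Fin d))),
        u x * Laplacian.laplacian (conjTest φ : _ → ℂ) x =
      ∫ x in (Ω : Set (EuclideanSpace ℝ (Fin d))), f x * conjTest φ x := by
    intro φ
    rw [hg.integral_mul_laplacian, testJet_none, inner_contL2, neg_eq_iff_eq_neg]
    simp only [testJet_some, inner_contL2, partialDeriv_conjTest, conjTest_apply]
  constructor
  · exact fun h φ => (key φ).mpr (h _)
  · intro h φ
    have := (key (conjTest φ)).mp (h _)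
    have e : conjTest (conjTest φ) = φ := by
      ext x
      simp [conjTest_apply]
    rwa [e] at this

/-- The adjoint of the inclusion sends `f` to the `x` in `H¹₀` with `⟨y, x⟩_{H¹} = ⟨y, f⟩_{L²}` for
all `y`. This is the weak form of `-Δu + u = f`, so the Riesz theorem hidden in the adjoint solves
the equation. -/
lemma resolventOp_eq_iff {u f : L2 Ω} :
    resolventOp Ω f = u ↔ MemH10 u ∧ IsWeakLaplacian u (-(f - u)) := by
  constructor
  · rintro rfl
    set x : H10 Ω := (inclL2 Ω).adjoint f with hx
    have hu : resolventOp Ω f = (x : Jet Ω) none := rfl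
    rw [hu]
    refine ⟨memH10_iff.mpr ⟨x, x.2, rfl⟩, ?_⟩
    rw [isWeakLaplacian_iff (isWeakGradient_of_mem x.2)]
    intro φ
    have h := ContinuousLinearMap.adjoint_inner_right (inclL2 Ω) ⟨testJet φ, testJet_mem φ⟩ f
    rw [← hx, Submodule.coe_inner, inner_jet, inclL2_apply] at h
    rw [inner_neg_right, neg_neg, inner_sub_right, ← h]
    ring
  · rintro ⟨hm, hl⟩
    obtain ⟨x, hx, rfl⟩ := memH10_iff.mp hm
    rw [isWeakLaplacian_iff (isWeakGradient_of_mem hx)] at hl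
    have : (inclL2 Ω).adjoint f = ⟨x, hx⟩ := by
      refine ext_inner_left ℂ fun y => ?_
      rw [ContinuousLinearMap.adjoint_inner_right, Submodule.coe_inner, inclL2_apply]
      refine H10_induction (p := fun y : Jet Ω => inner ℂ (y none) f = inner ℂ y x) ?_ ?_ y.2
      · exact isClosed_eq ((continuous_jet_apply _).inner continuous_const)
          (continuous_id.inner continuous_const)
      · intro φ
        rw [inner_jet, hl φ, inner_neg_right, neg_neg, inner_sub_right]
        ring
    rw [resolventOp, ContinuousLinearMap.comp_apply, this]
    rfl

/-- The quadratic form identity for `u = (A + 1)⁻¹ f`. -/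
lemma inner_resolventOp (f : L2 Ω) : ∃ x ∈ H10 Ω, x none = resolventOp Ω f ∧
    inner ℂ (resolventOp Ω f) f = (‖x none‖ ^ 2 + ∑ i, ‖x (some i)‖ ^ 2 : ℝ) := by
  set x : H10 Ω := (inclL2 Ω).adjoint f with hx
  refine ⟨x, x.2, rfl, ?_⟩
  -- Since `x` is the adjoint of the inclusion applied to `f`, pairing `f` with `x` gives the
  -- squared `H¹` norm of `x`.
  have h := ContinuousLinearMap.adjoint_inner_right (inclL2 Ω) x f
  have h2 : resolventOp Ω f = inclL2 Ω x := rfl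
  rw [h2, ← h, ← hx, Submodule.coe_inner, inner_jet]
  simp only [inner_self_eq_norm_sq_to_K]
  push_cast
  rfl

/-- The bijection `(A + 1)⁻¹` from `L²(Ω)` onto the domain of `A`. -/
def resolventEquiv (Ω : Opens (EuclideanSpace ℝ (Fin d))) :
    L2 Ω ≃ₗ[ℂ] (dirichletLaplacian Ω).domain :=
  LinearEquiv.ofBijective
    ((resolventOp Ω : L2 Ω →ₗ[ℂ] L2 Ω).codRestrict (dirichletLaplacian Ω).domain fun f =>
      ⟨(resolventOp_eq_iff.mp rfl).1, _, (resolventOp_eq_iff.mp rfl).2⟩) (by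
    constructor
    · intro f f' h
      have h' : resolventOp Ω f = resolventOp Ω f' := congrArg Subtype.val h
      have h1 := (resolventOp_eq_iff.mp (Eq.refl (resolventOp Ω f))).2
      have h2 := (resolventOp_eq_iff.mp (Eq.refl (resolventOp Ω f'))).2
      rw [← h'] at h2
      have h3 := h1.unique h2
      simpa using h3
    · rintro ⟨u, hu, g, hg⟩
      -- Here `g` stands for `Δu`, so the preimage of `u` is `(A + 1) u = u - g`.
      refine ⟨u - g, Subtype.ext ?_⟩
      change resolventOp Ω (u - g) = u
      rw [resolventOp_eq_iff]
      refine ⟨hu, ?_⟩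
      convert hg using 1
      abel)

lemma coe_resolventEquiv (f : L2 Ω) : (resolventEquiv Ω f : L2 Ω) = resolventOp Ω f := rfl

lemma dirichletLaplacian_resolventEquiv (f : L2 Ω) :
    dirichletLaplacian Ω (resolventEquiv Ω f) = f - resolventOp Ω f := by
  have h : (resolventOp Ω f, f - resolventOp Ω f) ∈ (dirichletLaplacian Ω).graph := by
    rw [mem_graph_dirichletLaplacian]
    exact resolventOp_eq_iff.mp rfl
  rw [LinearPMap.mem_graph_iff] at h
  obtain ⟨y, hy, hy'⟩ := h
  have : y = resolventEquiv Ω f := Subtype.ext hy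
  rw [← this]
  exact hy'

lemma subScalar_comp_resolventEquiv (z : ℂ) :
    subScalar (dirichletLaplacian Ω) z ∘ₗ (resolventEquiv Ω : L2 Ω →ₗ[ℂ] _) =
      ((1 - (z + 1) • resolventOp Ω : L2 Ω →L[ℂ] L2 Ω) : L2 Ω →ₗ[ℂ] L2 Ω) := by
  ext1 f
  change dirichletLaplacian Ω (resolventEquiv Ω f) - z • (resolventEquiv Ω f : L2 Ω) =
    f - (z + 1) • resolventOp Ω f
  rw [dirichletLaplacian_resolventEquiv, coe_resolventEquiv, add_smul, one_smul]
  abel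

/-- `A - z` is Fredholm if and only if the bounded operator `1 - (z + 1) (A + 1)⁻¹` is. -/
lemma isFredholm_subScalar_iff (z : ℂ) :
    IsFredholm (subScalar (dirichletLaplacian Ω) z) ↔
      IsFredholm ((1 - (z + 1) • resolventOp Ω : L2 Ω →L[ℂ] L2 Ω) : L2 Ω →ₗ[ℂ] L2 Ω) := by
  rw [← subScalar_comp_resolventEquiv, isFredholm_comp_iff]

end Resolvent

/-! ### One-dimensional inequalities -/

section OneDim

/-- The variance identity, by expanding the square. Nonnegativity of its left side gives
Cauchy–Schwarz, and an upper bound on that side gives the Poincaré inequality. -/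
lemma integral_norm_sq_sub_mean {w : ℝ → ℂ} (hw : Continuous w) {a b : ℝ} (hab : a < b) :
    ∫ t in a..b, ‖w t - ((b - a)⁻¹ : ℝ) • ∫ s in a..b, w s‖ ^ 2 =
      (∫ t in a..b, ‖w t‖ ^ 2) - (b - a)⁻¹ * ‖∫ s in a..b, w s‖ ^ 2 := by
  set I := ∫ s in a..b, w s with hI
  set m : ℂ := ((b - a)⁻¹ : ℝ) • I with hm
  have hpt : ∀ t, ‖w t - m‖ ^ 2 = ‖w t‖ ^ 2 - 2 * (innerSL ℝ m) (w t) + ‖m‖ ^ 2 := fun t => by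
    rw [norm_sub_sq_real, real_inner_comm, innerSL_apply_apply]
  have hwi : IntervalIntegrable w volume a b := hw.intervalIntegrable a b
  have h2 : ∫ t in a..b, (innerSL ℝ m) (w t) = (innerSL ℝ m) I :=
    ContinuousLinearMap.intervalIntegral_comp_comm _ hwi
  have hc1 : Continuous fun t => ‖w t‖ ^ 2 := by fun_prop
  have hc2 : Continuous fun t => 2 * (innerSL ℝ m) (w t) := by fun_prop
  have hc3 : Continuous fun t => ‖w t‖ ^ 2 - 2 * (innerSL ℝ m) (w t) := by fun_prop
  simp_rw [hpt]
  rw [intervalIntegral.integral_add (hc3.intervalIntegrable a b)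
    (by simp), intervalIntegral.integral_sub (hc1.intervalIntegrable a b)
    (hc2.intervalIntegrable a b), intervalIntegral.integral_const_mul, h2,
    intervalIntegral.integral_const, innerSL_apply_apply, hm, norm_smul, inner_smul_left,
    real_inner_self_eq_norm_sq]
  have hba : b - a ≠ 0 := (sub_pos.mpr hab).ne'
  simp only [conj_trivial, smul_eq_mul, norm_inv, Real.norm_eq_abs, mul_pow, inv_pow, sq_abs]
  field_simp
  ring

lemma norm_sq_integral_le {w : ℝ → ℂ} (hw : Continuous w) {a b : ℝ} (hab : a < b) :
    ‖∫ s in a..b, w s‖ ^ 2 ≤ (b - a) * ∫ t in a..b, ‖w t‖ ^ 2 := by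
  have h := integral_norm_sq_sub_mean hw hab
  have h0 : 0 ≤ ∫ t in a..b, ‖w t - ((b - a)⁻¹ : ℝ) • ∫ s in a..b, w s‖ ^ 2 :=
    intervalIntegral.integral_nonneg hab.le fun _ _ => by positivity
  have hba : 0 < b - a := sub_pos.mpr hab
  rw [h, sub_nonneg, inv_mul_le_iff₀ hba] at h0
  exact h0

/-- A function with small oscillation is close to its mean. -/
lemma integral_norm_sq_le_of_oscillation {w : ℝ → ℂ} (hw : Continuous w) {a b : ℝ} (hab : a < b)
    {M : ℝ} (hM : 0 ≤ M) (h : ∀ s ∈ Set.Icc a b, ∀ t ∈ Set.Icc a b, ‖w s - w t‖ ^ 2 ≤ M) :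
    ∫ t in a..b, ‖w t‖ ^ 2 ≤ (b - a)⁻¹ * ‖∫ s in a..b, w s‖ ^ 2 + (b - a) * M := by
  have hba : 0 < b - a := sub_pos.mpr hab
  have key := integral_norm_sq_sub_mean hw hab
  have hb : ∀ t ∈ Set.Icc a b, ‖w t - ((b - a)⁻¹ : ℝ) • ∫ s in a..b, w s‖ ^ 2 ≤ M := by
    intro t ht
    -- The deviation from the mean is the mean of the deviations `w t - w s`, each of norm at most
    -- `√M`.
    have e : w t - ((b - a)⁻¹ : ℝ) • ∫ s in a..b, w s =
        ((b - a)⁻¹ : ℝ) • ∫ s in a..b, (w t - w s) := by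
      rw [intervalIntegral.integral_sub (by simp) (hw.intervalIntegrable a b),
        intervalIntegral.integral_const, smul_sub, smul_smul, inv_mul_cancel₀ hba.ne', one_smul]
    have h1 : ‖∫ s in a..b, (w t - w s)‖ ≤ √M * |b - a| := by
      refine intervalIntegral.norm_integral_le_of_norm_le_const fun s hs => ?_
      rw [Set.uIoc_of_le hab.le] at hs
      exact Real.le_sqrt_of_sq_le (h t ht s (Set.Ioc_subset_Icc_self hs))
    rw [abs_of_pos hba] at h1
    have h2 : ‖w t - ((b - a)⁻¹ : ℝ) • ∫ s in a..b, w s‖ ≤ √M := by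
      rw [e, norm_smul, norm_inv, Real.norm_eq_abs, abs_of_pos hba, inv_mul_le_iff₀ hba]
      linarith
    calc _ ≤ √M ^ 2 := by gcongr
      _ = M := Real.sq_sqrt hM
  have hle : ∫ t in a..b, ‖w t - ((b - a)⁻¹ : ℝ) • ∫ s in a..b, w s‖ ^ 2 ≤ ∫ t in a..b, M := by
    refine intervalIntegral.integral_mono_on hab.le ?_ (by simp) hb
    exact Continuous.intervalIntegrable (by fun_prop) _ _
  rw [key, intervalIntegral.integral_const, smul_eq_mul] at hle
  linarith

lemma integral_norm_sq_mono {f : ℝ → ℝ} (hf : Continuous f) (h0 : ∀ t, 0 ≤ f t) {a b s t : ℝ}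
    (hs : s ∈ Set.Icc a b) (ht : t ∈ Set.Icc a b) (hst : s ≤ t) :
    ∫ x in s..t, f x ≤ ∫ x in a..b, f x :=
  intervalIntegral.integral_mono_interval hs.1 hst ht.2
    (Filter.Eventually.of_forall h0) (hf.intervalIntegrable _ _)

/-- `|w(s) - w(t)|² ≤ (b - a) ∫ |w'|²`. -/
lemma norm_sq_sub_le {w w' : ℝ → ℂ} (hd : ∀ t, HasDerivAt w (w' t) t) (hw' : Continuous w')
    {a b : ℝ} {s t : ℝ} (hs : s ∈ Set.Icc a b) (ht : t ∈ Set.Icc a b) :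
    ‖w s - w t‖ ^ 2 ≤ (b - a) * ∫ x in a..b, ‖w' x‖ ^ 2 := by
  wlog hst : s ≤ t generalizing s t
  · rw [norm_sub_rev]
    exact this ht hs (le_of_not_ge hst)
  have hab : a ≤ b := hs.1.trans hs.2
  have hI : 0 ≤ ∫ x in a..b, ‖w' x‖ ^ 2 :=
    intervalIntegral.integral_nonneg hab fun _ _ => by positivity
  rcases hst.eq_or_lt with rfl | hlt
  · rw [sub_self, norm_zero]
    have := mul_nonneg (sub_nonneg.mpr hab) hI
    simpa using this
  have hftc : ∫ x in s..t, w' x = w t - w s :=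
    intervalIntegral.integral_eq_sub_of_hasDerivAt (fun x _ => hd x) (hw'.intervalIntegrable _ _)
  rw [norm_sub_rev, ← hftc]
  refine (norm_sq_integral_le hw' hlt).trans ?_
  refine mul_le_mul (by linarith [hs.1, ht.2]) ?_ ?_ (sub_nonneg.mpr hab)
  · exact integral_norm_sq_mono (by fun_prop) (fun _ => by positivity) hs ht hst
  · exact intervalIntegral.integral_nonneg hst fun _ _ => by positivity

/-- The Poincaré inequality on an interval. -/
lemma integral_norm_sq_le_mean_add {w w' : ℝ → ℂ} (hd : ∀ t, HasDerivAt w (w' t) t)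
    (hw' : Continuous w') {a b : ℝ} (hab : a < b) :
    ∫ t in a..b, ‖w t‖ ^ 2 ≤
      (b - a)⁻¹ * ‖∫ s in a..b, w s‖ ^ 2 + (b - a) ^ 2 * ∫ t in a..b, ‖w' t‖ ^ 2 := by
  have hc : Continuous w := continuous_iff_continuousAt.mpr fun t => (hd t).continuousAt
  have := integral_norm_sq_le_of_oscillation hc hab
    (mul_nonneg (sub_pos.mpr hab).le
      (intervalIntegral.integral_nonneg hab.le fun t _ => by positivity))
    (fun s hs t ht => norm_sq_sub_le hd hw' hs ht)
  rwa [← mul_assoc, ← sq] at this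

/-- The function `v = α tan(α (t - π/2))` solves the Riccati equation `v' = α² + v²`, whence `|w'|²
+ (v |w|²)' - α² |w|² = |w' + v w|² ≥ 0`. The total derivative integrates to zero by the Dirichlet
conditions. Taking `α < 1` keeps `v` smooth up to the endpoints, where it would blow up for `α = 1`.
-/
lemma sq_mul_integral_norm_sq_le {w w' : ℝ → ℂ} (hd : ∀ t, HasDerivAt w (w' t) t)
    (hw' : Continuous w') (h0 : w 0 = 0) (hπ : w Real.pi = 0) {α : ℝ} (hα : α ∈ Set.Ioo 0 1) :
    α ^ 2 * ∫ t in 0..Real.pi, ‖w t‖ ^ 2 ≤ ∫ t in 0..Real.pi, ‖w' t‖ ^ 2 := by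
  have hc : Continuous w := continuous_iff_continuousAt.mpr fun t => (hd t).continuousAt
  have hpi := Real.pi_pos
  set v : ℝ → ℝ := fun t => α * Real.tan (α * (t - Real.pi / 2)) with hv
  have hcos : ∀ t ∈ Set.Icc 0 Real.pi, Real.cos (α * (t - Real.pi / 2)) ≠ 0 := by
    intro t ht
    refine (Real.cos_pos_of_mem_Ioo ⟨?_, ?_⟩).ne'
    · nlinarith [ht.1, ht.2, hα.1, hα.2]
    · nlinarith [ht.1, ht.2, hα.1, hα.2]
  have hvd : ∀ t ∈ Set.Icc 0 Real.pi, HasDerivAt v (α ^ 2 + v t ^ 2) t := by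
    intro t ht
    have h1 : HasDerivAt (fun t : ℝ => α * (t - Real.pi / 2)) α t := by
      simpa using ((hasDerivAt_id t).sub_const (Real.pi / 2)).const_mul α
    have h2 := ((Real.hasDerivAt_tan (hcos t ht)).comp t h1).const_mul α
    refine h2.congr_deriv ?_
    have h3 := Real.inv_one_add_tan_sq (hcos t ht)
    rw [one_div, ← h3, inv_inv, hv]
    ring
  set D : ℝ → ℝ := fun t => (α ^ 2 + v t ^ 2) * ‖w t‖ ^ 2 + v t * (2 * inner ℝ (w t) (w' t))
    with hD
  have hGd : ∀ t ∈ Set.Icc 0 Real.pi, HasDerivAt (fun t => v t * ‖w t‖ ^ 2) (D t) t :=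
    fun t ht => (hvd t ht).mul (hd t).norm_sq
  have hvc : ContinuousOn v (Set.Icc 0 Real.pi) := fun t ht =>
    (hvd t ht).continuousAt.continuousWithinAt
  have hDc : ContinuousOn D (Set.Icc 0 Real.pi) := by
    refine ContinuousOn.add (ContinuousOn.mul (by fun_prop) (by fun_prop))
      (hvc.mul (Continuous.continuousOn ?_))
    exact continuous_const.mul (hc.inner hw')
  have hDi : IntervalIntegrable D volume 0 Real.pi :=
    ContinuousOn.intervalIntegrable (by rwa [Set.uIcc_of_le hpi.le])
  have hDz : ∫ t in 0..Real.pi, D t = 0 := by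
    rw [intervalIntegral.integral_eq_sub_of_hasDerivAt
      (f := fun t => v t * ‖w t‖ ^ 2) (by rwa [Set.uIcc_of_le hpi.le]) hDi]
    simp [h0, hπ]
  have hpt : ∀ t, α ^ 2 * ‖w t‖ ^ 2 ≤ ‖w' t‖ ^ 2 + D t := by
    intro t
    have h1 : ‖w' t + v t • w t‖ ^ 2 = ‖w' t‖ ^ 2 + 2 * (v t * inner ℝ (w t) (w' t)) +
        v t ^ 2 * ‖w t‖ ^ 2 := by
      rw [norm_add_sq_real, inner_smul_right, real_inner_comm, norm_smul, mul_pow,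
        Real.norm_eq_abs, sq_abs]
    have h2 : 0 ≤ ‖w' t + v t • w t‖ ^ 2 := by positivity
    rw [h1] at h2
    simp only [hD]
    linarith
  have hw'i : IntervalIntegrable (fun t => ‖w' t‖ ^ 2) volume 0 Real.pi :=
    Continuous.intervalIntegrable (by fun_prop) _ _
  rw [← intervalIntegral.integral_const_mul]
  calc _ ≤ ∫ t in 0..Real.pi, (‖w' t‖ ^ 2 + D t) :=
        intervalIntegral.integral_mono_on hpi.le
          (Continuous.intervalIntegrable (by fun_prop) _ _) (hw'i.add hDi) fun t _ => hpt t
    _ = _ := by rw [intervalIntegral.integral_add hw'i hDi, hDz, add_zero]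

/-- The Wirtinger inequality on `(0, π)` with Dirichlet conditions. -/
lemma wirtinger {w w' : ℝ → ℂ} (hd : ∀ t, HasDerivAt w (w' t) t)
    (hw' : Continuous w') (h0 : w 0 = 0) (hπ : w Real.pi = 0) :
    ∫ t in 0..Real.pi, ‖w t‖ ^ 2 ≤ ∫ t in 0..Real.pi, ‖w' t‖ ^ 2 := by
  have hlim : Filter.Tendsto (fun α : ℝ => α ^ 2 * ∫ t in 0..Real.pi, ‖w t‖ ^ 2)
      (nhdsWithin 1 (Set.Iio 1)) (nhds (1 ^ 2 * ∫ t in 0..Real.pi, ‖w t‖ ^ 2)) :=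
    Filter.Tendsto.mono_left (Continuous.tendsto (by fun_prop) 1) nhdsWithin_le_nhds
  rw [one_pow, one_mul] at hlim
  refine le_of_tendsto hlim ?_
  filter_upwards [Ioo_mem_nhdsLT (zero_lt_one (α := ℝ))] with α hα
  exact sq_mul_integral_norm_sq_le hd hw' h0 hπ hα

end OneDim

/-! ### The Poincaré inequality on squares -/

section Square

lemma setIntegral_Ioc_prod {F : Type*} [NormedAddCommGroup F] [NormedSpace ℝ F]
    {f : ℝ × ℝ → F} (hf : Continuous f) {a b c d : ℝ}
    (hab : a ≤ b) (hcd : c ≤ d) :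
    ∫ p in Set.Ioc a b ×ˢ Set.Ioc c d, f p = ∫ x in a..b, ∫ y in c..d, f (x, y) := by
  rw [Measure.volume_eq_prod, setIntegral_prod]
  · rw [intervalIntegral.integral_of_le hab]
    simp_rw [intervalIntegral.integral_of_le hcd]
  · exact (hf.continuousOn.integrableOn_compact (isCompact_Icc.prod isCompact_Icc)).mono_set
      (Set.prod_mono Set.Ioc_subset_Icc_self Set.Ioc_subset_Icc_self)

lemma intervalIntegral_swap {F : Type*} [NormedAddCommGroup F] [NormedSpace ℝ F]
    {f : ℝ × ℝ → F} (hf : Continuous f) {a b c d : ℝ}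
    (hab : a ≤ b) (hcd : c ≤ d) :
    ∫ x in a..b, ∫ y in c..d, f (x, y) = ∫ y in c..d, ∫ x in a..b, f (x, y) := by
  simp_rw [intervalIntegral.integral_of_le hab, intervalIntegral.integral_of_le hcd]
  refine integral_integral_swap (f := fun x y => f (x, y)) ?_
  rw [Measure.prod_restrict]
  exact (hf.continuousOn.integrableOn_compact (isCompact_Icc.prod isCompact_Icc)).mono_set
      (Set.prod_mono Set.Ioc_subset_Icc_self Set.Ioc_subset_Icc_self)

/-- Poincaré in `y` for each fixed `x` leaves the integrals `m x` of `G (x, ·)`, and these vary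
little in `x` because their oscillation is controlled by `G1`. -/
lemma poincare_square {G G1 G2 : ℝ × ℝ → ℂ} (hG : Continuous G) (hG1 : Continuous G1)
    (hG2 : Continuous G2) (h1 : ∀ x y, HasDerivAt (fun s => G (s, y)) (G1 (x, y)) x)
    (h2 : ∀ x y, HasDerivAt (fun s => G (x, s)) (G2 (x, y)) y) (a c : ℝ) {ℓ : ℝ} (hℓ : 0 < ℓ) :
    ∫ p in Set.Ioc a (a + ℓ) ×ˢ Set.Ioc c (c + ℓ), ‖G p‖ ^ 2 ≤
      (ℓ⁻¹) ^ 2 * ‖∫ p in Set.Ioc a (a + ℓ) ×ˢ Set.Ioc c (c + ℓ), G p‖ ^ 2 +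
        ℓ ^ 2 * ∫ p in Set.Ioc a (a + ℓ) ×ˢ Set.Ioc c (c + ℓ), (‖G1 p‖ ^ 2 + ‖G2 p‖ ^ 2) := by
  have ha : a < a + ℓ := by linarith
  have hc : c < c + ℓ := by linarith
  have ela : a + ℓ - a = ℓ := by ring
  have elc : c + ℓ - c = ℓ := by ring
  rw [setIntegral_Ioc_prod (by fun_prop) ha.le hc.le, setIntegral_Ioc_prod hG ha.le hc.le,
    setIntegral_Ioc_prod (by fun_prop) ha.le hc.le]
  have par : ∀ {F : Type} [NormedAddCommGroup F] [NormedSpace ℝ F] {f : ℝ × ℝ → F},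
      Continuous f → Continuous fun x => ∫ y in c..(c + ℓ), f (x, y) := fun {F} _ _ {f} hf =>
    intervalIntegral.continuous_parametric_intervalIntegral_of_continuous'
      (f := fun x y => f (x, y)) hf _ _
  set m : ℝ → ℂ := fun x => ∫ y in c..(c + ℓ), G (x, y) with hm
  have hmc : Continuous m := par hG
  set A := ∫ x in a..(a + ℓ), ∫ y in c..(c + ℓ), ‖G1 (x, y)‖ ^ 2 with hA
  set B := ∫ x in a..(a + ℓ), ∫ y in c..(c + ℓ), ‖G2 (x, y)‖ ^ 2 with hB
  have hsplit : ∫ x in a..(a + ℓ), ∫ y in c..(c + ℓ), (‖G1 (x, y)‖ ^ 2 + ‖G2 (x, y)‖ ^ 2) =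
      A + B := by
    rw [hA, hB, ← intervalIntegral.integral_add
      ((par (f := fun p => ‖G1 p‖ ^ 2) (by fun_prop)).intervalIntegrable _ _)
      ((par (f := fun p => ‖G2 p‖ ^ 2) (by fun_prop)).intervalIntegrable _ _)]
    refine intervalIntegral.integral_congr fun x _ => ?_
    exact intervalIntegral.integral_add (Continuous.intervalIntegrable (by fun_prop) _ _)
      (Continuous.intervalIntegrable (by fun_prop) _ _)
  have hA0 : 0 ≤ A := intervalIntegral.integral_nonneg ha.le fun x _ =>
    intervalIntegral.integral_nonneg hc.le fun y _ => by positivity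
  -- One factor `ℓ` comes from Cauchy–Schwarz in `y`, the other from the bound on `G (s, y) - G (t,
  -- y)` by the derivative in `x`.
  have hosc : ∀ s ∈ Set.Icc a (a + ℓ), ∀ t ∈ Set.Icc a (a + ℓ), ‖m s - m t‖ ^ 2 ≤ ℓ ^ 2 * A := by
    intro s hs t ht
    have e : m s - m t = ∫ y in c..(c + ℓ), (G (s, y) - G (t, y)) :=
      (intervalIntegral.integral_sub (Continuous.intervalIntegrable (by fun_prop) _ _)
        (Continuous.intervalIntegrable (by fun_prop) _ _)).symm
    have h3 := norm_sq_integral_le (w := fun y => G (s, y) - G (t, y)) (by fun_prop) hc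
    rw [← e, elc] at h3
    have h4 : ∫ y in c..(c + ℓ), ‖G (s, y) - G (t, y)‖ ^ 2 ≤
        ∫ y in c..(c + ℓ), ℓ * ∫ x in a..(a + ℓ), ‖G1 (x, y)‖ ^ 2 := by
      refine intervalIntegral.integral_mono_on hc.le
        (Continuous.intervalIntegrable (by fun_prop) _ _) ?_ fun y _ => ?_
      · refine (continuous_const.mul ?_).intervalIntegrable _ _
        exact intervalIntegral.continuous_parametric_intervalIntegral_of_continuous'
          (f := fun y x => ‖G1 (x, y)‖ ^ 2) (by fun_prop) _ _
      · have := norm_sq_sub_le (w := fun x => G (x, y)) (w' := fun x => G1 (x, y))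
          (fun x => h1 x y) (by fun_prop) hs ht
        rwa [ela] at this
    rw [intervalIntegral.integral_const_mul,
      ← intervalIntegral_swap (f := fun p => ‖G1 p‖ ^ 2) (by fun_prop) ha.le hc.le, ← hA] at h4
    calc _ ≤ _ := h3
      _ ≤ ℓ * (ℓ * A) := mul_le_mul_of_nonneg_left h4 hℓ.le
      _ = _ := by ring
  have h5 := integral_norm_sq_le_of_oscillation hmc ha (by positivity) hosc
  rw [ela] at h5
  have h6 : ∫ x in a..(a + ℓ), ∫ y in c..(c + ℓ), ‖G (x, y)‖ ^ 2 ≤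
      ∫ x in a..(a + ℓ), (ℓ⁻¹ * ‖m x‖ ^ 2 + ℓ ^ 2 * ∫ y in c..(c + ℓ), ‖G2 (x, y)‖ ^ 2) := by
    refine intervalIntegral.integral_mono_on ha.le
      ((par (f := fun p => ‖G p‖ ^ 2) (by fun_prop)).intervalIntegrable _ _) ?_ fun x _ => ?_
    · exact Continuous.intervalIntegrable ((continuous_const.mul (by fun_prop)).add
        (continuous_const.mul (par (f := fun p => ‖G2 p‖ ^ 2) (by fun_prop)))) _ _
    · have := integral_norm_sq_le_mean_add (w := fun y => G (x, y)) (w' := fun y => G2 (x, y))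
        (fun y => h2 x y) (by fun_prop) hc
      rwa [elc] at this
  rw [intervalIntegral.integral_add, intervalIntegral.integral_const_mul,
    intervalIntegral.integral_const_mul, ← hB] at h6
  · rw [hsplit]
    have h7 := mul_le_mul_of_nonneg_left h5 (inv_pos.mpr hℓ).le
    have h8 : ℓ⁻¹ * (ℓ * (ℓ ^ 2 * A)) = ℓ ^ 2 * A := by
      rw [← mul_assoc, inv_mul_cancel₀ hℓ.ne', one_mul]
    rw [mul_add, h8, ← mul_assoc] at h7
    rw [sq (ℓ⁻¹)]
    linarith
  · exact Continuous.intervalIntegrable (continuous_const.mul (by fun_prop)) _ _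
  · exact Continuous.intervalIntegrable
      (continuous_const.mul (par (f := fun p => ‖G2 p‖ ^ 2) (by fun_prop))) _ _

end Square

/-! ### Orthonormal frames of the plane -/

section Frame

/-- The Euclidean plane. -/
abbrev Plane : Type := EuclideanSpace ℝ (Fin 2)

/-- The coordinates of the plane in an orthonormal basis. -/
def frame (b : OrthonormalBasis (Fin 2) ℝ Plane) : ℝ × ℝ ≃ᵐ Plane :=
  (MeasurableEquiv.finTwoArrow.symm.trans (MeasurableEquiv.toLp 2 (Fin 2 → ℝ))).trans
    b.repr.symm.toMeasurableEquiv

lemma measurePreserving_frame (b : OrthonormalBasis (Fin 2) ℝ Plane) :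
    MeasurePreserving (frame b) :=
  ((PiLp.volume_preserving_toLp (Fin 2)).comp
    ((volume_preserving_finTwoArrow ℝ).symm _)).trans b.measurePreserving_repr_symm

lemma repr_frame (b : OrthonormalBasis (Fin 2) ℝ Plane) (p : ℝ × ℝ) :
    b.repr (frame b p) = !₂[p.1, p.2] :=
  b.repr.apply_symm_apply _

lemma frame_apply (b : OrthonormalBasis (Fin 2) ℝ Plane) (p : ℝ × ℝ) :
    frame b p = p.1 • b 0 + p.2 • b 1 := by
  rw [← b.sum_repr (frame b p), Fin.sum_univ_two, repr_frame]
  simp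

lemma continuous_frame (b : OrthonormalBasis (Fin 2) ℝ Plane) : Continuous (frame b) := by
  have : (frame b : ℝ × ℝ → Plane) = fun p => p.1 • b 0 + p.2 • b 1 := funext (frame_apply b)
  rw [this]
  fun_prop

lemma setIntegral_frame {F : Type*} [NormedAddCommGroup F] [NormedSpace ℝ F]
    (b : OrthonormalBasis (Fin 2) ℝ Plane) (f : Plane → F) (S : Set Plane) :
    ∫ p in frame b ⁻¹' S, f (frame b p) = ∫ x in S, f x :=
  (measurePreserving_frame b).setIntegral_preimage_emb (frame b).measurableEmbedding f S

lemma hasDerivAt_frame_fst (b : OrthonormalBasis (Fin 2) ℝ Plane) {f : Plane → ℂ}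
    (hf : ContDiff ℝ ∞ f) (s t : ℝ) :
    HasDerivAt (fun s => f (frame b (s, t))) (fderiv ℝ f (frame b (s, t)) (b 0)) s := by
  have h1 : HasDerivAt (fun s => frame b (s, t)) (b 0) s := by
    simp_rw [frame_apply]
    simpa using ((hasDerivAt_id s).smul_const (b 0)).add_const (t • b 1)
  exact (hf.differentiable (by simp) _).hasFDerivAt.comp_hasDerivAt s h1

lemma hasDerivAt_frame_snd (b : OrthonormalBasis (Fin 2) ℝ Plane) {f : Plane → ℂ}
    (hf : ContDiff ℝ ∞ f) (s t : ℝ) :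
    HasDerivAt (fun t => f (frame b (s, t))) (fderiv ℝ f (frame b (s, t)) (b 1)) t := by
  have h1 : HasDerivAt (fun t => frame b (s, t)) (b 1) t := by
    simp_rw [frame_apply]
    simpa using ((hasDerivAt_id t).smul_const (b 1)).const_add (s • b 0)
  exact (hf.differentiable (by simp) _).hasFDerivAt.comp_hasDerivAt t h1

/-- The squared norm of the gradient. -/
def gradSq (f : Plane → ℂ) (x : Plane) : ℝ := ∑ i, ‖partialDeriv i f x‖ ^ 2

lemma gradSq_nonneg (f : Plane → ℂ) (x : Plane) : 0 ≤ gradSq f x :=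
  Finset.sum_nonneg fun _ _ => by positivity

/-- Cauchy–Schwarz in the coordinates of `v`. It bounds the derivative across a slanted arm by the
gradient in the standard coordinates. -/
lemma norm_sq_fderiv_le_gradSq (f : Plane → ℂ) (x v : Plane) (hv : ‖v‖ = 1) :
    ‖fderiv ℝ f x v‖ ^ 2 ≤ gradSq f x := by
  have e : v = ∑ i, v i • EuclideanSpace.single i (1 : ℝ) := by
    have := (EuclideanSpace.basisFun (Fin 2) ℝ).sum_repr v
    simpa using this.symm
  have h1 : fderiv ℝ f x v = ∑ i, v i • partialDeriv i f x := by
    conv_lhs => rw [e]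
    simp only [map_sum, map_smul]
    rfl
  have h2 : ‖fderiv ℝ f x v‖ ≤ ∑ i, |v i| * ‖partialDeriv i f x‖ := by
    rw [h1]
    refine (norm_sum_le _ _).trans (Finset.sum_le_sum fun i _ => ?_)
    rw [norm_smul, Real.norm_eq_abs]
  have h3 : ∑ i, |v i| ^ 2 = 1 := by
    have := EuclideanSpace.norm_sq_eq v
    rw [hv, one_pow] at this
    simpa using this.symm
  calc _ ≤ (∑ i, |v i| * ‖partialDeriv i f x‖) ^ 2 := by gcongr
    _ ≤ (∑ i, |v i| ^ 2) * ∑ i, ‖partialDeriv i f x‖ ^ 2 := Finset.sum_mul_sq_le_sq_mul_sq _ _ _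
    _ = _ := by rw [h3, one_mul, gradSq]

lemma continuous_partialDeriv_of_contDiff {f : Plane → ℂ} (hf : ContDiff ℝ ∞ f) (i : Fin 2) :
    Continuous (partialDeriv i f) := (contDiff_partialDeriv hf i).continuous

lemma continuous_gradSq {f : Plane → ℂ} (hf : ContDiff ℝ ∞ f) : Continuous (gradSq f) :=
  continuous_finsetSum _ fun i _ => (continuous_partialDeriv_of_contDiff hf i).norm.pow 2

lemma integrable_norm_sq {f : Plane → ℂ} (hf : ContDiff ℝ ∞ f) (hs : HasCompactSupport f) :
    Integrable fun x => ‖f x‖ ^ 2 := by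
  have h1 : Continuous fun x => ‖f x‖ ^ 2 := hf.continuous.norm.pow 2
  have h2 : HasCompactSupport fun x => ‖f x‖ ^ 2 := by
    refine hs.mono fun x hx h0 => hx ?_
    change ‖f x‖ ^ 2 = 0
    rw [h0, norm_zero, zero_pow two_ne_zero]
  exact h1.integrable_of_hasCompactSupport h2

lemma integrable_gradSq {f : Plane → ℂ} (hf : ContDiff ℝ ∞ f) (hs : HasCompactSupport f) :
    Integrable (gradSq f) :=
  integrable_finsetSum _ fun i _ => integrable_norm_sq (contDiff_partialDeriv hf i)
    (hs.fderiv_apply (𝕜 := ℝ) _)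

end Frame

/-! ### A finite rank bound for the `L²` norm on bounded sets -/

section Cells

/-- The half-open square of side `ℓ` with upper right corner `ℓ k`. -/
def cell (ℓ : ℝ) (k : ℤ × ℤ) : Set Plane := {x | ⌈x 0 / ℓ⌉ = k.1 ∧ ⌈x 1 / ℓ⌉ = k.2}

lemma ceil_div_eq_iff {ℓ : ℝ} (hℓ : 0 < ℓ) (t : ℝ) (k : ℤ) :
    ⌈t / ℓ⌉ = k ↔ t ∈ Set.Ioc ((k - 1) * ℓ) ((k - 1) * ℓ + ℓ) := by
  rw [Int.ceil_eq_iff, lt_div_iff₀ hℓ, div_le_iff₀ hℓ, Set.mem_Ioc]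
  ring_nf

lemma measurableSet_cell (ℓ : ℝ) (k : ℤ × ℤ) : MeasurableSet (cell ℓ k) := by
  have h : ∀ i : Fin 2, Measurable fun x : Plane => ⌈x i / ℓ⌉ := fun i =>
    Int.measurable_ceil.comp (Measurable.div_const (by fun_prop) ℓ)
  exact (measurableSet_eq_fun (h 0) measurable_const).inter
    (measurableSet_eq_fun (h 1) measurable_const)

lemma pairwise_disjoint_cell (ℓ : ℝ) (K : Finset (ℤ × ℤ)) :
    (K : Set (ℤ × ℤ)).Pairwise (Function.onFun Disjoint (cell ℓ)) := by
  intro k _ k' _ hne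
  refine Set.disjoint_left.mpr fun x hx hx' => hne ?_
  exact Prod.ext (hx.1.symm.trans hx'.1) (hx.2.symm.trans hx'.2)

lemma preimage_cell {ℓ : ℝ} (hℓ : 0 < ℓ) (k : ℤ × ℤ) :
    frame (EuclideanSpace.basisFun (Fin 2) ℝ) ⁻¹' cell ℓ k =
      Set.Ioc ((k.1 - 1) * ℓ) ((k.1 - 1) * ℓ + ℓ) ×ˢ
        Set.Ioc ((k.2 - 1) * ℓ) ((k.2 - 1) * ℓ + ℓ) := by
  ext p
  have h0 : frame (EuclideanSpace.basisFun (Fin 2) ℝ) p 0 = p.1 := by simp [frame_apply]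
  have h1 : frame (EuclideanSpace.basisFun (Fin 2) ℝ) p 1 = p.2 := by simp [frame_apply]
  simp only [cell, Set.mem_preimage, Set.mem_ofPred_eq, h0, h1, ceil_div_eq_iff hℓ, Set.mem_prod]

lemma measure_cell_lt_top {ℓ : ℝ} (hℓ : 0 < ℓ) (k : ℤ × ℤ) : volume (cell ℓ k) < ⊤ := by
  rw [← (measurePreserving_frame (EuclideanSpace.basisFun (Fin 2) ℝ)).measure_preimage_equiv,
    preimage_cell hℓ, Measure.volume_eq_prod, Measure.prod_prod]
  exact ENNReal.mul_lt_top (by simp) (by simp)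

lemma poincare_cell {f : Plane → ℂ} (hf : ContDiff ℝ ∞ f) {ℓ : ℝ} (hℓ : 0 < ℓ) (k : ℤ × ℤ) :
    ∫ x in cell ℓ k, ‖f x‖ ^ 2 ≤
      (ℓ⁻¹) ^ 2 * ‖∫ x in cell ℓ k, f x‖ ^ 2 + ℓ ^ 2 * ∫ x in cell ℓ k, gradSq f x := by
  set b := EuclideanSpace.basisFun (Fin 2) ℝ with hb
  rw [← setIntegral_frame b, ← setIntegral_frame b, ← setIntegral_frame b, hb, preimage_cell hℓ]
  have hfr := continuous_frame b
  have hd := hf.continuous_fderiv (by simp)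
  have := poincare_square (G := fun p => f (frame b p))
    (G1 := fun p => fderiv ℝ f (frame b p) (b 0))
    (G2 := fun p => fderiv ℝ f (frame b p) (b 1)) (hf.continuous.comp hfr)
    ((hd.comp hfr).clm_apply continuous_const) ((hd.comp hfr).clm_apply continuous_const)
    (fun x y => hasDerivAt_frame_fst b hf x y) (fun x y => hasDerivAt_frame_snd b hf x y)
    ((k.1 - 1) * ℓ) ((k.2 - 1) * ℓ) hℓ
  convert this using 6 with p
  rw [gradSq, Fin.sum_univ_two]
  simp [partialDeriv, hb]

/-- The square `[-L, L]²`. -/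
def box (L : ℝ) : Set Plane := {x | ∀ i, |x i| ≤ L}

lemma measurableSet_box (L : ℝ) : MeasurableSet (box L) := by
  rw [box, Set.ofPred_forall]
  exact MeasurableSet.iInter fun i => measurableSet_le (by fun_prop) measurable_const

lemma exists_finset_box_subset (L : ℝ) {ℓ : ℝ} (hℓ : 0 < ℓ) :
    ∃ K : Finset (ℤ × ℤ), box L ⊆ ⋃ k ∈ K, cell ℓ k := by
  refine ⟨Finset.Icc ⌈-L / ℓ⌉ ⌈L / ℓ⌉ ×ˢ Finset.Icc ⌈-L / ℓ⌉ ⌈L / ℓ⌉, fun x hx => ?_⟩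
  have h : ∀ i, ⌈x i / ℓ⌉ ∈ Finset.Icc ⌈-L / ℓ⌉ ⌈L / ℓ⌉ := fun i => by
    have := abs_le.mp (hx i)
    rw [Finset.mem_Icc]
    exact ⟨Int.ceil_mono (div_le_div_of_nonneg_right this.1 hℓ.le),
      Int.ceil_mono (div_le_div_of_nonneg_right this.2 hℓ.le)⟩
  simp only [Set.mem_iUnion]
  exact ⟨(⌈x 0 / ℓ⌉, ⌈x 1 / ℓ⌉), Finset.mem_product.mpr ⟨h 0, h 1⟩, rfl, rfl⟩

/-- Summation of `poincare_cell` over the grid. The gradient term carries `ℓ²`, so it can be made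
negligible at the price of more cell averages, which remain finitely many. -/
lemma setIntegral_box_le {f : Plane → ℂ} (hf : ContDiff ℝ ∞ f) (hs : HasCompactSupport f) {L ℓ : ℝ}
    (hℓ : 0 < ℓ) {K : Finset (ℤ × ℤ)} (hK : box L ⊆ ⋃ k ∈ K, cell ℓ k) :
    ∫ x in box L, ‖f x‖ ^ 2 ≤
      (ℓ⁻¹) ^ 2 * ∑ k ∈ K, ‖∫ x in cell ℓ k, f x‖ ^ 2 + ℓ ^ 2 * ∫ x, gradSq f x := by
  have hi := integrable_norm_sq hf hs
  have hg := integrable_gradSq hf hs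
  calc ∫ x in box L, ‖f x‖ ^ 2 ≤ ∫ x in ⋃ k ∈ K, cell ℓ k, ‖f x‖ ^ 2 :=
        setIntegral_mono_set hi.integrableOn (Filter.Eventually.of_forall fun _ => by positivity)
          (Filter.Eventually.of_forall hK)
    _ = ∑ k ∈ K, ∫ x in cell ℓ k, ‖f x‖ ^ 2 :=
        integral_biUnion_finset K (fun k _ => measurableSet_cell ℓ k) (pairwise_disjoint_cell ℓ K)
          fun _ _ => hi.integrableOn
    _ ≤ ∑ k ∈ K, ((ℓ⁻¹) ^ 2 * ‖∫ x in cell ℓ k, f x‖ ^ 2 +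
          ℓ ^ 2 * ∫ x in cell ℓ k, gradSq f x) := Finset.sum_le_sum fun k _ => poincare_cell hf hℓ k
    _ = (ℓ⁻¹) ^ 2 * ∑ k ∈ K, ‖∫ x in cell ℓ k, f x‖ ^ 2 +
          ℓ ^ 2 * ∫ x in ⋃ k ∈ K, cell ℓ k, gradSq f x := by
        rw [Finset.sum_add_distrib, ← Finset.mul_sum, ← Finset.mul_sum,
          integral_biUnion_finset K (fun k _ => measurableSet_cell ℓ k)
            (pairwise_disjoint_cell ℓ K) fun _ _ => hg.integrableOn]
    _ ≤ _ := by
        exact add_le_add le_rfl (mul_le_mul_of_nonneg_left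
          (setIntegral_le_integral hg (Filter.Eventually.of_forall (gradSq_nonneg f)))
          (sq_nonneg ℓ))

end Cells

/-! ### Half strips -/

section HalfStrip

/-- The half strip `{s > 0, 0 < t ≤ π}` in the coordinates `(s, t)` of an orthonormal basis. -/
def halfStrip (b : OrthonormalBasis (Fin 2) ℝ Plane) : Set Plane :=
  {x | 0 < b.repr x 0 ∧ b.repr x 1 ∈ Set.Ioc 0 Real.pi}

lemma measurableSet_halfStrip (b : OrthonormalBasis (Fin 2) ℝ Plane) :
    MeasurableSet (halfStrip b) := by
  have h : ∀ i : Fin 2, Measurable fun x : Plane => b.repr x i := fun i => by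
    have : Continuous fun x : Plane => b.repr x i := by fun_prop
    exact this.measurable
  exact (measurableSet_lt measurable_const (h 0)).inter (h 1 measurableSet_Ioc)

lemma preimage_halfStrip (b : OrthonormalBasis (Fin 2) ℝ Plane) :
    frame b ⁻¹' halfStrip b = Set.Ioi 0 ×ˢ Set.Ioc 0 Real.pi := by
  ext p
  simp only [halfStrip, Set.mem_preimage, Set.mem_ofPred_eq, repr_frame, Set.mem_prod, Set.mem_Ioi]
  simp

/-- Fubini, then Wirtinger on each cross section. Only the derivative in `t` is used, so no
condition is needed at the end `s = 0`. -/
lemma setIntegral_halfStrip_le (b : OrthonormalBasis (Fin 2) ℝ Plane) {f : Plane → ℂ}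
    (hf : ContDiff ℝ ∞ f) (hs : HasCompactSupport f) (h0 : ∀ s > 0, f (frame b (s, 0)) = 0)
    (hπ : ∀ s > 0, f (frame b (s, Real.pi)) = 0) :
    ∫ x in halfStrip b, ‖f x‖ ^ 2 ≤ ∫ x in halfStrip b, gradSq f x := by
  have hfr := continuous_frame b
  have hd := hf.continuous_fderiv (by simp)
  have hi : IntegrableOn (fun p => ‖f (frame b p)‖ ^ 2) (Set.Ioi (0 : ℝ) ×ˢ Set.Ioc 0 Real.pi)
      ((volume : Measure ℝ).prod volume) :=
    ((measurePreserving_frame b).integrable_comp_of_integrable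
      (integrable_norm_sq hf hs)).integrableOn
  have hg : IntegrableOn (fun p => gradSq f (frame b p)) (Set.Ioi (0 : ℝ) ×ˢ Set.Ioc 0 Real.pi)
      ((volume : Measure ℝ).prod volume) :=
    ((measurePreserving_frame b).integrable_comp_of_integrable
      (integrable_gradSq hf hs)).integrableOn
  rw [← setIntegral_frame b, ← setIntegral_frame b, preimage_halfStrip, Measure.volume_eq_prod,
    setIntegral_prod _ hi, setIntegral_prod _ hg]
  rw [IntegrableOn, ← Measure.prod_restrict] at hi hg
  refine setIntegral_mono_on hi.integral_prod_left hg.integral_prod_left measurableSet_Ioi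
    fun s hs => ?_
  have h1 := wirtinger (w := fun t => f (frame b (s, t)))
    (w' := fun t => fderiv ℝ f (frame b (s, t)) (b 1))
    (fun t => hasDerivAt_frame_snd b hf s t)
    ((hd.comp (hfr.comp (by fun_prop))).clm_apply continuous_const) (h0 s hs) (hπ s hs)
  rw [← intervalIntegral.integral_of_le Real.pi_pos.le,
    ← intervalIntegral.integral_of_le Real.pi_pos.le]
  refine h1.trans (intervalIntegral.integral_mono_on Real.pi_pos.le ?_ ?_ fun t _ => ?_)
  · refine Continuous.intervalIntegrable (Continuous.pow (Continuous.norm ?_) 2) _ _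
    exact (hd.comp (hfr.comp (by fun_prop))).clm_apply continuous_const
  · exact ((continuous_gradSq hf).comp (hfr.comp (by fun_prop))).intervalIntegrable _ _
  · exact norm_sq_fderiv_le_gradSq f _ _ (b.orthonormal.1 1)

end HalfStrip

/-! ### Fredholm property outside a half line from a coercivity estimate -/

section Coercive

variable {d : ℕ} {Ω : Opens (EuclideanSpace ℝ (Fin d))}

/-- Up to finite rank terms and an arbitrarily small loss, the Dirichlet form dominates the square
of the `L²` norm. -/
def CoerciveModFinite (Ω : Opens (EuclideanSpace ℝ (Fin d))) : Prop :=
  ∀ ε : ℝ, 0 < ε → ∃ (n : ℕ) (F : L2 Ω →L[ℂ] EuclideanSpace ℂ (Fin n)), ∀ x ∈ H10 Ω,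
    ‖x none‖ ^ 2 ≤ (1 + ε) * ∑ i, ‖x (some i)‖ ^ 2 + ‖F (x none)‖ ^ 2

/-- With `u = (A + 1)⁻¹ f`, the vector `(1 - (z + 1)(A + 1)⁻¹) f` is `(A - z) u`, and this is `⟨u,
(A - z) u⟩ = ‖∇u‖² - z ‖u‖²`. Its real part serves real `z < 1`, its imaginary part nonreal `z`. -/
lemma inner_resolventOp_sub (z : ℂ) (f : L2 Ω) : ∃ x ∈ H10 Ω, x none = resolventOp Ω f ∧
    inner ℂ (resolventOp Ω f) ((1 - (z + 1) • resolventOp Ω : L2 Ω →L[ℂ] L2 Ω) f) =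
      ((∑ i, ‖x (some i)‖ ^ 2 : ℝ) : ℂ) - z * (‖resolventOp Ω f‖ ^ 2 : ℝ) := by
  obtain ⟨x, hx, hxu, h⟩ := inner_resolventOp f
  refine ⟨x, hx, hxu, ?_⟩
  change inner ℂ (resolventOp Ω f) (f - (z + 1) • resolventOp Ω f) = _
  rw [inner_sub_right, inner_smul_right, h, inner_self_eq_norm_sq_to_K, hxu]
  push_cast
  change _ - (z + 1) * (‖resolventOp Ω f‖ : ℂ) ^ 2 = _
  ring

/-- For nonreal `z`, the form identity gives `|Im z| ‖u‖² ≤ ‖u‖ ‖(A - z) u‖` and no functional is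
needed. For real `z < 1`, coercivity with `(1 + ε) z < 1` absorbs the term `z ‖u‖²`. -/
lemma exists_estimate (hΩ : CoerciveModFinite Ω) {z : ℂ}
    (hz : z ∉ Complex.ofReal '' Set.Ici (1 : ℝ)) :
    ∃ (n : ℕ) (F : L2 Ω →L[ℂ] EuclideanSpace ℂ (Fin n)) (C : ℝ), ∀ f : L2 Ω,
      ‖f‖ ≤ C * (‖(1 - (z + 1) • resolventOp Ω : L2 Ω →L[ℂ] L2 Ω) f‖ + ‖F f‖) := by
  -- Bounding `u = (A + 1)⁻¹ f` is enough, because `f = T f + (z + 1) u`.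
  suffices h : ∃ (n : ℕ) (F : L2 Ω →L[ℂ] EuclideanSpace ℂ (Fin n)) (C : ℝ), 0 ≤ C ∧ ∀ f : L2 Ω,
      ‖resolventOp Ω f‖ ≤ C * (‖(1 - (z + 1) • resolventOp Ω : L2 Ω →L[ℂ] L2 Ω) f‖ +
        ‖F (resolventOp Ω f)‖) by
    obtain ⟨n, F, C, hC0, hC⟩ := h
    refine ⟨n, F.comp (resolventOp Ω), 1 + ‖z + 1‖ * C, fun f => ?_⟩
    set T : L2 Ω →L[ℂ] L2 Ω := 1 - (z + 1) • resolventOp Ω with hT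
    have e : f = T f + (z + 1) • resolventOp Ω f := by
      change f = f - (z + 1) • resolventOp Ω f + (z + 1) • resolventOp Ω f
      rw [sub_add_cancel]
    have h1 : ‖f‖ ≤ ‖T f‖ + ‖z + 1‖ * ‖resolventOp Ω f‖ := by
      conv_lhs => rw [e]
      refine (norm_add_le _ _).trans ?_
      rw [norm_smul]
    have h2 := mul_le_mul_of_nonneg_left (hC f) (norm_nonneg (z + 1))
    change ‖f‖ ≤ (1 + ‖z + 1‖ * C) * (‖T f‖ + ‖F (resolventOp Ω f)‖)
    have h3 := norm_nonneg (F (resolventOp Ω f))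
    nlinarith
  by_cases him : z.im = 0
  · have hre : z.re < 1 := by
      by_contra! h
      exact hz ⟨z.re, h, Complex.ext rfl him.symm⟩
    obtain ⟨ε, hε, hc⟩ : ∃ ε : ℝ, 0 < ε ∧ 0 < 1 - (1 + ε) * z.re := by
      rcases le_or_gt z.re 0 with h | h
      · exact ⟨1, one_pos, by linarith⟩
      -- With this `ε` and `x = Re z`, one has `1 - (1 + ε) x = (1 - x)(2 - x) / 2 > 0`.
      · refine ⟨(1 - z.re) / 2, by linarith, ?_⟩
        nlinarith
    obtain ⟨n, F, hF⟩ := hΩ ε hε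
    set c := 1 - (1 + ε) * z.re with hcdef
    -- The inequality to reach is `c ‖u‖² ≤ (1 + ε) ‖u‖ ‖r‖ + ‖F‖ ‖u‖ ‖F u‖`, divided by `c ‖u‖`;
    -- the sum `1 + ε + ‖F‖` dominates both coefficients.
    refine ⟨n, F, c⁻¹ * (1 + ε + ‖F‖), by positivity, fun f => ?_⟩
    obtain ⟨x, hx, hxu, hin⟩ := inner_resolventOp_sub z f
    have hco := hF x hx
    rw [hxu] at hco
    set u := resolventOp Ω f with hu
    set r := (1 - (z + 1) • resolventOp Ω : L2 Ω →L[ℂ] L2 Ω) f with hr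
    have hre1 := congrArg Complex.re hin
    simp only [Complex.sub_re, Complex.ofReal_re, Complex.mul_re, Complex.ofReal_im, mul_zero,
      sub_zero] at hre1
    have hcs : Complex.re (inner ℂ u r) ≤ ‖u‖ * ‖r‖ :=
      (Complex.re_le_norm _).trans (norm_inner_le_norm u r)
    have hFu := F.le_opNorm u
    rcases (norm_nonneg u).eq_or_lt with h0 | hpos
    · rw [← h0]
      positivity
    rw [mul_assoc, ← div_eq_inv_mul, le_div_iff₀ hc]
    refine le_of_mul_le_mul_right ?_ hpos
    have h4 : ‖F u‖ ^ 2 ≤ ‖F‖ * ‖u‖ * ‖F u‖ := by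
      rw [sq]
      exact mul_le_mul_of_nonneg_right hFu (norm_nonneg _)
    have h5 : (1 + ε) * ∑ i, ‖x (some i)‖ ^ 2 ≤ (1 + ε) * (‖u‖ * ‖r‖ + z.re * ‖u‖ ^ 2) :=
      mul_le_mul_of_nonneg_left (by linarith) (by linarith)
    have h6 : 0 ≤ (1 + ε) * ‖F u‖ * ‖u‖ := by positivity
    have h7 : 0 ≤ ‖F‖ * ‖r‖ * ‖u‖ := by positivity
    have h8 : ‖u‖ * c * ‖u‖ = ‖u‖ ^ 2 - (1 + ε) * (z.re * ‖u‖ ^ 2) := by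
      rw [hcdef]
      ring
    rw [h8]
    linarith
  · refine ⟨0, 0, |z.im|⁻¹, by positivity, fun f => ?_⟩
    obtain ⟨x, hx, hxu, hin⟩ := inner_resolventOp_sub z f
    set u := resolventOp Ω f with hu
    set r := (1 - (z + 1) • resolventOp Ω : L2 Ω →L[ℂ] L2 Ω) f with hr
    have him1 := congrArg (fun w => |Complex.im w|) hin
    simp only [Complex.sub_im, Complex.ofReal_im, Complex.mul_im, Complex.ofReal_re, mul_zero,
      zero_sub, zero_add, abs_neg, abs_mul, abs_pow, abs_norm] at him1
    have hcs : |Complex.im (inner ℂ u r)| ≤ ‖u‖ * ‖r‖ :=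
      (Complex.abs_im_le_norm _).trans (norm_inner_le_norm u r)
    have hpos' : 0 < |z.im| := abs_pos.mpr him
    rcases (norm_nonneg u).eq_or_lt with h0 | hpos
    · rw [← h0]
      positivity
    rw [← div_eq_inv_mul, le_div_iff₀ hpos']
    refine le_of_mul_le_mul_right ?_ hpos
    simp only [zero_apply, norm_zero, add_zero]
    linarith

lemma conj_notMem {z : ℂ} (hz : z ∉ Complex.ofReal '' Set.Ici (1 : ℝ)) :
    (starRingEnd ℂ) z ∉ Complex.ofReal '' Set.Ici (1 : ℝ) := by
  rintro ⟨r, hr, h⟩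
  refine hz ⟨r, hr, ?_⟩
  rw [← Complex.conj_conj z, ← h, Complex.conj_ofReal]

/-- The estimate at `z` gives kernel and range. As the resolvent at `-1` is self-adjoint, the
adjoint is the same operator at the conjugate of `z`, also off `[1, ∞)`, and its kernel controls the
cokernel. -/
theorem isFredholm_of_coerciveModFinite (hΩ : CoerciveModFinite Ω) {z : ℂ}
    (hz : z ∉ Complex.ofReal '' Set.Ici (1 : ℝ)) :
    IsFredholm (subScalar (dirichletLaplacian Ω) z) := by
  rw [isFredholm_subScalar_iff]
  obtain ⟨n, F, C, h⟩ := exists_estimate hΩ hz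
  obtain ⟨n', F', C', h'⟩ := exists_estimate hΩ (conj_notMem hz)
  have hadj : (1 - (z + 1) • resolventOp Ω : L2 Ω →L[ℂ] L2 Ω).adjoint =
      1 - ((starRingEnd ℂ) z + 1) • resolventOp Ω := by
    have h1 : (1 : L2 Ω →L[ℂ] L2 Ω).adjoint = 1 := ContinuousLinearMap.adjoint_id
    rw [map_sub, map_smulₛₗ, adjoint_resolventOp, h1, map_add, map_one]
  have hcl := isClosed_range_of_estimate _ F h
  refine ⟨finiteDimensional_ker_of_estimate _ F h, hcl, finiteDimensional_quotient_range _ hcl ?_⟩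
  rw [hadj]
  exact finiteDimensional_ker_of_estimate _ F' h'

end Coercive

/-! ### Geometry of the broken guide -/

section Geometry

lemma orthonormal_guide (θ : ℝ) {σ : ℝ} (hσ : σ * σ = 1) :
    Orthonormal ℝ (![!₂[Real.cos θ, σ * Real.sin θ], !₂[-Real.sin θ, σ * Real.cos θ]] :
      Fin 2 → Plane) := by
  have h := Real.sin_sq_add_cos_sq θ
  have key : ∀ v w : Plane, inner ℝ v w = v 0 * w 0 + v 1 * w 1 := fun v w => by
    simp [PiLp.inner_apply, Fin.sum_univ_two]
    ring
  rw [orthonormal_iff_ite]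
  intro i j
  rw [key]
  fin_cases i <;> fin_cases j <;> simp
  · linear_combination h + Real.sin θ ^ 2 * hσ
  · linear_combination Real.sin θ * Real.cos θ * hσ
  · linear_combination Real.sin θ * Real.cos θ * hσ
  · linear_combination h + Real.cos θ ^ 2 * hσ

/-- The tangential and normal unit vectors of the upper (`σ = 1`) and lower (`σ = -1`) arms. -/
def guideBasis (θ : ℝ) {σ : ℝ} (hσ : σ * σ = 1) : OrthonormalBasis (Fin 2) ℝ Plane :=
  (basisOfOrthonormalOfCardEqFinrank (orthonormal_guide θ hσ) (by simp)).toOrthonormalBasis (by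
    rw [coe_basisOfOrthonormalOfCardEqFinrank]
    exact orthonormal_guide θ hσ)

lemma guideBasis_zero (θ : ℝ) {σ : ℝ} (hσ : σ * σ = 1) :
    guideBasis θ hσ 0 = !₂[Real.cos θ, σ * Real.sin θ] := by
  simp [guideBasis]

lemma guideBasis_one (θ : ℝ) {σ : ℝ} (hσ : σ * σ = 1) :
    guideBasis θ hσ 1 = !₂[-Real.sin θ, σ * Real.cos θ] := by
  simp [guideBasis]

lemma guideBasis_repr_zero (θ : ℝ) {σ : ℝ} (hσ : σ * σ = 1) (x : Plane) :
    (guideBasis θ hσ).repr x 0 = x 0 * Real.cos θ + σ * x 1 * Real.sin θ := by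
  rw [OrthonormalBasis.repr_apply_apply, guideBasis_zero]
  simp [PiLp.inner_apply, Fin.sum_univ_two]
  ring

lemma guideBasis_repr_one (θ : ℝ) {σ : ℝ} (hσ : σ * σ = 1) (x : Plane) :
    (guideBasis θ hσ).repr x 1 = -(x 0 * Real.sin θ) + σ * x 1 * Real.cos θ := by
  rw [OrthonormalBasis.repr_apply_apply, guideBasis_one]
  simp [PiLp.inner_apply, Fin.sum_univ_two]
  ring

lemma frame_guideBasis_zero (θ : ℝ) {σ : ℝ} (hσ : σ * σ = 1) (s t : ℝ) :
    frame (guideBasis θ hσ) (s, t) 0 = s * Real.cos θ - t * Real.sin θ := by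
  rw [frame_apply, guideBasis_zero, guideBasis_one]
  simp
  ring

lemma frame_guideBasis_one (θ : ℝ) {σ : ℝ} (hσ : σ * σ = 1) (s t : ℝ) :
    frame (guideBasis θ hσ) (s, t) 1 = σ * (s * Real.sin θ + t * Real.cos θ) := by
  rw [frame_apply, guideBasis_zero, guideBasis_one]
  simp
  ring

lemma sin_pos_of_mem {θ : ℝ} (hθ : θ ∈ Set.Ioo 0 (Real.pi / 2)) : 0 < Real.sin θ :=
  Real.sin_pos_of_pos_of_lt_pi hθ.1 (by linarith [hθ.2, Real.pi_pos])

lemma cos_pos_of_mem {θ : ℝ} (hθ : θ ∈ Set.Ioo 0 (Real.pi / 2)) : 0 < Real.cos θ :=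
  Real.cos_pos_of_mem_Ioo ⟨by linarith [hθ.1, Real.pi_pos], hθ.2⟩

/-- After multiplication by `cos θ > 0`, the quantity bounded is the signed distance to the line
carrying the inner wall, on the side of the point; the shift `π / sin θ` makes the width exactly π.
-/
lemma mem_brokenGuide_iff {θ : ℝ} (hθ : θ ∈ Set.Ioo 0 (Real.pi / 2)) {x : Plane} :
    x ∈ brokenGuide θ ↔ 0 < |x 1| * Real.cos θ - x 0 * Real.sin θ ∧
      |x 1| * Real.cos θ - x 0 * Real.sin θ < Real.pi := by
  have hs := sin_pos_of_mem hθ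
  have hc := cos_pos_of_mem hθ
  change (x 0 * Real.tan θ < |x 1| ∧ |x 1| < (x 0 + Real.pi / Real.sin θ) * Real.tan θ) ↔ _
  rw [Real.tan_eq_sin_div_cos, ← mul_div_assoc, div_lt_iff₀ hc, ← mul_div_assoc, lt_div_iff₀ hc,
    add_mul, div_mul_cancel₀ _ hs.ne']
  constructor <;> rintro ⟨h1, h2⟩ <;> constructor <;> linarith

lemma mem_brokenGuide_iff_repr {θ : ℝ} (hθ : θ ∈ Set.Ioo 0 (Real.pi / 2))
    {σ : ℝ} (hσ : σ * σ = 1) {x : Plane} (hx : 0 ≤ σ * x 1) :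
    x ∈ brokenGuide θ ↔ (guideBasis θ hσ).repr x 1 ∈ Set.Ioo 0 Real.pi := by
  have habs : |x 1| = σ * x 1 := by
    have h1 : |σ| = 1 := by
      have := abs_mul_abs_self σ
      rw [hσ] at this
      nlinarith [abs_nonneg σ]
    rw [← abs_of_nonneg hx, abs_mul, h1, one_mul]
  rw [mem_brokenGuide_iff hθ, guideBasis_repr_one, habs, Set.mem_Ioo]
  constructor <;> rintro ⟨h1, h2⟩ <;> constructor <;> linarith

/-- In the arm's coordinates, `σ x₂ = s sin θ + t cos θ` with `s, t > 0`. Each half strip thus stays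
on its side of the axis. -/
lemma pos_of_mem_halfStrip {θ : ℝ} (hθ : θ ∈ Set.Ioo 0 (Real.pi / 2))
    {σ : ℝ} (hσ : σ * σ = 1) {x : Plane}
    (hx : x ∈ halfStrip (guideBasis θ hσ)) : 0 < σ * x 1 := by
  have hs := sin_pos_of_mem hθ
  have hc := cos_pos_of_mem hθ
  have h1 := hx.1
  have h2 := hx.2.1
  rw [guideBasis_repr_zero] at h1
  rw [guideBasis_repr_one] at h2
  have h3 := Real.sin_sq_add_cos_sq θ
  have h4 : σ * x 1 = (x 0 * Real.cos θ + σ * x 1 * Real.sin θ) * Real.sin θ +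
      (-(x 0 * Real.sin θ) + σ * x 1 * Real.cos θ) * Real.cos θ := by
    linear_combination -(σ * x 1) * h3
  rw [h4]
  positivity

lemma disjoint_halfStrip {θ : ℝ} (hθ : θ ∈ Set.Ioo 0 (Real.pi / 2))
    {σ τ : ℝ} (hσ : σ * σ = 1) (hτ : τ * τ = 1) (h : σ = -τ) :
    Disjoint (halfStrip (guideBasis θ hσ)) (halfStrip (guideBasis θ hτ)) := by
  refine Set.disjoint_left.mpr fun x hx hx' => ?_
  have h1 := pos_of_mem_halfStrip hθ hσ hx
  have h2 := pos_of_mem_halfStrip hθ hτ hx'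
  rw [h] at h1
  linarith

/-- If `s ≤ 0`, then `s sin θ + t cos θ ≥ 0` and `t < π` force `s ≥ -π / sin θ`. The half-side of
the box bounds `|s| + |t|`. -/
lemma mem_halfStrip_or_mem_box {θ : ℝ} (hθ : θ ∈ Set.Ioo 0 (Real.pi / 2))
    {σ : ℝ} (hσ : σ * σ = 1) {x : Plane} (hx : 0 ≤ σ * x 1)
    (hm : x ∈ brokenGuide θ) :
    x ∈ halfStrip (guideBasis θ hσ) ∨ x ∈ box (Real.pi / Real.sin θ + Real.pi) := by
  have hs := sin_pos_of_mem hθ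
  have hc := cos_pos_of_mem hθ
  have hpi := Real.pi_pos
  rw [mem_brokenGuide_iff_repr hθ hσ hx] at hm
  by_cases h0 : 0 < (guideBasis θ hσ).repr x 0
  · exact Or.inl ⟨h0, hm.1, hm.2.le⟩
  right
  obtain ⟨ht0, htπ⟩ := hm
  rw [not_lt] at h0
  set s := (guideBasis θ hσ).repr x 0 with hsd
  set t := (guideBasis θ hσ).repr x 1 with htd
  have hx' : x = frame (guideBasis θ hσ) (s, t) := by
    refine (guideBasis θ hσ).repr.injective ?_
    rw [repr_frame]
    ext i
    fin_cases i <;> rfl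
  have hx1 : x 1 = σ * (s * Real.sin θ + t * Real.cos θ) := by
    conv_lhs => rw [hx', frame_guideBasis_one]
  have hx0 : x 0 = s * Real.cos θ - t * Real.sin θ := by
    conv_lhs => rw [hx', frame_guideBasis_zero]
  have hpos : 0 ≤ s * Real.sin θ + t * Real.cos θ := by
    rw [hx1, ← mul_assoc, hσ, one_mul] at hx
    exact hx
  have hs1 := Real.sin_le_one θ
  have hc1 := Real.cos_le_one θ
  have hsb : -(Real.pi / Real.sin θ) ≤ s := by
    rw [neg_le, le_div_iff₀ hs]
    nlinarith
  have hps : 0 < Real.pi / Real.sin θ := by positivity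
  intro i
  fin_cases i
  · change |x 0| ≤ _
    rw [hx0, abs_le]
    constructor <;> nlinarith
  · change |x 1| ≤ _
    have h1 : |σ| = 1 := by
      have := abs_mul_abs_self σ
      rw [hσ] at this
      nlinarith [abs_nonneg σ]
    rw [hx1, abs_mul, h1, one_mul, abs_of_nonneg hpos]
    nlinarith

lemma notMem_brokenGuide_frame {θ : ℝ} (hθ : θ ∈ Set.Ioo 0 (Real.pi / 2))
    {σ : ℝ} (hσ : σ * σ = 1) {s t : ℝ} (hs0 : 0 < s)
    (ht : t = 0 ∨ t = Real.pi) : frame (guideBasis θ hσ) (s, t) ∉ brokenGuide θ := by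
  have hs := sin_pos_of_mem hθ
  have hc := cos_pos_of_mem hθ
  have ht0 : 0 ≤ t := by
    rcases ht with rfl | rfl
    · exact le_rfl
    · exact Real.pi_pos.le
  rw [mem_brokenGuide_iff_repr hθ hσ, repr_frame]
  · rcases ht with rfl | rfl <;> simp
  · rw [frame_guideBasis_one, ← mul_assoc, hσ, one_mul]
    positivity

/-- The two half strips are disjoint and, together with the box, cover the guide. Wirtinger handles
the strips with constant 1; what they miss lies in the box. -/
lemma integral_norm_sq_le_gradSq_add_box {θ : ℝ} (hθ : θ ∈ Set.Ioo 0 (Real.pi / 2))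
    (φ : 𝓓(brokenGuide θ, ℂ)) :
    ∫ x, ‖φ x‖ ^ 2 ≤
      (∫ x, gradSq φ x) + ∫ x in box (Real.pi / Real.sin θ + Real.pi), ‖φ x‖ ^ 2 := by
  have hp : (1 : ℝ) * 1 = 1 := one_mul 1
  have hn : (-1 : ℝ) * -1 = 1 := by norm_num
  set U := halfStrip (guideBasis θ hp) with hU
  set D := halfStrip (guideBasis θ hn) with hD
  set Q := box (Real.pi / Real.sin θ + Real.pi) with hQ
  have hi := integrable_norm_sq φ.contDiff φ.hasCompactSupport
  have hg := integrable_gradSq φ.contDiff φ.hasCompactSupport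
  have hdisj : Disjoint U D := disjoint_halfStrip hθ hp hn (by norm_num)
  have hz : ∀ x, x ∉ brokenGuide θ → φ x = 0 := fun x hx =>
    image_eq_zero_of_notMem_tsupport fun h => hx (φ.tsupport_subset h)
  have hstrip : ∀ {σ : ℝ} (hσ : σ * σ = 1), ∫ x in halfStrip (guideBasis θ hσ), ‖φ x‖ ^ 2 ≤
      ∫ x in halfStrip (guideBasis θ hσ), gradSq φ x := fun hσ =>
    setIntegral_halfStrip_le _ φ.contDiff φ.hasCompactSupport
      (fun s hs => hz _ (notMem_brokenGuide_frame hθ hσ hs (Or.inl rfl)))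
      (fun s hs => hz _ (notMem_brokenGuide_frame hθ hσ hs (Or.inr rfl)))
  have hcover : ∀ x ∈ brokenGuide θ, x ∈ (U ∪ D) ∪ Q := by
    intro x hx
    rcases le_total 0 (x 1) with h | h
    · rcases mem_halfStrip_or_mem_box hθ hp (by rwa [one_mul]) hx with h' | h'
      · exact Or.inl (Or.inl h')
      · exact Or.inr h'
    · rcases mem_halfStrip_or_mem_box hθ hn (by linarith) hx with h' | h'
      · exact Or.inl (Or.inr h')
      · exact Or.inr h'
  have hUD : MeasurableSet (U ∪ D) :=
    (measurableSet_halfStrip _).union (measurableSet_halfStrip _)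
  calc ∫ x, ‖φ x‖ ^ 2 = ∫ x in (U ∪ D) ∪ Q, ‖φ x‖ ^ 2 :=
        (setIntegral_eq_integral_of_forall_compl_eq_zero fun x hx => by
          rw [hz x fun h => hx (hcover x h), norm_zero, zero_pow two_ne_zero]).symm
    _ = ∫ x in (U ∪ D) ∪ (Q \ (U ∪ D)), ‖φ x‖ ^ 2 := by rw [Set.union_sdiff_self]
    _ = (∫ x in U ∪ D, ‖φ x‖ ^ 2) + ∫ x in Q \ (U ∪ D), ‖φ x‖ ^ 2 :=
        setIntegral_union Set.disjoint_sdiff_right ((measurableSet_box _).diff hUD)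
          hi.integrableOn hi.integrableOn
    _ ≤ (∫ x in U ∪ D, gradSq φ x) + ∫ x in Q, ‖φ x‖ ^ 2 := by
        refine add_le_add ?_ (setIntegral_mono_set hi.integrableOn
          (Filter.Eventually.of_forall fun _ => by positivity)
          (Filter.Eventually.of_forall Set.sdiff_subset))
        rw [setIntegral_union hdisj (measurableSet_halfStrip _) hi.integrableOn hi.integrableOn,
          setIntegral_union hdisj (measurableSet_halfStrip _) hg.integrableOn hg.integrableOn]
        exact add_le_add (hstrip hp) (hstrip hn)
    _ ≤ _ := add_le_add
        (setIntegral_le_integral hg (Filter.Eventually.of_forall (gradSq_nonneg φ))) le_rfl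

end Geometry

/-! ### The essential spectrum is contained in `[1, ∞)` -/

section UpperBound

lemma norm_sq_contL2 {d : ℕ} {Ω : Opens (EuclideanSpace ℝ (Fin d))}
    {ψ : EuclideanSpace ℝ (Fin d) → ℂ} (hc : Continuous ψ) (hs : HasCompactSupport ψ) :
    ‖contL2 Ω hc hs‖ ^ 2 = ∫ x in (Ω : Set (EuclideanSpace ℝ (Fin d))), ‖ψ x‖ ^ 2 := by
  have h := inner_contL2 (contL2 Ω hc hs) hc hs
  rw [inner_self_eq_norm_sq_to_K] at h
  have h2 : ∫ x in (Ω : Set (EuclideanSpace ℝ (Fin d))), contL2 Ω hc hs x * (starRingEnd ℂ) (ψ x) =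
      ∫ x in (Ω : Set (EuclideanSpace ℝ (Fin d))), ((‖ψ x‖ ^ 2 : ℝ) : ℂ) := by
    refine integral_congr_ae ?_
    filter_upwards [coeFn_contL2 (Ω := Ω) hc hs] with x hx
    rw [hx, Complex.mul_conj, Complex.normSq_eq_norm_sq]
  have h3 : ∫ x in (Ω : Set (EuclideanSpace ℝ (Fin d))), ((‖ψ x‖ ^ 2 : ℝ) : ℂ) =
      ((∫ x in (Ω : Set (EuclideanSpace ℝ (Fin d))), ‖ψ x‖ ^ 2 : ℝ) : ℂ) := integral_ofReal
  have h4 := h.trans (h2.trans h3)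
  change ((‖contL2 Ω hc hs‖ : ℝ) : ℂ) ^ 2 = _ at h4
  exact_mod_cast h4

lemma setIntegral_norm_sq_test {d : ℕ} {Ω : Opens (EuclideanSpace ℝ (Fin d))} (φ : 𝓓(Ω, ℂ)) :
    ∫ x in (Ω : Set (EuclideanSpace ℝ (Fin d))), ‖φ x‖ ^ 2 = ∫ x, ‖φ x‖ ^ 2 :=
  setIntegral_eq_integral_of_forall_compl_eq_zero fun x hx => by
    rw [image_eq_zero_of_notMem_tsupport (fun h => hx (φ.tsupport_subset h)), norm_zero,
      zero_pow two_ne_zero]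

lemma norm_sq_testJet_none {d : ℕ} {Ω : Opens (EuclideanSpace ℝ (Fin d))} (φ : 𝓓(Ω, ℂ)) :
    ‖testJet φ none‖ ^ 2 = ∫ x, ‖φ x‖ ^ 2 := by
  rw [testJet_none, norm_sq_contL2, setIntegral_norm_sq_test]

lemma norm_sq_testJet_some {d : ℕ} {Ω : Opens (EuclideanSpace ℝ (Fin d))} (φ : 𝓓(Ω, ℂ))
    (i : Fin d) : ‖testJet φ (some i)‖ ^ 2 = ∫ x, ‖partialDeriv i φ x‖ ^ 2 := by
  rw [testJet_some, norm_sq_contL2]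
  exact setIntegral_norm_sq_test (partialTest i φ)

/-- Finitely many integrals over sets of finite measure, as a bounded operator. -/
lemma exists_finiteRank {Ω : Opens Plane} (K : Finset (ℤ × ℤ)) {ℓ : ℝ} (hℓ : 0 < ℓ) (c : ℝ) :
    ∃ (n : ℕ) (F : L2 Ω →L[ℂ] EuclideanSpace ℂ (Fin n)), ∀ φ : 𝓓(Ω, ℂ),
      ‖F (testJet φ none)‖ ^ 2 = c ^ 2 * ∑ k ∈ K, ‖∫ x in cell ℓ k, φ x‖ ^ 2 := by
  have hfin : ∀ k, volume.restrict (Ω : Set Plane) (cell ℓ k) ≠ ⊤ := fun k =>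
    ((Measure.restrict_le_self _).trans_lt (measure_cell_lt_top hℓ k)).ne
  -- Integration over a cell is the inner product with its indicator, hence continuous on `L²`.
  let h : ℤ × ℤ → L2 Ω := fun k => indicatorConstLp 2 (measurableSet_cell ℓ k) (hfin k) (1 : ℂ)
  let e := K.equivFin.symm
  refine ⟨K.card, (c : ℂ) • ((PiLp.continuousLinearEquiv 2 ℂ
    (fun _ : Fin K.card => ℂ)).symm : _ →L[ℂ] _).comp
      (ContinuousLinearMap.pi fun j => innerSL ℂ (h (e j))), fun φ => ?_⟩
  rw [smul_apply, norm_smul, mul_pow, Complex.norm_real, Real.norm_eq_abs, sq_abs]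
  congr 1
  rw [EuclideanSpace.norm_sq_eq, ← Finset.sum_coe_sort K, ← e.sum_comp]
  refine Finset.sum_congr rfl fun j _ => ?_
  change ‖inner ℂ (h (e j)) (testJet φ none)‖ ^ 2 = _
  rw [L2.inner_indicatorConstLp_one]
  congr 2
  rw [testJet_none]
  have h1 := ae_restrict_of_ae (s := cell ℓ (e j))
    (coeFn_contL2 (Ω := Ω) φ.continuous φ.hasCompactSupport)
  rw [integral_congr_ae h1, Measure.restrict_restrict (measurableSet_cell ℓ _),
    Set.inter_comm, ← Measure.restrict_restrict Ω.isOpen.measurableSet]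
  refine setIntegral_eq_integral_of_forall_compl_eq_zero fun x hx => ?_
  exact image_eq_zero_of_notMem_tsupport fun h => hx (φ.tsupport_subset h)

/-- Cells of side `ℓ = √ε` make the gradient loss `ℓ²` equal to `ε`. The inequality is closed, so
test functions suffice. -/
lemma coerciveModFinite_brokenGuide {θ : ℝ} (hθ : θ ∈ Set.Ioo 0 (Real.pi / 2)) :
    CoerciveModFinite (brokenGuide θ) := by
  intro ε hε
  have hℓ : 0 < √ε := Real.sqrt_pos.mpr hε
  obtain ⟨K, hK⟩ := exists_finset_box_subset (Real.pi / Real.sin θ + Real.pi) hℓ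
  obtain ⟨n, F, hF⟩ := exists_finiteRank (Ω := brokenGuide θ) K hℓ (√ε)⁻¹
  refine ⟨n, F, fun x hx => ?_⟩
  refine H10_induction (p := fun x : Jet (brokenGuide θ) => ‖x none‖ ^ 2 ≤
    (1 + ε) * ∑ i, ‖x (some i)‖ ^ 2 + ‖F (x none)‖ ^ 2) ?_ ?_ hx
  · refine isClosed_le ((continuous_jet_apply _).norm.pow 2) ?_
    refine (continuous_const.mul (continuous_finsetSum _ fun i _ => ?_)).add ?_
    · exact (continuous_jet_apply _).norm.pow 2
    · exact (F.continuous.comp (continuous_jet_apply _)).norm.pow 2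
  · intro φ
    have h1 := integral_norm_sq_le_gradSq_add_box hθ φ
    have h2 := setIntegral_box_le φ.contDiff φ.hasCompactSupport hℓ hK
    rw [Real.sq_sqrt hε.le] at h2
    have h3 : ∑ i, ‖testJet φ (some i)‖ ^ 2 = ∫ x, gradSq φ x := by
      simp_rw [norm_sq_testJet_some, gradSq]
      rw [integral_finsetSum]
      exact fun i _ => integrable_norm_sq (contDiff_partialDeriv φ.contDiff i)
        (hasCompactSupport_partialDeriv φ i)
    rw [norm_sq_testJet_none, h3, hF]
    linarith

end UpperBound

/-! ### Weyl's criterion -/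

section Weyl

variable {d : ℕ} {Ω : Opens (EuclideanSpace ℝ (Fin d))}

/-- A bounded sequence of separated approximate eigenvectors prevents `A - z` from being
Fredholm. -/
lemma not_isFredholm_of_separated {z : ℂ} {u g : ℕ → L2 Ω} (hu : ∀ n, MemH10 (u n))
    (hg : ∀ n, IsWeakLaplacian (u n) (-g n)) {M c : ℝ} (hM : ∀ n, ‖u n‖ ≤ M) (hc : 0 < c)
    (hsep : ∀ n m, n ≠ m → c ≤ ‖u n - u m‖)
    (hlim : Filter.Tendsto (fun n => g n - z • u n) Filter.atTop (nhds 0)) :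
    ¬ IsFredholm (subScalar (dirichletLaplacian Ω) z) := by
  rw [isFredholm_subScalar_iff]
  intro hF
  set T : L2 Ω →L[ℂ] L2 Ω := 1 - (z + 1) • resolventOp Ω with hT
  -- Since `g n = A (u n)`, the sequence to feed to `T` is `(A + 1) (u n) = g n + u n`; its image
  -- under `T` is `(A - z) (u n)`.
  have hR : ∀ n, resolventOp Ω (g n + u n) = u n := fun n => by
    rw [resolventOp_eq_iff, add_sub_cancel_right]
    exact ⟨hu n, hg n⟩
  have hTf : ∀ n, T (g n + u n) = g n - z • u n := fun n => by
    change g n + u n - (z + 1) • resolventOp Ω (g n + u n) = _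
    rw [hR, add_smul, one_smul]
    abel
  obtain ⟨M', hM'⟩ := hlim.norm.bddAbove_range
  have hb : ∀ n, ‖g n + u n‖ ≤ M' + ‖z + 1‖ * M := fun n => by
    have e : g n + u n = (g n - z • u n) + (z + 1) • u n := by
      rw [add_smul, one_smul]
      abel
    rw [e]
    refine (norm_add_le _ _).trans (add_le_add (hM' ⟨n, rfl⟩) ?_)
    rw [norm_smul]
    exact mul_le_mul_of_nonneg_left (hM n) (norm_nonneg _)
  obtain ⟨a, φ, hφ, hconv⟩ := exists_tendsto_subseq_of_isFredholm T hF hb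
    (hlim.congr fun n => (hTf n).symm)
  -- Continuity of the resolvent turns convergence of the sources into convergence of `u (φ n)`,
  -- against the separation.
  have hu' : Filter.Tendsto (fun n => u (φ n)) Filter.atTop (nhds (resolventOp Ω a)) :=
    (((resolventOp Ω).continuous.tendsto a).comp hconv).congr fun n => hR (φ n)
  obtain ⟨N, hN⟩ := Metric.cauchySeq_iff.mp hu'.cauchySeq c hc
  have h1 := hN N le_rfl (N + 1) (Nat.le_succ N)
  rw [dist_eq_norm] at h1
  exact absurd (hsep _ _ (hφ.injective.ne (Nat.succ_ne_self N).symm)) (not_le.mpr h1)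

end Weyl

/-! ### Products of functions of the coordinates -/

section Tensor

/-- The function `x ↦ a(s) p(t)`, where `(s, t)` are the coordinates of `x` in the basis `b`. -/
def tensor (b : OrthonormalBasis (Fin 2) ℝ Plane) (a p : ℝ → ℂ) (x : Plane) : ℂ :=
  a (b.repr x 0) * p (b.repr x 1)

variable (b : OrthonormalBasis (Fin 2) ℝ Plane) {a p : ℝ → ℂ}

lemma contDiff_tensor (ha : ContDiff ℝ ∞ a) (hp : ContDiff ℝ ∞ p) :
    ContDiff ℝ ∞ (tensor b a p) := by
  have h : ∀ i : Fin 2, ContDiff ℝ ∞ fun x : Plane => b.repr x i := fun i => by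
    simp_rw [OrthonormalBasis.repr_apply_apply]
    exact contDiff_const.inner ℝ contDiff_id
  exact (ha.comp (h 0)).mul (hp.comp (h 1))

lemma tsupport_tensor_subset (ha : HasCompactSupport a) (hp : HasCompactSupport p) :
    tsupport (tensor b a p) ⊆ frame b '' (tsupport a ×ˢ tsupport p) := by
  refine closure_minimal ?_ ((ha.isCompact.prod hp.isCompact).image (continuous_frame b)).isClosed
  intro x hx
  rw [Function.mem_support, tensor, mul_ne_zero_iff] at hx
  refine ⟨(b.repr x 0, b.repr x 1), ⟨subset_tsupport _ hx.1, subset_tsupport _ hx.2⟩, ?_⟩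
  refine b.repr.injective ?_
  rw [repr_frame]
  ext i
  fin_cases i <;> rfl

lemma hasCompactSupport_tensor (ha : HasCompactSupport a) (hp : HasCompactSupport p) :
    HasCompactSupport (tensor b a p) :=
  ((ha.isCompact.prod hp.isCompact).image (continuous_frame b)).of_isClosed_subset
    (isClosed_tsupport _) (tsupport_tensor_subset b ha hp)

lemma fderiv_tensor (ha : ContDiff ℝ ∞ a) (hp : ContDiff ℝ ∞ p) (x w : Plane) :
    fderiv ℝ (tensor b a p) x w =
      (b.repr w 0 : ℂ) * tensor b (deriv a) p x + (b.repr w 1 : ℂ) * tensor b a (deriv p) x := by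
  have hl : ∀ i : Fin 2, HasFDerivAt (fun x : Plane => b.repr x i) (innerSL ℝ (b i)) x := by
    intro i
    simp_rw [OrthonormalBasis.repr_apply_apply]
    exact (innerSL ℝ (b i)).hasFDerivAt
  have h1 := ((ha.differentiable (by simp) (b.repr x 0)).hasDerivAt.hasFDerivAt).comp x (hl 0)
  have h2 := ((hp.differentiable (by simp) (b.repr x 1)).hasDerivAt.hasFDerivAt).comp x (hl 1)
  have h3 : HasFDerivAt (tensor b a p) _ x := h1.mul h2
  rw [h3.fderiv]
  simp [tensor, OrthonormalBasis.repr_apply_apply]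
  ring

lemma partialDeriv_tensor (ha : ContDiff ℝ ∞ a) (hp : ContDiff ℝ ∞ p) (i : Fin 2) (x : Plane) :
    partialDeriv i (tensor b a p) x = (b.repr (EuclideanSpace.single i 1) 0 : ℂ) *
      tensor b (deriv a) p x + (b.repr (EuclideanSpace.single i 1) 1 : ℂ) *
        tensor b a (deriv p) x :=
  fderiv_tensor b ha hp x _

/-- The Laplacian can be computed in any orthonormal basis; in `b` it is `∂ₛ² + ∂ₜ²` and separates.
-/
lemma laplacian_tensor (ha : ContDiff ℝ ∞ a) (hp : ContDiff ℝ ∞ p) (x : Plane) :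
    Laplacian.laplacian (tensor b a p) x =
      tensor b (deriv (deriv a)) p x + tensor b a (deriv (deriv p)) x := by
  have ha' : ContDiff ℝ ∞ (deriv a) := (contDiff_infty_iff_deriv.mp ha).2
  have hp' : ContDiff ℝ ∞ (deriv p) := (contDiff_infty_iff_deriv.mp hp).2
  have hd : DifferentiableAt ℝ (fderiv ℝ (tensor b a p)) x :=
    (((contDiff_tensor b ha hp).fderiv_right (m := ∞) (by simp)).differentiable (by simp)) x
  have key : ∀ w : Plane, fderiv ℝ (fderiv ℝ (tensor b a p)) x w w =
      fderiv ℝ (fun y => fderiv ℝ (tensor b a p) y w) x w := fun w => by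
    rw [fderiv_clm_apply hd (differentiableAt_const _)]
    simp
  rw [InnerProductSpace.laplacian_eq_iteratedFDeriv_orthonormalBasis _ b]
  simp only [iteratedFDeriv_two_apply, Fin.sum_univ_two, Matrix.cons_val_zero, Matrix.cons_val_one,
    key]
  have e0 : (fun y => fderiv ℝ (tensor b a p) y (b 0)) = tensor b (deriv a) p := by
    ext y
    rw [fderiv_tensor b ha hp]
    simp
  have e1 : (fun y => fderiv ℝ (tensor b a p) y (b 1)) = tensor b a (deriv p) := by
    ext y
    rw [fderiv_tensor b ha hp]
    simp
  rw [e0, e1, fderiv_tensor b ha' hp, fderiv_tensor b ha hp']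
  simp

lemma setIntegral_norm_sq_tensor (I : Set ℝ) (a p : ℝ → ℂ) :
    ∫ x in {x : Plane | b.repr x 1 ∈ I}, ‖tensor b a p x‖ ^ 2 =
      (∫ s, ‖a s‖ ^ 2) * ∫ t in I, ‖p t‖ ^ 2 := by
  rw [← setIntegral_frame b]
  have h : frame b ⁻¹' {x : Plane | b.repr x 1 ∈ I} = Set.univ ×ˢ I := by
    ext q
    simp [repr_frame]
  rw [h, Measure.volume_eq_prod, ← Measure.prod_restrict, Measure.restrict_univ,
    ← integral_prod_mul (L := ℝ) (fun s => ‖a s‖ ^ 2) (fun t => ‖p t‖ ^ 2)]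
  refine integral_congr_ae (Filter.Eventually.of_forall fun q => ?_)
  simp [tensor, repr_frame, mul_pow]

/-- The derivative of a test function of one variable. -/
def derivTest {I : Opens ℝ} (φ : 𝓓(I, ℂ)) : 𝓓(I, ℂ) where
  toFun := deriv φ
  contDiff' := (contDiff_infty_iff_deriv.mp φ.contDiff).2
  hasCompactSupport' := φ.hasCompactSupport.deriv
  tsupport_subset' := (closure_minimal (support_deriv_subset (f := φ)) (isClosed_tsupport _)).trans
    φ.tsupport_subset

lemma derivTest_apply {I : Opens ℝ} (φ : 𝓓(I, ℂ)) (t : ℝ) : derivTest φ t = deriv φ t := rfl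

lemma derivTest_sub {I : Opens ℝ} (φ ψ : 𝓓(I, ℂ)) :
    derivTest (φ - ψ) = derivTest φ - derivTest ψ := by
  ext t
  have e : ((φ - ψ : 𝓓(I, ℂ)) : ℝ → ℂ) = (φ : ℝ → ℂ) - ψ := by
    ext; simp
  rw [derivTest_apply, e, deriv_sub (φ.contDiff.differentiable (by simp) t)
    (ψ.contDiff.differentiable (by simp) t)]
  rfl

end Tensor

/-! ### Quasi-modes along the upper arm -/

section QuasiMode

/-- The class in `L²` of the broken guide of the function `a(s) p(t)`, where `(s, t)` are the
coordinates along the upper arm. -/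
def armL2 (θ : ℝ) {I J : Opens ℝ} (a : 𝓓(I, ℂ)) (p : 𝓓(J, ℂ)) : L2 (brokenGuide θ) :=
  contL2 (brokenGuide θ)
    (contDiff_tensor (guideBasis θ (one_mul 1)) a.contDiff p.contDiff).continuous
    (hasCompactSupport_tensor (guideBasis θ (one_mul 1)) a.hasCompactSupport p.hasCompactSupport)

lemma coeFn_armL2 (θ : ℝ) {I J : Opens ℝ} (a : 𝓓(I, ℂ)) (p : 𝓓(J, ℂ)) :
    armL2 θ a p =ᵐ[volume.restrict (brokenGuide θ : Set Plane)]
      tensor (guideBasis θ (one_mul 1)) a p := coeFn_contL2 _ _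

lemma armL2_sub_right (θ : ℝ) {I J : Opens ℝ} (a : 𝓓(I, ℂ)) (p q : 𝓓(J, ℂ)) :
    armL2 θ a (p - q) = armL2 θ a p - armL2 θ a q := by
  refine Lp.ext ?_
  filter_upwards [coeFn_armL2 θ a (p - q), coeFn_armL2 θ a p, coeFn_armL2 θ a q,
    Lp.coeFn_sub (armL2 θ a p) (armL2 θ a q)] with x h1 h2 h3 h4
  rw [h1, h4, Pi.sub_apply, h2, h3]
  simp [tensor, mul_sub]

lemma armL2_sub_left (θ : ℝ) {I J : Opens ℝ} (a c : 𝓓(I, ℂ)) (p : 𝓓(J, ℂ)) :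
    armL2 θ (a - c) p = armL2 θ a p - armL2 θ c p := by
  refine Lp.ext ?_
  filter_upwards [coeFn_armL2 θ (a - c) p, coeFn_armL2 θ a p, coeFn_armL2 θ c p,
    Lp.coeFn_sub (armL2 θ a p) (armL2 θ c p)] with x h1 h2 h3 h4
  rw [h1, h4, Pi.sub_apply, h2, h3]
  simp [tensor, sub_mul]

lemma armL2_add_left (θ : ℝ) {I J : Opens ℝ} (a c : 𝓓(I, ℂ)) (p : 𝓓(J, ℂ)) :
    armL2 θ (a + c) p = armL2 θ a p + armL2 θ c p := by
  refine Lp.ext ?_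
  filter_upwards [coeFn_armL2 θ (a + c) p, coeFn_armL2 θ a p, coeFn_armL2 θ c p,
    Lp.coeFn_add (armL2 θ a p) (armL2 θ c p)] with x h1 h2 h3 h4
  rw [h1, h4, Pi.add_apply, h2, h3]
  simp [tensor, add_mul]

lemma armL2_smul_left (θ : ℝ) {I J : Opens ℝ} (c : ℂ) (a : 𝓓(I, ℂ)) (p : 𝓓(J, ℂ)) :
    armL2 θ (c • a) p = c • armL2 θ a p := by
  refine Lp.ext ?_
  filter_upwards [coeFn_armL2 θ (c • a) p, coeFn_armL2 θ a p,
    Lp.coeFn_smul c (armL2 θ a p)] with x h1 h2 h3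
  rw [h1, h3, Pi.smul_apply, h2]
  simp [tensor, mul_assoc]

/-- The interval of longitudinal coordinates for which a neighbourhood of the cross section of the
upper arm stays in the upper half plane. -/
def farInterval (θ : ℝ) : Opens ℝ := ⟨Set.Ioi (Real.cos θ / Real.sin θ), isOpen_Ioi⟩

/-- A neighbourhood of the cross section `[0, π]`. -/
def crossInterval : Opens ℝ := ⟨Set.Ioo (-1) (Real.pi + 1), isOpen_Ioo⟩

/-- From `s sin θ > cos θ` and `t > -1` follows `x₂ = s sin θ + t cos θ > 0`, which is why
`farInterval` starts at the cotangent. -/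
lemma mem_brokenGuide_frame_iff {θ : ℝ} (hθ : θ ∈ Set.Ioo 0 (Real.pi / 2)) {x : Plane}
    (hs : (guideBasis θ (one_mul 1)).repr x 0 ∈ farInterval θ)
    (ht : (guideBasis θ (one_mul 1)).repr x 1 ∈ crossInterval) :
    x ∈ brokenGuide θ ↔ (guideBasis θ (one_mul 1)).repr x 1 ∈ Set.Ioo 0 Real.pi := by
  refine mem_brokenGuide_iff_repr hθ (one_mul 1) ?_
  have hsin := sin_pos_of_mem hθ
  have hcos := cos_pos_of_mem hθ
  have h1 : Real.cos θ / Real.sin θ < (guideBasis θ (one_mul 1)).repr x 0 := hs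
  have h2 : -1 < (guideBasis θ (one_mul 1)).repr x 1 := ht.1
  have h3 := Real.sin_sq_add_cos_sq θ
  rw [div_lt_iff₀ hsin, guideBasis_repr_zero] at h1
  rw [guideBasis_repr_one] at h2
  nlinarith

/-- On the support of `a(s) p(t)`, belonging to the guide restricts `t` only. The guide may be
replaced by the full strip, where Fubini applies. -/
lemma norm_sq_armL2 {θ : ℝ} (hθ : θ ∈ Set.Ioo 0 (Real.pi / 2)) (a : 𝓓(farInterval θ, ℂ))
    (p : 𝓓(crossInterval, ℂ)) :
    ‖armL2 θ a p‖ ^ 2 = (∫ s, ‖a s‖ ^ 2) * ∫ t in Set.Ioo 0 Real.pi, ‖p t‖ ^ 2 := by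
  set b := guideBasis θ (one_mul 1) with hb
  have hm : MeasurableSet {x : Plane | b.repr x 1 ∈ Set.Ioo 0 Real.pi} := by
    have : Continuous fun x : Plane => b.repr x 1 := by fun_prop
    exact this.measurable measurableSet_Ioo
  rw [armL2, norm_sq_contL2, ← setIntegral_norm_sq_tensor b,
    ← integral_indicator (brokenGuide θ).isOpen.measurableSet, ← integral_indicator hm]
  congr 1
  ext x
  by_cases h : tensor b a p x = 0
  · have h' : ‖tensor b a p x‖ ^ 2 = 0 := by simp [h]
    have hz : ∀ S : Set Plane, S.indicator (fun x => ‖tensor b a p x‖ ^ 2) x = 0 := fun S =>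
      Set.indicator_apply_eq_zero.mpr fun _ => h'
    exact (hz _).trans (hz _).symm
  · rw [tensor, mul_eq_zero, not_or] at h
    have hs : b.repr x 0 ∈ farInterval θ := a.tsupport_subset (subset_tsupport _ h.1)
    have ht : b.repr x 1 ∈ crossInterval := p.tsupport_subset (subset_tsupport _ h.2)
    have hiff := mem_brokenGuide_frame_iff hθ hs ht
    by_cases hx : x ∈ brokenGuide θ
    · rw [Set.indicator_of_mem (show x ∈ (brokenGuide θ : Set Plane) from hx),
        Set.indicator_of_mem
          (show x ∈ {x : Plane | b.repr x 1 ∈ Set.Ioo 0 Real.pi} from hiff.mp hx)]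
    · rw [Set.indicator_of_notMem (show x ∉ (brokenGuide θ : Set Plane) from hx),
        Set.indicator_of_notMem
          (show x ∉ {x : Plane | b.repr x 1 ∈ Set.Ioo 0 Real.pi} from fun h => hx (hiff.mpr h))]

/-- The product is smooth on the whole plane, so its classical Laplacian is the weak one. Letting
`p` extend past `[0, π]` is what makes this hold with no boundary analysis. -/
lemma isWeakLaplacian_armL2 (θ : ℝ) {I J : Opens ℝ} (a : 𝓓(I, ℂ)) (p : 𝓓(J, ℂ)) :
    IsWeakLaplacian (armL2 θ a p)
      (armL2 θ (derivTest (derivTest a)) p + armL2 θ a (derivTest (derivTest p))) := by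
  intro φ
  set b := guideBasis θ (one_mul 1) with hb
  have h := integral_mul_laplacian_test (contDiff_tensor b a.contDiff p.contDiff) φ
  refine (integral_congr_ae ?_).trans (h.trans (integral_congr_ae ?_))
  · filter_upwards [coeFn_armL2 θ a p] with x hx
    rw [hx]
  · filter_upwards [coeFn_armL2 θ (derivTest (derivTest a)) p,
      coeFn_armL2 θ a (derivTest (derivTest p)),
      Lp.coeFn_add (armL2 θ (derivTest (derivTest a)) p)
        (armL2 θ a (derivTest (derivTest p)))] with x h1 h2 h3
    rw [h3, Pi.add_apply, h1, h2, laplacian_tensor b a.contDiff p.contDiff]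
    rfl

/-- A function `a(s) p(t)` is in `H¹₀` if the transverse factor is a limit in `H¹(0, π)` of
functions with compact support in `(0, π)`. -/
lemma memH10_armL2 {θ : ℝ} (hθ : θ ∈ Set.Ioo 0 (Real.pi / 2)) (a : 𝓓(farInterval θ, ℂ))
    (p : 𝓓(crossInterval, ℂ)) (q : ℕ → 𝓓(crossInterval, ℂ))
    (hq : ∀ n, tsupport (q n) ⊆ Set.Ioo 0 Real.pi)
    (h0 : Filter.Tendsto (fun n => ∫ t in Set.Ioo 0 Real.pi, ‖(p - q n) t‖ ^ 2) Filter.atTop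
      (nhds 0))
    (h1 : Filter.Tendsto (fun n => ∫ t in Set.Ioo 0 Real.pi, ‖derivTest (p - q n) t‖ ^ 2)
      Filter.atTop (nhds 0)) :
    MemH10 (armL2 θ a p) := by
  set b := guideBasis θ (one_mul 1) with hb
  have hsub : ∀ n, tsupport (tensor b a (q n)) ⊆ brokenGuide θ := by
    intro n x hx
    obtain ⟨⟨s, t⟩, ⟨hs, ht⟩, rfl⟩ :=
      tsupport_tensor_subset b a.hasCompactSupport (q n).hasCompactSupport hx
    have e0 : b.repr (frame b (s, t)) 0 = s := by rw [repr_frame]; rfl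
    have e1 : b.repr (frame b (s, t)) 1 = t := by rw [repr_frame]; rfl
    refine (mem_brokenGuide_frame_iff hθ (x := frame b (s, t)) ?_ ?_).mpr ?_
    · rw [← hb, e0]
      exact a.tsupport_subset hs
    · rw [← hb, e1]
      exact (q n).tsupport_subset ht
    · rw [← hb, e1]
      exact hq n ht
  let φ : ℕ → 𝓓(brokenGuide θ, ℂ) := fun n =>
    ⟨tensor b a (q n), contDiff_tensor b a.contDiff (q n).contDiff,
      hasCompactSupport_tensor b a.hasCompactSupport (q n).hasCompactSupport, hsub n⟩
  -- Coefficients expressing `∂ᵢ` through `∂ₛ` and `∂ₜ`.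
  let e : Fin 2 → Fin 2 → ℂ := fun i j => (b.repr (EuclideanSpace.single i 1) j : ℂ)
  let x : Jet (brokenGuide θ) := WithLp.toLp 2 fun o => o.elim (armL2 θ a p)
    fun i => e i 0 • armL2 θ (derivTest a) p + e i 1 • armL2 θ a (derivTest p)
  have hsome : ∀ n i, testJet (φ n) (some i) =
      e i 0 • armL2 θ (derivTest a) (q n) + e i 1 • armL2 θ a (derivTest (q n)) := by
    intro n i
    refine Lp.ext ?_
    filter_upwards [coeFn_contL2 (Ω := brokenGuide θ) (continuous_partialDeriv (φ n) i)
        (hasCompactSupport_partialDeriv (φ n) i), coeFn_armL2 θ (derivTest a) (q n),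
      coeFn_armL2 θ a (derivTest (q n)), Lp.coeFn_add (e i 0 • armL2 θ (derivTest a) (q n))
        (e i 1 • armL2 θ a (derivTest (q n))), Lp.coeFn_smul (e i 0) (armL2 θ (derivTest a) (q n)),
      Lp.coeFn_smul (e i 1) (armL2 θ a (derivTest (q n)))] with y k1 k2 k3 k4 k5 k6
    rw [testJet_some, k1, k4, Pi.add_apply, k5, k6, Pi.smul_apply, Pi.smul_apply, k2, k3]
    exact partialDeriv_tensor b a.contDiff (q n).contDiff i y
  -- By `norm_sq_armL2` the transverse factor enters the norm only through its `L²(0, π)` norm.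
  have small : ∀ (c : 𝓓(farInterval θ, ℂ)) (r : ℕ → 𝓓(crossInterval, ℂ)),
      Filter.Tendsto (fun n => ∫ t in Set.Ioo 0 Real.pi, ‖r n t‖ ^ 2) Filter.atTop (nhds 0) →
      Filter.Tendsto (fun n => armL2 θ c (r n)) Filter.atTop (nhds 0) := by
    intro c r hr
    rw [tendsto_zero_iff_norm_tendsto_zero]
    have h2 := (hr.const_mul (∫ s, ‖c s‖ ^ 2)).sqrt
    rw [mul_zero, Real.sqrt_zero] at h2
    refine h2.congr fun n => ?_
    rw [← norm_sq_armL2 hθ, Real.sqrt_sq (norm_nonneg _)]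
  have conv : ∀ (c : 𝓓(farInterval θ, ℂ)) (r : 𝓓(crossInterval, ℂ))
      (r' : ℕ → 𝓓(crossInterval, ℂ)),
      Filter.Tendsto (fun n => ∫ t in Set.Ioo 0 Real.pi, ‖(r - r' n) t‖ ^ 2) Filter.atTop
        (nhds 0) →
      Filter.Tendsto (fun n => armL2 θ c (r' n)) Filter.atTop (nhds (armL2 θ c r)) := by
    intro c r r' hr
    have h2 := (tendsto_const_nhds (x := armL2 θ c r)).sub (small c _ hr)
    rw [sub_zero] at h2
    refine h2.congr fun n => ?_
    rw [armL2_sub_right, sub_sub_cancel]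
  rw [memH10_iff]
  refine ⟨x, ?_, rfl⟩
  refine mem_closure_of_tendsto (f := fun n => testJet (φ n)) (b := Filter.atTop) ?_
    (Filter.Eventually.of_forall fun n => ⟨φ n, rfl⟩)
  have : Filter.Tendsto (fun n => WithLp.ofLp (testJet (φ n))) Filter.atTop
      (nhds (WithLp.ofLp x)) := by
    rw [tendsto_pi_nhds]
    intro o
    cases o with
    | none => exact conv a p q h0
    | some i =>
      refine Filter.Tendsto.congr (fun n => (hsome n i).symm) ?_
      refine ((conv (derivTest a) p q h0).const_smul (e i 0)).add
        ((conv a (derivTest p) (fun n => derivTest (q n)) ?_).const_smul (e i 1))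
      refine h1.congr fun n => ?_
      rw [derivTest_sub]
  exact ((PiLp.continuous_toLp 2 _).tendsto _).comp this

end QuasiMode

/-! ### The transverse profile -/

section Transverse

/-- A smooth cutoff, equal to `1` on `[0, π]`. -/
def crossBump : ContDiffBump (Real.pi / 2) :=
  ⟨Real.pi / 2, Real.pi / 2 + 1 / 2, by positivity, by linarith⟩

lemma crossBump_eq_one {t : ℝ} (ht : t ∈ Set.Icc 0 Real.pi) : crossBump t = 1 := by
  refine crossBump.one_of_mem_closedBall ?_
  rw [Metric.mem_closedBall, Real.dist_eq, abs_le]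
  change -(Real.pi / 2) ≤ _ ∧ _ ≤ Real.pi / 2
  constructor <;> linarith [ht.1, ht.2]

lemma tsupport_crossBump : tsupport crossBump = Set.Icc (-1 / 2) (Real.pi + 1 / 2) := by
  rw [crossBump.tsupport_eq, Real.closedBall_eq_Icc]
  change Set.Icc (Real.pi / 2 - (Real.pi / 2 + 1 / 2)) (Real.pi / 2 + (Real.pi / 2 + 1 / 2)) = _
  congr 1 <;> ring

lemma tsupport_crossBump_subset : tsupport crossBump ⊆ crossInterval := by
  rw [tsupport_crossBump]
  exact fun t ht => ⟨by linarith [ht.1], by linarith [ht.2]⟩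

/-- The product of the cutoff and of a smooth function, as a test function. -/
def crossMul (f : ℝ → ℝ) (hf : ContDiff ℝ ∞ f) : 𝓓(crossInterval, ℂ) where
  toFun := fun t => ((crossBump t * f t : ℝ) : ℂ)
  contDiff' := Complex.ofRealCLM.contDiff.comp (crossBump.contDiff.mul hf)
  hasCompactSupport' := (crossBump.hasCompactSupport.mul_right (f' := f)).comp_left
    (g := Complex.ofReal) Complex.ofReal_zero
  tsupport_subset' := by
    refine (closure_mono ?_).trans tsupport_crossBump_subset
    intro t ht h
    exact ht (by simp [h])

lemma crossMul_apply {f : ℝ → ℝ} (hf : ContDiff ℝ ∞ f) {t : ℝ} (ht : t ∈ Set.Icc 0 Real.pi) :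
    crossMul f hf t = f t := by
  change ((crossBump t * f t : ℝ) : ℂ) = _
  rw [crossBump_eq_one ht, one_mul]

lemma crossMul_eventuallyEq {f : ℝ → ℝ} (hf : ContDiff ℝ ∞ f) {t : ℝ}
    (ht : t ∈ Set.Ioo 0 Real.pi) : (crossMul f hf : ℝ → ℂ) =ᶠ[nhds t] fun t => (f t : ℂ) := by
  filter_upwards [Ioo_mem_nhds ht.1 ht.2] with s hs
  exact crossMul_apply hf (Set.Ioo_subset_Icc_self hs)

lemma derivTest_crossMul {f : ℝ → ℝ} (hf : ContDiff ℝ ∞ f) {t : ℝ} (ht : t ∈ Set.Ioo 0 Real.pi) :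
    derivTest (crossMul f hf) t = ((deriv f t : ℝ) : ℂ) := by
  rw [derivTest_apply, (crossMul_eventuallyEq hf ht).deriv_eq]
  exact ((hf.differentiable (by simp) t).hasDerivAt.ofReal_comp).deriv

lemma derivTest_derivTest_crossMul {f : ℝ → ℝ} (hf : ContDiff ℝ ∞ f) {t : ℝ}
    (ht : t ∈ Set.Ioo 0 Real.pi) :
    derivTest (derivTest (crossMul f hf)) t = ((deriv (deriv f) t : ℝ) : ℂ) := by
  have h : (derivTest (crossMul f hf) : ℝ → ℂ) =ᶠ[nhds t] fun t => ((deriv f t : ℝ) : ℂ) := by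
    filter_upwards [Ioo_mem_nhds ht.1 ht.2] with s hs
    exact derivTest_crossMul hf hs
  rw [derivTest_apply, h.deriv_eq]
  exact
    (((contDiff_infty_iff_deriv.mp hf).2.differentiable (by simp) t).hasDerivAt.ofReal_comp).deriv

lemma crossMul_sub {f g : ℝ → ℝ} (hf : ContDiff ℝ ∞ f) (hg : ContDiff ℝ ∞ g) :
    crossMul f hf - crossMul g hg = crossMul (f - g) (hf.sub hg) := by
  ext t
  change ((crossBump t * f t : ℝ) : ℂ) - ((crossBump t * g t : ℝ) : ℂ) =
    ((crossBump t * (f t - g t) : ℝ) : ℂ)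
  push_cast
  ring

/-- The function `sin` on the cross section. -/
def crossSin : 𝓓(crossInterval, ℂ) := crossMul Real.sin Real.contDiff_sin

/-- A truncation of `sin`, vanishing where `sin ≤ 1 / (n + 1)`. -/
def truncSin (n : ℕ) (t : ℝ) : ℝ :=
  Real.sin t * Real.smoothTransition ((n + 1) * Real.sin t - 1)

lemma contDiff_truncSin (n : ℕ) : ContDiff ℝ ∞ (truncSin n) :=
  Real.contDiff_sin.mul (Real.smoothTransition.contDiff.comp
    ((contDiff_const.mul Real.contDiff_sin).sub contDiff_const))

lemma sin_nonpos_of_notMem {t : ℝ} (ht : t ∈ Set.Icc (-1 / 2) (Real.pi + 1 / 2))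
    (h : t ∉ Set.Ioo 0 Real.pi) : Real.sin t ≤ 0 := by
  have hpi := Real.pi_gt_three
  by_cases h0 : 0 < t
  · have h1 : Real.pi ≤ t := by
      by_contra! h1
      exact h ⟨h0, h1⟩
    have h2 := Real.sin_nonneg_of_nonneg_of_le_pi (x := t - Real.pi) (by linarith)
      (by linarith [ht.2])
    rw [Real.sin_sub_pi] at h2
    linarith
  · exact Real.sin_nonpos_of_nonpos_of_neg_pi_le (not_lt.mp h0) (by linarith [ht.1])

/-- The truncation lives in the closed set `(n + 1) sin t ≥ 1`, whereas `sin ≤ 0` at the points of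
the cutoff's support outside `(0, π)`. -/
lemma tsupport_crossMul_truncSin (n : ℕ) :
    tsupport (crossMul (truncSin n) (contDiff_truncSin n)) ⊆ Set.Ioo 0 Real.pi := by
  have hcl : IsClosed (Set.Icc (-1 / 2) (Real.pi + 1 / 2) ∩
      {t : ℝ | 1 ≤ ((n : ℝ) + 1) * Real.sin t}) :=
    isClosed_Icc.inter (isClosed_le continuous_const (by fun_prop))
  have h1 : tsupport (crossMul (truncSin n) (contDiff_truncSin n)) ⊆
      Set.Icc (-1 / 2) (Real.pi + 1 / 2) ∩ {t : ℝ | 1 ≤ ((n : ℝ) + 1) * Real.sin t} := by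
    refine closure_minimal (fun t ht => ⟨?_, ?_⟩) hcl
    · rw [← tsupport_crossBump]
      refine subset_tsupport _ fun h => ht ?_
      change ((crossBump t * truncSin n t : ℝ) : ℂ) = 0
      rw [h, zero_mul, Complex.ofReal_zero]
    · by_contra h
      refine ht ?_
      change ((crossBump t * truncSin n t : ℝ) : ℂ) = 0
      have h' : ((n : ℝ) + 1) * Real.sin t < 1 := not_le.mp h
      rw [truncSin, Real.smoothTransition.zero_of_nonpos (by linarith), mul_zero, mul_zero,
        Complex.ofReal_zero]
  intro t ht
  obtain ⟨ht1, ht2⟩ := h1 ht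
  by_contra h
  have h3 := sin_nonpos_of_notMem ht1 h
  have h4 : 1 ≤ ((n : ℝ) + 1) * Real.sin t := ht2
  have h5 : (0 : ℝ) < n + 1 := by positivity
  nlinarith

/-- The derivative vanishes unless `1 ≤ y ≤ 2`. With `y = (n + 1) sin t`, the bound absorbs the
factor `n + 1` produced by differentiating the truncation. -/
lemma exists_bound_mul_deriv_smoothTransition :
    ∃ C : ℝ, ∀ y, |y * deriv Real.smoothTransition (y - 1)| ≤ C := by
  have hc : Continuous fun y : ℝ => y * deriv Real.smoothTransition (y - 1) := by
    have := (Real.smoothTransition.contDiff (n := 1)).continuous_deriv le_rfl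
    fun_prop
  have hs : HasCompactSupport fun y : ℝ => y * deriv Real.smoothTransition (y - 1) := by
    refine HasCompactSupport.intro (isCompact_Icc (a := (1 : ℝ)) (b := 2)) fun y hy => ?_
    have h0 : deriv Real.smoothTransition (y - 1) = 0 := by
      rw [Set.mem_Icc, not_and_or, not_le, not_le] at hy
      rcases hy with hy | hy
      · have : Real.smoothTransition =ᶠ[nhds (y - 1)] fun _ => (0 : ℝ) := by
          filter_upwards [Iio_mem_nhds (show y - 1 < 0 by linarith)] with s hs
          exact Real.smoothTransition.zero_of_nonpos (le_of_lt hs)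
        rw [this.deriv_eq, deriv_const]
      · have : Real.smoothTransition =ᶠ[nhds (y - 1)] fun _ => (1 : ℝ) := by
          filter_upwards [Ioi_mem_nhds (show 1 < y - 1 by linarith)] with s hs
          exact Real.smoothTransition.one_of_one_le (le_of_lt hs)
        rw [this.deriv_eq, deriv_const]
    rw [h0, mul_zero]
  exact hc.bounded_above_of_compact_support hs

lemma abs_sub_truncSin_le (n : ℕ) (t : ℝ) : |Real.sin t - truncSin n t| ≤ 1 := by
  have h1 := Real.smoothTransition.nonneg (((n : ℝ) + 1) * Real.sin t - 1)
  have h2 := Real.smoothTransition.le_one (((n : ℝ) + 1) * Real.sin t - 1)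
  have e : Real.sin t - truncSin n t =
      Real.sin t * (1 - Real.smoothTransition (((n : ℝ) + 1) * Real.sin t - 1)) := by
    rw [truncSin]
    ring
  rw [e, abs_mul]
  exact mul_le_one₀ (Real.abs_sin_le_one t) (abs_nonneg _) (abs_le.mpr ⟨by linarith, by linarith⟩)

lemma exists_bound_deriv_sub_truncSin :
    ∃ C : ℝ, ∀ (n : ℕ) (t : ℝ), |deriv (Real.sin - truncSin n) t| ≤ C := by
  obtain ⟨C, hC⟩ := exists_bound_mul_deriv_smoothTransition
  refine ⟨1 + C, fun n t => ?_⟩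
  set y : ℝ := (n + 1) * Real.sin t with hy
  have hT : HasDerivAt Real.smoothTransition (deriv Real.smoothTransition (y - 1)) (y - 1) :=
    ((Real.smoothTransition.contDiff (n := 1)).differentiable (by simp) _).hasDerivAt
  have hin : HasDerivAt (fun t : ℝ => ((n : ℝ) + 1) * Real.sin t - 1) ((n + 1) * Real.cos t) t :=
    ((Real.hasDerivAt_sin t).const_mul _).sub_const _
  have hcomp : HasDerivAt (fun t => Real.smoothTransition (((n : ℝ) + 1) * Real.sin t - 1))
      (deriv Real.smoothTransition (y - 1) * ((n + 1) * Real.cos t)) t :=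
    HasDerivAt.comp (h₂ := Real.smoothTransition) t hT hin
  have hd : HasDerivAt (Real.sin - truncSin n) _ t :=
    (Real.hasDerivAt_sin t).sub ((Real.hasDerivAt_sin t).mul hcomp)
  rw [hd.deriv]
  have e : Real.cos t - (Real.cos t * Real.smoothTransition (((n : ℝ) + 1) * Real.sin t - 1) +
      Real.sin t * (deriv Real.smoothTransition (y - 1) * ((n + 1) * Real.cos t))) =
      Real.cos t * ((1 - Real.smoothTransition (y - 1)) -
        y * deriv Real.smoothTransition (y - 1)) := by
    rw [hy]
    ring
  rw [e, abs_mul]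
  have h1 := Real.smoothTransition.nonneg (y - 1)
  have h2 := Real.smoothTransition.le_one (y - 1)
  have h3 : |(1 - Real.smoothTransition (y - 1)) - y * deriv Real.smoothTransition (y - 1)| ≤
      1 + C :=
    (abs_sub _ _).trans (add_le_add (abs_le.mpr ⟨by linarith, by linarith⟩) (hC y))
  calc _ ≤ 1 * (1 + C) := mul_le_mul (Real.abs_cos_le_one t) h3 (abs_nonneg _) zero_le_one
    _ = _ := one_mul _

lemma eventually_sub_truncSin {t : ℝ} (ht : t ∈ Set.Ioo 0 Real.pi) :
    ∀ᶠ n : ℕ in Filter.atTop, (Real.sin - truncSin n) =ᶠ[nhds t] fun _ => (0 : ℝ) := by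
  have hs := Real.sin_pos_of_mem_Ioo ht
  obtain ⟨N, hN⟩ := exists_nat_gt (2 / Real.sin t)
  filter_upwards [Filter.eventually_ge_atTop N] with n hn
  rw [div_lt_iff₀ hs] at hN
  have h1 : (N : ℝ) ≤ n := by exact_mod_cast hn
  have h2 : 2 < ((n : ℝ) + 1) * Real.sin t := by nlinarith
  have hc : Continuous fun t : ℝ => ((n : ℝ) + 1) * Real.sin t := by fun_prop
  filter_upwards [hc.continuousAt.eventually (lt_mem_nhds h2)] with s hs
  simp only [Pi.sub_apply, truncSin]
  rw [Real.smoothTransition.one_of_one_le (by linarith), mul_one, sub_self]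

lemma tendsto_setIntegral_zero {F : ℕ → ℝ → ℂ} (hF : ∀ n, Continuous (F n)) {C : ℝ}
    (hC : ∀ n, ∀ t ∈ Set.Ioo 0 Real.pi, ‖F n t‖ ≤ C)
    (h0 : ∀ t ∈ Set.Ioo 0 Real.pi, ∀ᶠ n in Filter.atTop, F n t = 0) :
    Filter.Tendsto (fun n => ∫ t in Set.Ioo 0 Real.pi, ‖F n t‖ ^ 2) Filter.atTop (nhds 0) := by
  have h := tendsto_integral_of_dominated_convergence (μ := volume.restrict (Set.Ioo 0 Real.pi))
    (F := fun n t => ‖F n t‖ ^ 2) (f := fun _ => (0 : ℝ)) (fun _ => C ^ 2)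
    (fun n => ((hF n).norm.pow 2).aestronglyMeasurable) (integrable_const _)
    (fun n => by
      filter_upwards [ae_restrict_mem measurableSet_Ioo] with t ht
      rw [Real.norm_eq_abs, abs_pow, abs_norm]
      exact pow_le_pow_left₀ (norm_nonneg _) (hC n t ht) 2)
    (by
      filter_upwards [ae_restrict_mem measurableSet_Ioo] with t ht
      refine tendsto_const_nhds.congr' ?_
      filter_upwards [h0 t ht] with n hn
      rw [hn, norm_zero, zero_pow two_ne_zero])
  simpa using h

/-- Each truncation equals `sin` near a given point of `(0, π)` once `n` is large, and the errors
and their derivatives are bounded uniformly in `n`; dominated convergence gives convergence in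
`H¹(0, π)`. -/
lemma memH10_armL2_crossSin {θ : ℝ} (hθ : θ ∈ Set.Ioo 0 (Real.pi / 2))
    (a : 𝓓(farInterval θ, ℂ)) : MemH10 (armL2 θ a crossSin) := by
  have hsub : ∀ n, crossSin - crossMul (truncSin n) (contDiff_truncSin n) =
      crossMul (Real.sin - truncSin n) (Real.contDiff_sin.sub (contDiff_truncSin n)) :=
    fun n => crossMul_sub _ _
  refine memH10_armL2 hθ a crossSin (fun n => crossMul (truncSin n) (contDiff_truncSin n))
    tsupport_crossMul_truncSin ?_ ?_
  · simp_rw [hsub]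
    refine tendsto_setIntegral_zero (C := 1) (fun n => TestFunction.continuous _) ?_ ?_
    · intro n t ht
      rw [crossMul_apply _ (Set.Ioo_subset_Icc_self ht), Complex.norm_real]
      exact abs_sub_truncSin_le n t
    · intro t ht
      filter_upwards [eventually_sub_truncSin ht] with n hn
      rw [crossMul_apply _ (Set.Ioo_subset_Icc_self ht), hn.eq_of_nhds, Complex.ofReal_zero]
  · simp_rw [hsub]
    obtain ⟨C, hC⟩ := exists_bound_deriv_sub_truncSin
    refine tendsto_setIntegral_zero (C := C) (fun n => TestFunction.continuous _) ?_ ?_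
    · intro n t ht
      rw [derivTest_crossMul _ ht, Complex.norm_real]
      exact hC n t
    · intro t ht
      filter_upwards [eventually_sub_truncSin ht] with n hn
      rw [derivTest_crossMul _ ht, hn.deriv_eq, deriv_const, Complex.ofReal_zero]

/-- The cutoff spoils `sin'' = -sin` outside `[0, π]`, but the norm on the guide sees only `(0, π)`.
-/
lemma armL2_deriv_deriv_crossSin {θ : ℝ} (hθ : θ ∈ Set.Ioo 0 (Real.pi / 2))
    (a : 𝓓(farInterval θ, ℂ)) :
    armL2 θ a (derivTest (derivTest crossSin)) = -armL2 θ a crossSin := by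
  have e : armL2 θ a (derivTest (derivTest crossSin) - -crossSin) = 0 := by
    rw [← norm_eq_zero, ← sq_eq_zero_iff, norm_sq_armL2 hθ]
    refine mul_eq_zero_of_right _ ?_
    rw [setIntegral_congr_fun (g := fun _ => (0 : ℝ)) measurableSet_Ioo]
    · simp
    · intro t ht
      have h1 := derivTest_derivTest_crossMul Real.contDiff_sin ht
      have h2 := crossMul_apply Real.contDiff_sin (Set.Ioo_subset_Icc_self ht)
      have h3 : (derivTest (derivTest crossSin) - -crossSin) t = 0 := by
        change derivTest (derivTest crossSin) t - -(crossSin t) = 0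
        rw [crossSin, h1, h2]
        simp
      change ‖(derivTest (derivTest crossSin) - -crossSin) t‖ ^ 2 = 0
      rw [h3, norm_zero, zero_pow two_ne_zero]
  have e2 : armL2 θ a (-crossSin) = -armL2 θ a crossSin := by
    have h0 : armL2 θ a (crossSin - crossSin) = 0 := by rw [armL2_sub_right, sub_self]
    have h := armL2_sub_right θ a (crossSin - crossSin) crossSin
    rwa [h0, zero_sub, sub_self, zero_sub] at h
  rw [armL2_sub_right, sub_eq_zero] at e
  rw [e, e2]

lemma setIntegral_crossSin_pos : 0 < ∫ t in Set.Ioo 0 Real.pi, ‖crossSin t‖ ^ 2 := by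
  have e : ∫ t in Set.Ioo 0 Real.pi, ‖crossSin t‖ ^ 2 = ∫ t in 0..Real.pi, Real.sin t ^ 2 := by
    rw [intervalIntegral.integral_of_le Real.pi_pos.le, integral_Ioc_eq_integral_Ioo]
    refine setIntegral_congr_fun measurableSet_Ioo fun t ht => ?_
    simp only [crossSin]
    rw [crossMul_apply _ (Set.Ioo_subset_Icc_self ht), Complex.norm_real, Real.norm_eq_abs, sq_abs]
  rw [e, integral_sin_sq]
  simp
  exact Real.pi_pos

end Transverse

/-! ### The longitudinal profiles -/

section Longitudinal

/-- A smooth bump supported in `(1, 2)`. -/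
def longBump : ContDiffBump (3 / 2 : ℝ) := ⟨1 / 8, 1 / 4, by norm_num, by norm_num⟩

/-- The bump, as a complex valued function. -/
def longBumpC (t : ℝ) : ℂ := (longBump t : ℂ)

lemma contDiff_longBumpC : ContDiff ℝ ∞ longBumpC :=
  Complex.ofRealCLM.contDiff.comp longBump.contDiff

lemma tsupport_longBumpC : tsupport longBumpC ⊆ Set.Icc (5 / 4) (7 / 4) := by
  have h1 : tsupport longBumpC ⊆ tsupport longBump :=
    closure_mono (Function.support_comp_subset Complex.ofReal_zero longBump)
  refine h1.trans ?_
  rw [longBump.tsupport_eq, Real.closedBall_eq_Icc]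
  change Set.Icc ((3 / 2 : ℝ) - 1 / 4) (3 / 2 + 1 / 4) ⊆ _
  norm_num

lemma longBumpC_eq_zero {t : ℝ} (ht : t ∉ Set.Ioo (1 : ℝ) 2) : longBumpC t = 0 := by
  refine image_eq_zero_of_notMem_tsupport fun h => ht ?_
  have := tsupport_longBumpC h
  exact ⟨by linarith [this.1], by linarith [this.2]⟩

lemma hasCompactSupport_longBumpC : HasCompactSupport longBumpC :=
  longBump.hasCompactSupport.comp_left (g := Complex.ofReal) Complex.ofReal_zero

/-- The wave packet `R^{-1/2} χ(s / R) e^{iks}`. -/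
def packet (k R : ℝ) (s : ℝ) : ℂ :=
  ((√R)⁻¹ : ℝ) * longBumpC (s / R) * Complex.exp (Complex.I * k * s)

lemma contDiff_packet (k R : ℝ) : ContDiff ℝ ∞ (packet k R) := by
  have h1 : ContDiff ℝ ∞ fun s : ℝ => longBumpC (s / R) :=
    contDiff_longBumpC.comp (contDiff_id.div_const R)
  have h2 : ContDiff ℝ ∞ fun s : ℝ => Complex.exp (Complex.I * k * s) :=
    (contDiff_const.mul Complex.ofRealCLM.contDiff).cexp
  exact (contDiff_const.mul h1).mul h2

lemma packet_eq_zero {k R : ℝ} (hR : 0 < R) {s : ℝ} (hs : s ∉ Set.Ioo R (2 * R)) :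
    packet k R s = 0 := by
  have h : longBumpC (s / R) = 0 := by
    refine longBumpC_eq_zero fun h => hs ?_
    rw [Set.mem_Ioo, lt_div_iff₀ hR, div_lt_iff₀ hR, one_mul] at h
    exact h
  rw [packet, h, mul_zero, zero_mul]

lemma tsupport_packet_subset {k R : ℝ} (hR : 0 < R) : tsupport (packet k R) ⊆ Set.Icc R (2 * R) :=
  closure_minimal (fun s hs => by
    by_contra h
    exact hs (packet_eq_zero hR fun h' => h (Set.Ioo_subset_Icc_self h'))) isClosed_Icc

lemma norm_exp_I_mul_mul (k s : ℝ) : ‖Complex.exp (Complex.I * k * s)‖ = 1 := by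
  have : Complex.I * k * s = ((k * s : ℝ) : ℂ) * Complex.I := by
    push_cast
    ring
  rw [this, Complex.norm_exp_ofReal_mul_I]

lemma norm_sq_mul_exp {R : ℝ} (hR : 0 < R) (k s : ℝ) (w : ℂ) :
    ‖((√R)⁻¹ : ℝ) * w * Complex.exp (Complex.I * k * s)‖ ^ 2 = R⁻¹ * ‖w‖ ^ 2 := by
  rw [norm_mul, norm_mul, norm_exp_I_mul_mul, mul_one, mul_pow, Complex.norm_real, norm_inv,
    Real.norm_eq_abs, inv_pow, sq_abs, Real.sq_sqrt hR.le]

lemma integral_comp_div_scaled {R : ℝ} (hR : 0 < R) (h : ℝ → ℝ) :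
    ∫ s, R⁻¹ * h (s / R) = ∫ s, h s := by
  rw [integral_const_mul, Measure.integral_comp_div, abs_of_pos hR, smul_eq_mul, ← mul_assoc,
    inv_mul_cancel₀ hR.ne', one_mul]

lemma integral_norm_sq_packet {R : ℝ} (hR : 0 < R) (k : ℝ) :
    ∫ s, ‖packet k R s‖ ^ 2 = ∫ s, ‖longBumpC s‖ ^ 2 := by
  simp_rw [packet, norm_sq_mul_exp hR]
  exact integral_comp_div_scaled hR fun s => ‖longBumpC s‖ ^ 2

lemma integral_longBumpC_pos : 0 < ∫ s, ‖longBumpC s‖ ^ 2 := by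
  have hc : Continuous fun s => ‖longBumpC s‖ ^ 2 := contDiff_longBumpC.continuous.norm.pow 2
  have hs : HasCompactSupport fun s => ‖longBumpC s‖ ^ 2 := by
    refine hasCompactSupport_longBumpC.mono fun s hs h0 => hs ?_
    change ‖longBumpC s‖ ^ 2 = 0
    rw [h0, norm_zero, zero_pow two_ne_zero]
  refine hc.integral_pos_of_hasCompactSupport_nonneg_nonzero hs (fun s => by positivity)
    (x := 3 / 2) ?_
  have h1 : longBump (3 / 2) = 1 :=
    longBump.one_of_mem_closedBall (Metric.mem_closedBall_self longBump.rIn_pos.le)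
  rw [longBumpC, h1]
  simp

/-- The form `c f(s/R) e^{iks}` is stable under differentiation, with `f` becoming `R⁻¹ f' + i k f`;
a second application yields the second derivative. -/
lemma deriv_mul_exp {f : ℝ → ℂ} (hf : ContDiff ℝ ∞ f) (c : ℂ) (k R s : ℝ) :
    deriv (fun s : ℝ => c * f (s / R) * Complex.exp (Complex.I * k * s)) s =
      c * (((R⁻¹ : ℝ) : ℂ) * deriv f (s / R) + Complex.I * k * f (s / R)) *
        Complex.exp (Complex.I * k * s) := by
  have h1 : HasDerivAt (fun s : ℝ => f (s / R)) ((R⁻¹ : ℝ) • deriv f (s / R)) s := by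
    have := (hf.differentiable (by simp) (s / R)).hasDerivAt.scomp s
      ((hasDerivAt_id s).div_const R)
    simpa [Function.comp_def] using this
  have h2 : HasDerivAt (fun s : ℝ => Complex.exp (Complex.I * k * s))
      (Complex.exp (Complex.I * k * s) * (Complex.I * k)) s := by
    have h3 : HasDerivAt (fun s : ℝ => Complex.I * k * (s : ℂ)) (Complex.I * k) s := by
      simpa using ((hasDerivAt_id s).ofReal_comp).const_mul (Complex.I * (k : ℂ))
    exact h3.cexp
  have h4 : HasDerivAt (fun s : ℝ => c * f (s / R) * Complex.exp (Complex.I * k * s)) _ s :=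
    (h1.const_mul c).mul h2
  rw [h4.deriv]
  simp only [Complex.real_smul]
  ring

lemma deriv_deriv_packet (k R s : ℝ) :
    deriv (deriv (packet k R)) s + k ^ 2 * packet k R s =
      ((√R)⁻¹ : ℝ) * (((R⁻¹ : ℝ) : ℂ) * (((R⁻¹ : ℝ) : ℂ) * deriv (deriv longBumpC) (s / R) +
        2 * Complex.I * k * deriv longBumpC (s / R))) * Complex.exp (Complex.I * k * s) := by
  have hX := contDiff_longBumpC
  have hX1 : ContDiff ℝ ∞ (deriv longBumpC) := (contDiff_infty_iff_deriv.mp hX).2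
  have hY : ContDiff ℝ ∞ fun t =>
      ((R⁻¹ : ℝ) : ℂ) * deriv longBumpC t + Complex.I * k * longBumpC t :=
    (contDiff_const.mul hX1).add (contDiff_const.mul hX)
  have e1 : deriv (packet k R) = fun s : ℝ => ((√R)⁻¹ : ℝ) *
      ((fun t => ((R⁻¹ : ℝ) : ℂ) * deriv longBumpC t + Complex.I * k * longBumpC t) (s / R)) *
        Complex.exp (Complex.I * k * s) := by
    ext s
    exact deriv_mul_exp hX ((√R)⁻¹ : ℝ) k R s
  have e2 : deriv (fun t =>
      ((R⁻¹ : ℝ) : ℂ) * deriv longBumpC t + Complex.I * k * longBumpC t) (s / R) =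
      ((R⁻¹ : ℝ) : ℂ) * deriv (deriv longBumpC) (s / R) +
        Complex.I * k * deriv longBumpC (s / R) := by
    have h : HasDerivAt
        (fun t => ((R⁻¹ : ℝ) : ℂ) * deriv longBumpC t + Complex.I * k * longBumpC t) _ (s / R) :=
      ((hX1.differentiable (by simp) _).hasDerivAt.const_mul _).add
        ((hX.differentiable (by simp) _).hasDerivAt.const_mul _)
    exact h.deriv
  rw [e1, deriv_mul_exp hY, e2, packet]
  linear_combination ((√R)⁻¹ : ℝ) * longBumpC (s / R) * Complex.exp (Complex.I * k * s) * k ^ 2 *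
    Complex.I_sq

/-- The `k²` terms cancel and every remaining term has a factor `R⁻¹`. For `R ≥ 1` the rest is
bounded independently of `R`, and the weaker rate `R⁻¹` in place of `R⁻²` suffices. -/
lemma exists_bound_packet (k : ℝ) : ∃ C : ℝ, ∀ R : ℝ, 1 ≤ R →
    ∫ s, ‖deriv (deriv (packet k R)) s + k ^ 2 * packet k R s‖ ^ 2 ≤ R⁻¹ * C := by
  have hX1 : ContDiff ℝ ∞ (deriv longBumpC) := (contDiff_infty_iff_deriv.mp contDiff_longBumpC).2
  have hX2 : ContDiff ℝ ∞ (deriv (deriv longBumpC)) := (contDiff_infty_iff_deriv.mp hX1).2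
  set h : ℝ → ℝ := fun t =>
    (‖deriv (deriv longBumpC) t‖ + ‖2 * Complex.I * k * deriv longBumpC t‖) ^ 2 with hh
  have hc : Continuous h :=
    (hX2.continuous.norm.add (continuous_const.mul hX1.continuous).norm).pow 2
  have hs : HasCompactSupport h := by
    refine (hasCompactSupport_longBumpC.deriv (𝕜 := ℝ)).of_isClosed_subset (isClosed_tsupport _)
      (closure_minimal (fun t ht => ?_) (isClosed_tsupport _))
    by_contra hnot
    refine ht ?_
    have h1 := image_eq_zero_of_notMem_tsupport hnot
    have h2 := image_eq_zero_of_notMem_tsupport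
      (fun hm => hnot (closure_minimal (support_deriv_subset (f := deriv longBumpC))
        (isClosed_tsupport _) hm))
    simp [hh, h1, h2]
  refine ⟨∫ t, h t, fun R hR => ?_⟩
  have hR0 : 0 < R := zero_lt_one.trans_le hR
  have hRi : R⁻¹ ≤ 1 := inv_le_one_of_one_le₀ hR
  have hRi0 : 0 < R⁻¹ := inv_pos.mpr hR0
  simp_rw [deriv_deriv_packet, norm_sq_mul_exp hR0]
  rw [integral_comp_div_scaled hR0 fun t => ‖((R⁻¹ : ℝ) : ℂ) *
    (((R⁻¹ : ℝ) : ℂ) * deriv (deriv longBumpC) t +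
    2 * Complex.I * k * deriv longBumpC t)‖ ^ 2, ← integral_const_mul]
  refine integral_mono_of_nonneg (Filter.Eventually.of_forall fun t => by positivity)
    ((hc.integrable_of_hasCompactSupport hs).const_mul _) (Filter.Eventually.of_forall fun t => ?_)
  have hn : ‖((R⁻¹ : ℝ) : ℂ)‖ = R⁻¹ := by
    rw [Complex.norm_real, Real.norm_eq_abs, abs_of_pos hRi0]
  simp only
  rw [norm_mul, hn, mul_pow]
  have h1 : ‖((R⁻¹ : ℝ) : ℂ) * deriv (deriv longBumpC) t + 2 * Complex.I * k * deriv longBumpC t‖ ≤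
      ‖deriv (deriv longBumpC) t‖ + ‖2 * Complex.I * k * deriv longBumpC t‖ := by
    refine (norm_add_le _ _).trans (add_le_add ?_ le_rfl)
    rw [norm_mul, hn]
    exact mul_le_of_le_one_left (norm_nonneg _) hRi
  have h2 : ‖((R⁻¹ : ℝ) : ℂ) * deriv (deriv longBumpC) t +
      2 * Complex.I * k * deriv longBumpC t‖ ^ 2 ≤ h t := pow_le_pow_left₀ (norm_nonneg _) h1 2
  have h3 : (R⁻¹) ^ 2 ≤ R⁻¹ := by nlinarith
  exact mul_le_mul h3 h2 (by positivity) hRi0.le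

/-- The scales of the wave packets. -/
def scale (θ : ℝ) (n : ℕ) : ℝ := (|Real.cos θ / Real.sin θ| + 1) * 2 ^ n

lemma two_pow_le_scale (θ : ℝ) (n : ℕ) : (2 : ℝ) ^ n ≤ scale θ n :=
  le_mul_of_one_le_left (by positivity) (by linarith [abs_nonneg (Real.cos θ / Real.sin θ)])

lemma one_le_scale (θ : ℝ) (n : ℕ) : 1 ≤ scale θ n :=
  (one_le_pow₀ one_le_two).trans (two_pow_le_scale θ n)

lemma lt_scale (θ : ℝ) (n : ℕ) : Real.cos θ / Real.sin θ < scale θ n := by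
  have h1 : |Real.cos θ / Real.sin θ| + 1 ≤ scale θ n :=
    le_mul_of_one_le_right (by positivity) (one_le_pow₀ one_le_two)
  linarith [le_abs_self (Real.cos θ / Real.sin θ)]

/-- Packet `n` vanishes outside `(scale θ n, 2 * scale θ n)`, so doubling at each step makes the
packets disjoint. -/
lemma two_mul_scale_le (θ : ℝ) {n m : ℕ} (h : n < m) : 2 * scale θ n ≤ scale θ m := by
  have h1 : (2 : ℝ) ^ (n + 1) ≤ 2 ^ m := pow_le_pow_right₀ one_le_two h
  rw [pow_succ] at h1
  have h2 : 0 < |Real.cos θ / Real.sin θ| + 1 := by positivity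
  simp only [scale]
  nlinarith

/-- The wave packets, as test functions on the far part of the arm. -/
def packetTest (θ k : ℝ) (n : ℕ) : 𝓓(farInterval θ, ℂ) where
  toFun := packet k (scale θ n)
  contDiff' := contDiff_packet _ _
  hasCompactSupport' := isCompact_Icc.of_isClosed_subset (isClosed_tsupport _)
    (tsupport_packet_subset (zero_lt_one.trans_le (one_le_scale θ n)))
  tsupport_subset' := (tsupport_packet_subset (zero_lt_one.trans_le (one_le_scale θ n))).trans
    fun _ ht => (lt_scale θ n).trans_le ht.1

lemma coe_packetTest (θ k : ℝ) (n : ℕ) : (packetTest θ k n : ℝ → ℂ) = packet k (scale θ n) := rfl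

lemma packetTest_mul_eq_zero (θ k : ℝ) {n m : ℕ} (h : n ≠ m) (s : ℝ) :
    packetTest θ k n s = 0 ∨ packetTest θ k m s = 0 := by
  wlog hnm : n < m generalizing n m
  · exact (this h.symm (lt_of_le_of_ne (not_lt.mp hnm) h.symm)).symm
  have hn := zero_lt_one.trans_le (one_le_scale θ n)
  have hm := zero_lt_one.trans_le (one_le_scale θ m)
  by_cases hs : s ∈ Set.Ioo (scale θ n) (2 * scale θ n)
  · exact Or.inr (packet_eq_zero hm fun h' =>
      absurd (hs.2.trans_le (two_mul_scale_le θ hnm)) (not_lt.mpr h'.1.le))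
  · exact Or.inl (packet_eq_zero hn hs)

/-- At each point one of the two packets vanishes, so the difference dominates packet `n` pointwise.
-/
lemma integral_norm_sq_packetTest_sub_ge (θ k : ℝ) {n m : ℕ} (h : n ≠ m) :
    ∫ s, ‖longBumpC s‖ ^ 2 ≤ ∫ s, ‖(packetTest θ k n - packetTest θ k m) s‖ ^ 2 := by
  rw [← integral_norm_sq_packet (zero_lt_one.trans_le (one_le_scale θ n)) k, ← coe_packetTest]
  have hc : Continuous fun s => ‖(packetTest θ k n - packetTest θ k m) s‖ ^ 2 :=
    (TestFunction.continuous _).norm.pow 2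
  have hs : HasCompactSupport fun s => ‖(packetTest θ k n - packetTest θ k m) s‖ ^ 2 := by
    refine (packetTest θ k n - packetTest θ k m).hasCompactSupport.mono fun s hs h0 => hs ?_
    change ‖(packetTest θ k n - packetTest θ k m) s‖ ^ 2 = 0
    rw [h0, norm_zero, zero_pow two_ne_zero]
  refine integral_mono_of_nonneg (Filter.Eventually.of_forall fun t => by positivity)
    (hc.integrable_of_hasCompactSupport hs) (Filter.Eventually.of_forall fun s => ?_)
  change ‖packetTest θ k n s‖ ^ 2 ≤ ‖packetTest θ k n s - packetTest θ k m s‖ ^ 2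
  rcases packetTest_mul_eq_zero θ k h s with h0 | h0
  · rw [h0, norm_zero, zero_pow two_ne_zero]
    positivity
  · rw [h0, sub_zero]

end Longitudinal

/-! ### The essential spectrum of the broken guide -/

section Main

/-- The Weyl sequence is packet times `sin`: the transverse factor contributes 1 to the energy and
the oscillation `k²`, up to the remainder of `exists_bound_packet`. The same number `√(X * P)`
bounds the norms above and the mutual distances below. -/
lemma not_isFredholm_brokenGuide {θ : ℝ} (hθ : θ ∈ Set.Ioo 0 (Real.pi / 2)) (k : ℝ) :
    ¬ IsFredholm (subScalar (dirichletLaplacian (brokenGuide θ)) ((1 + k ^ 2 : ℝ) : ℂ)) := by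
  set A : ℕ → 𝓓(farInterval θ, ℂ) := packetTest θ k with hA
  set X := ∫ s, ‖longBumpC s‖ ^ 2 with hX
  set P := ∫ t in Set.Ioo 0 Real.pi, ‖crossSin t‖ ^ 2 with hP
  have hX0 : 0 < X := integral_longBumpC_pos
  have hP0 : 0 < P := setIntegral_crossSin_pos
  have hscale : ∀ n, 0 < scale θ n := fun n => zero_lt_one.trans_le (one_le_scale θ n)
  refine not_isFredholm_of_separated (u := fun n => armL2 θ (A n) crossSin)
    (g := fun n => armL2 θ (A n) crossSin - armL2 θ (derivTest (derivTest (A n))) crossSin)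
    (M := √(X * P)) (c := √(X * P)) (fun n => memH10_armL2_crossSin hθ (A n)) (fun n => ?_)
    (fun n => ?_) (Real.sqrt_pos.mpr (mul_pos hX0 hP0)) (fun n m hnm => ?_) ?_
  · have h := isWeakLaplacian_armL2 θ (A n) crossSin
    rw [armL2_deriv_deriv_crossSin hθ] at h
    rwa [neg_sub, sub_eq_add_neg]
  · refine Real.le_sqrt_of_sq_le ?_
    rw [norm_sq_armL2 hθ, hA, coe_packetTest, integral_norm_sq_packet (hscale n)]
  · rw [← armL2_sub_left, ← Real.sqrt_sq (norm_nonneg (armL2 θ (A n - A m) crossSin)),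
      norm_sq_armL2 hθ]
    exact Real.sqrt_le_sqrt (mul_le_mul_of_nonneg_right
      (integral_norm_sq_packetTest_sub_ge θ k hnm) hP0.le)
  · obtain ⟨C, hC⟩ := exists_bound_packet k
    have e : ∀ n, armL2 θ (A n) crossSin - armL2 θ (derivTest (derivTest (A n))) crossSin -
        ((1 + k ^ 2 : ℝ) : ℂ) • armL2 θ (A n) crossSin =
        -armL2 θ (derivTest (derivTest (A n)) + ((k ^ 2 : ℝ) : ℂ) • A n) crossSin := fun n => by
      rw [armL2_add_left, armL2_smul_left, Complex.ofReal_add, Complex.ofReal_one, add_smul,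
        one_smul]
      abel
    simp_rw [e]
    rw [← neg_zero]
    refine Filter.Tendsto.neg ?_
    rw [tendsto_zero_iff_norm_tendsto_zero]
    have hlim : Filter.Tendsto (fun n : ℕ => √((2⁻¹ : ℝ) ^ n * |C| * P)) Filter.atTop (nhds 0) := by
      have h1 := (((tendsto_pow_atTop_nhds_zero_of_lt_one (r := (2⁻¹ : ℝ)) (by norm_num)
        (by norm_num)).mul_const |C|).mul_const P).sqrt
      simpa using h1
    refine squeeze_zero (fun n => norm_nonneg _) (fun n => ?_) hlim
    refine Real.le_sqrt_of_sq_le ?_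
    rw [norm_sq_armL2 hθ]
    refine mul_le_mul_of_nonneg_right ?_ hP0.le
    have h2 := hC (scale θ n) (one_le_scale θ n)
    have h3 : (scale θ n)⁻¹ ≤ (2⁻¹ : ℝ) ^ n := by
      rw [inv_pow]
      exact inv_anti₀ (by positivity) (two_pow_le_scale θ n)
    have h4 : (scale θ n)⁻¹ * C ≤ (2⁻¹ : ℝ) ^ n * |C| :=
      mul_le_mul_of_nonneg h3 (le_abs_self C) (inv_pos.mpr (hscale n)).le (abs_nonneg C)
    refine le_trans (le_of_eq ?_) (h2.trans h4)
    refine integral_congr_ae (Filter.Eventually.of_forall fun s => ?_)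
    change ‖deriv (deriv (packet k (scale θ n))) s + ((k ^ 2 : ℝ) : ℂ) * packet k (scale θ n) s‖ ^ 2
      = _
    rw [Complex.ofReal_pow]

end Main

end BrokenGuide

end

theorem proposition2p1 (θ : ℝ) (hθ : θ ∈ Set.Ioo 0 (Real.pi / 2)) :
    BrokenGuide.essentialSpectrum (BrokenGuide.dirichletLaplacian (BrokenGuide.brokenGuide θ)) =
      Complex.ofReal '' Set.Ici (1 : ℝ) := by
  ext z
  constructor
  · intro hz
    by_contra h
    exact hz (BrokenGuide.isFredholm_of_coerciveModFinite
      (BrokenGuide.coerciveModFinite_brokenGuide hθ) h)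
  · rintro ⟨r, hr, rfl⟩
    -- The wave number solves `1 + k² = r`, real because `r ≥ 1`.
    have h := BrokenGuide.not_isFredholm_brokenGuide hθ √(r - 1)
    rw [Real.sq_sqrt (sub_nonneg.mpr hr), add_sub_cancel] at h
    exact h
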